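/- Let $d\ge 1$, $\alpha>0$, $\nu\ge 0$, $\gamma>0$, $T>0$, $1\le k\le d$, and let $e_1,\dots,e_d$ be the unit vectors of the discrete torus $\mathbb T_N^d=(\mathbb Z/N\mathbb Z)^d$. For $(q,p)\in\mathbb R^{\mathbb T_N^d}\times\mathbb R^{\mathbb T_N^d}$ let $$\mathcal H_N=\sum_{x}\Big(\frac{p_x^2}{2}+W(q_x)+\frac12\sum_{|y-x|=1}V(q_x-q_y)\Big),\qquad V(r)=\alpha r^2,\quad W(q)=\nu q^2 .$$ Let $(q(t),p(t))_{t\ge0}$ be the Markov process which follows Hamilton's equations of $\mathcal H_N$ and in which, independently for every ordered pair $(x,y)$ with $|x-y|=1$, the momenta $p_x$ and $p_y$ are exchanged at rate $\gamma$ (energy-momentum conserving noise). Its initial law is the Gibbs measure $\mu_{N,T}=Z_{N,T}^{-1}e^{-\mathcal H_N/T}\,dq\,dp$; when $\nu=0$ it is understood as a measure on $p$ and the deformation field (the gradient of $q$), represented by the positions with $\sum_x q_x=0$. Put $$\tilde j_{x,x+e_k}=-\tfrac12V'(q_{x+e_k}-q_x)(p_{x+e_k}+p_x).$$ **(1)**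 For every $t\ge0$ the limit $C(t)=\lim_{N\to\infty}\sum_{x\in\mathbb T_N^d}\mathbb E_{\mu_{N,T}}\big[\tilde j_{0,e_k}(0)\,\tilde j_{x,x+e_k}(t)\big]$ exists and $$C(t)=T^2\int_{[0,1]^d}\frac{2\alpha^2\sin^2(2\pi\xi_k)}{\nu+4\alpha S(\xi)}\,e^{-8\gamma t S(\xi)}\,d\xi,\qquad S(\xi)=\sum_{j=1}^d\sin^2(\pi\xi_j).$$ There is a constant $c>0$ such that, as $t\to\infty$, $C(t)\sim c\,t^{-d/2}$ if $\nu=0$ and $C(t)\sim c\,t^{-d/2-1}$ if $\nu>0$ (the ratio of the two sides tends to $1$). **(2)** For every $t>0$ the two expressions $$\frac{1}{T^2}\,\frac{1}{2N^dt}\,\mathbb E_{\mu_{N,T}}\Big[\Big(\sum_x\int_0^t\tilde j_{x,x+e_k}(s)\,ds\Big)^2\Big]+\gamma,\qquad \frac1{T^2}\sum_x\int_0^\infty\Big(1-\frac st\Big)^+\mathbb E_{\mu_{N,T}}\big[\tilde j_{0,e_k}(0)\,\tilde j_{x,x+e_k}(s)\big]ds+\gamma$$ converge as $N\to\infty$ to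 the same real number $K(t)$, and the Green–Kubo conductivity $\kappa(T)=\lim_{t\to\infty}K(t)$ exists in $(0,+\infty]$. It does not depend on $T$; it is finite if and only if $d\ge3$ or $\nu>0$, and then $$\kappa(T)=\gamma+\frac{\alpha^2}{4\gamma}\int_{[0,1]^d}\frac{\sin^2(2\pi\xi_k)}{(\nu+4\alpha S(\xi))\,S(\xi)}\,d\xi ,$$ the integral being convergent. (The Gibbs measures are probability measures and all the expectations and time integrals above are well defined.) -/

import Mathlib

open MeasureTheory ProbabilityTheory Filter Topology Set

noncomputable section

namespace ExchangeChain

/-- Sites of the discrete torus of side `N` in dimension `d`. -/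
abbrev Site (d N : ℕ) := Fin d → ZMod N

/-- The `2 d` unit directions `± e_j`, encoded by `j` and a sign. -/
abbrev Dir (d : ℕ) := Fin d × Bool

/-- Real fields on the torus. -/
abbrev Config (d N : ℕ) [NeZero N] := EuclideanSpace ℝ (Site d N)

/-- Phase space: a configuration is a pair `(q, p)` of positions and momenta. -/
abbrev Phase (d N : ℕ) [NeZero N] := Config d N × Config d N

/-- The neighbour of `x` in the given direction, that is `x + e_j` or `x - e_j`. -/
def nbr {d N : ℕ} (x : Site d N) (e : Dir d) : Site d N :=
  x + Pi.single e.1 (if e.2 then 1 else -1)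

section Model

variable {d N : ℕ} [NeZero N]

/-- Energy of the atom at `x`, with interaction potential `V` and pinning potential `W`. -/
def siteEnergy (V W : ℝ → ℝ) (ω : Phase d N) (x : Site d N) : ℝ :=
  (ω.2 x) ^ 2 / 2 + W (ω.1 x) + (1 / 2) * ∑ e : Dir d, V (ω.1 x - ω.1 (nbr x e))

/-- The Hamiltonian with periodic boundary conditions. -/
def hamiltonian (V W : ℝ → ℝ) (ω : Phase d N) : ℝ := ∑ x, siteEnergy V W ω x

/-- The Hamiltonian part of the instantaneous energy current from `x` to `x + e_k`. -/
def current (V : ℝ → ℝ) (k : Fin d) (x : Site d N) (ω : Phase d N) : ℝ :=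
  -(1 / 2) * deriv V (ω.1 (nbr x (k, true)) - ω.1 x) * (ω.2 (nbr x (k, true)) + ω.2 x)

/-- The harmonic interaction potential. -/
def harmV (α : ℝ) : ℝ → ℝ := fun r => α * r ^ 2

/-- The harmonic pinning potential. -/
def harmW (ν : ℝ) : ℝ → ℝ := fun q => ν * q ^ 2

/-- The (linear) vector field of Newton's equations for the harmonic potentials:
`q_x' = p_x`, `p_x' = - W'(q_x) - ∑_{|y-x|=1} V'(q_x - q_y)`. -/
def newtonField (α ν : ℝ) : Phase d N →ₗ[ℝ] Phase d N where
  toFun ω := (ω.2, WithLp.toLp 2 fun x =>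
    -(2 * ν * ω.1 x) - ∑ e : Dir d, 2 * α * (ω.1 x - ω.1 (nbr x e)))
  map_add' ω ω' := by
    refine Prod.ext rfl ?_
    ext x
    simp only [Prod.fst_add, PiLp.add_apply, Prod.mk_add_mk]
    rw [sub_add_sub_comm, ← Finset.sum_add_distrib]
    congr 1
    · ring
    · exact Finset.sum_congr rfl fun e _ => by ring
  map_smul' c ω := by
    refine Prod.ext rfl ?_
    ext x
    simp only [Prod.smul_fst, PiLp.smul_apply, smul_eq_mul, RingHom.id_apply, Prod.smul_mk]
    rw [mul_sub, Finset.mul_sum]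
    congr 1
    · ring
    · exact Finset.sum_congr rfl fun e _ => by ring

/-- The Hamiltonian flow of the harmonic chain, the exponential of the linear field. -/
def flow (α ν t : ℝ) : Phase d N →L[ℝ] Phase d N :=
  NormedSpace.exp (t • LinearMap.toContinuousLinearMap (newtonField (d := d) (N := N) α ν))

/-- The flow solves Newton's equations. -/
theorem hasDerivAt_flow (α ν t : ℝ) (ω : Phase d N) :
    HasDerivAt (fun s => flow α ν s ω) (newtonField α ν (flow α ν t ω)) t := by
  have h := hasDerivAt_exp_smul_const' (𝕂 := ℝ)
    (LinearMap.toContinuousLinearMap (newtonField (d := d) (N := N) α ν)) t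
  exact (h.clm_apply (hasDerivAt_const t ω)).congr_deriv (by simp [flow])

/-- The flow starts at the identity. -/
theorem flow_zero (α ν : ℝ) (ω : Phase d N) : flow α ν 0 ω = ω := by
  have h : (0 : ℝ) • LinearMap.toContinuousLinearMap (newtonField (d := d) (N := N) α ν) = 0 :=
    zero_smul ℝ (LinearMap.toContinuousLinearMap (newtonField (d := d) (N := N) α ν))
  rw [flow, h, NormedSpace.exp_zero]
  rfl

/-- Exchange of the momenta of the two ends of the ordered nearest neighbour pair
`b = (x, x ± e_j)`. -/
def exchange (b : Site d N × Dir d) (ω : Phase d N) : Phase d N :=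
  (ω.1, WithLp.toLp 2 fun z => ω.2 (Equiv.swap b.1 (nbr b.1 b.2) z))

end Model

section Equilibrium

variable (d N : ℕ) [NeZero N]

/-- The space of positions. Without pinning (`ν = 0`) only the deformation field (the discrete
gradient of `q`) is considered: it is represented by the positions with zero sum, one in each
class modulo constants. -/
def posSpace (ν : ℝ) : Submodule ℝ (Config d N) where
  carrier := {q | ν = 0 → ∑ x, q x = 0}
  add_mem' {a b} ha hb h := by
    simp only [PiLp.add_apply, Finset.sum_add_distrib, ha h, hb h, add_zero]
  zero_mem' _ := by simp
  smul_mem' c a ha h := by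
    simp only [PiLp.smul_apply, smul_eq_mul, ← Finset.mul_sum, ha h, mul_zero]

/-- Lebesgue measure `dq dp`, the positions ranging over `posSpace`. -/
def lebesgue (ν : ℝ) : Measure (Phase d N) :=
  (Measure.map (fun q : posSpace d N ν => (q : Config d N)) volume).prod volume

/-- The Gibbs measure `Z⁻¹ exp (- H / T) dq dp` of the harmonic chain. -/
def gibbs (α ν T : ℝ) : Measure (Phase d N) :=
  (lebesgue d N ν).tilted fun ω => -hamiltonian (harmV α) (harmW ν) ω / T

end Equilibrium

section Dynamics

/-- The randomness of the noise: a sequence of unit-rate waiting times together with the ordered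
nearest neighbour pairs whose momenta are exchanged. -/
abbrev Clock (d N : ℕ) := ℕ → ℝ × (Site d N × Dir d)

instance : IsProbabilityMeasure (expMeasure 1) := isProbabilityMeasure_expMeasure one_pos

/-- Independent waiting times with exponential law of parameter `1` and independent uniform
ordered nearest neighbour pairs. -/
def clockLaw (d N : ℕ) [NeZero d] [NeZero N] : Measure (Clock d N) :=
  Measure.infinitePi fun _ : ℕ =>
    (expMeasure 1).prod (PMF.uniformOfFintype (Site d N × Dir d)).toMeasure

variable {d N : ℕ} [NeZero N]

/-- Time of the `n`-th exchange. Every ordered pair `(x, y)` with `|x - y| = 1` is exchanged at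
rate `γ`, hence the waiting times are exponential with parameter `γ` times the number of ordered
pairs. -/
def jumpTime (γ : ℝ) (c : Clock d N) (n : ℕ) : ℝ :=
  ∑ i ∈ Finset.range n, (c i).1 / (γ * Fintype.card (Site d N × Dir d))

/-- Number of exchanges up to time `t`. -/
def jumpCount (γ : ℝ) (c : Clock d N) (t : ℝ) : ℕ :=
  Set.ncard {n : ℕ | jumpTime γ c (n + 1) ≤ t}

/-- The configuration just after the `n`-th exchange. -/
def stateAfter (α ν γ : ℝ) (ω : Phase d N) (c : Clock d N) : ℕ → Phase d N
  | 0 => ω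
  | n + 1 => exchange (c n).2
      (flow α ν (jumpTime γ c (n + 1) - jumpTime γ c n) (stateAfter α ν γ ω c n))

/-- The configuration at time `t`: Hamiltonian flow between the exchanges. This is the Markov
process with generator `A + γ S`, where `A` is the Liouville operator and
`S f (q, p) = ∑_{(x, y), |x - y| = 1} (f (q, p^{x,y}) - f (q, p))`, the sum being over ordered
pairs. The argument is the pair of the initial configuration and the randomness of the noise. -/
def trajectory (α ν γ t : ℝ) (z : Phase d N × Clock d N) : Phase d N :=
  flow α ν (t - jumpTime γ z.2 (jumpCount γ z.2 t))
    (stateAfter α ν γ z.1 z.2 (jumpCount γ z.2 t))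

/-- The law of the initial configuration and of the noise for the process started from the Gibbs
measure. -/
def equilibrium (d N : ℕ) [NeZero d] [NeZero N] (α ν T : ℝ) :
    Measure (Phase d N × Clock d N) :=
  (gibbs d N α ν T).prod (clockLaw d N)

end Dynamics

section GreenKubo

/-- The energy current at time `t` along the trajectory. -/
def currentAt {d N : ℕ} [NeZero N] (α ν γ : ℝ) (k : Fin d) (x : Site d N) (t : ℝ)
    (z : Phase d N × Clock d N) : ℝ :=
  current (harmV α) k x (trajectory α ν γ t z)

variable (d N : ℕ) [NeZero d] [NeZero N]

/-- The correlation `E [j_{0,e_k}(0) j_{x,x+e_k}(t)]` at equilibrium. -/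
def correlation (α ν γ T : ℝ) (k : Fin d) (x : Site d N) (t : ℝ) : ℝ :=
  ∫ z, currentAt α ν γ k 0 0 z * currentAt α ν γ k x t z ∂(equilibrium d N α ν T)

/-- The finite volume and finite time Green-Kubo quantity, as a variance of the time integrated
current. -/
def greenKuboVariance (α ν γ T : ℝ) (k : Fin d) (t : ℝ) : ℝ :=
  T⁻¹ ^ 2 * (1 / (2 * (N : ℝ) ^ d * t) *
    ∫ z, (∑ x : Site d N, ∫ s in (0 : ℝ)..t, currentAt α ν γ k x s z) ^ 2
      ∂(equilibrium d N α ν T)) + γ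

/-- The finite volume and finite time Green-Kubo quantity, through the time correlations. -/
def greenKuboCorrelation (α ν γ T : ℝ) (k : Fin d) (t : ℝ) : ℝ :=
  T⁻¹ ^ 2 * (∑ x : Site d N, ∫ s in Ioi (0 : ℝ),
    max (1 - s / t) 0 * correlation d N α ν γ T k x s) + γ

end GreenKubo

end ExchangeChain

end

/-! The total current is, up to terms that telescope, a translation invariant bilinear form in the
momenta and the positions whose kernel is odd (`sum_current`). Such a form is conserved by the
Hamiltonian flow: its time derivative pairs the odd kernel with even autocorrelations (`quad_flow`).
Averaging over a uniformly chosen exchange acts on the kernel as the identity plus a multiple of the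
discrete Laplacian (`sum_quad_exchange`). The odd Fourier modes diagonalize this action, so the mean
of each mode evolves by the scalar factor `exp (-8γtS(ξ))` (`expect_quad_mode`), although the
dynamics itself is not diagonalized.

The equilibrium covariance of a local current with a mode comes from Gaussian integration by parts
(`stiffEig_mul_integral_current_mul_quad`): the mode, multiplied by its stiffness eigenvalue, is a
sum of momenta times derivatives of the energy. The sum of the correlations in finite volume is
therefore exactly `T ^ 2 * spectralSum`, a Riemann sum of the spectral density against the
exponential factor. The density is bounded uniformly, even without pinning, because the numerator
vanishes with the symbol (`density_le`). Dominated convergence gives the limit `limitCorr`.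

For the variance form, two-time correlations must depend on the time difference only
(`integral_mul_comp_trajectory_add`). A linear map that preserves the energy preserves the Gibbs
integrals of observables insensitive to constant shifts of the positions (`integral_comp_gibbs`).
The process is treated by renewal at the first exchange: the identities to be proved satisfy renewal
equations, and a strict contraction on bounded time intervals gives uniqueness
(`eq_zero_of_contraction`). Both Green–Kubo expressions then equal `γ + ∫₀ᵗ (1 - h/t) spectralSum(h)
dh` in finite volume.

The decay follows by moving the cube so that the zero of the symbol sits at its centre and rescaling
by the square root of time; a Gaussian dominates the integrand (`exists_tendsto_mul_limitCorr_sq`).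
Without pinning the density tends to a function homogeneous of degree zero; with pinning it vanishes
to second order, which costs one more power of `t`. Monotone convergence sends the truncated time
integral to the full one (`tendsto_integral_one_sub_div`), the decay exponent decides finiteness,
and Tonelli evaluates the integral (`lintegral_limitCorr`). -/

noncomputable section

namespace ExchangeChain

/-! ### Sums over the discrete torus and forms with odd kernel. -/

section Lattice

variable {d N : ℕ}

/-- The opposite direction. -/
def opp (e : Dir d) : Dir d := (e.1, !e.2)

/-- The unit vector in a given direction. -/
def unitVec (N : ℕ) (e : Dir d) : Site d N := Pi.single e.1 (if e.2 then 1 else -1)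

theorem nbr_eq (x : Site d N) (e : Dir d) : nbr x e = x + unitVec N e := rfl

theorem unitVec_opp (e : Dir d) : unitVec N (opp e) = -unitVec N e := by
  rcases e with ⟨j, _ | _⟩ <;> simp [unitVec, opp, ← Pi.single_neg]

theorem opp_opp (e : Dir d) : opp (opp e) = e := by simp [opp]

/-- Reversing directions, as a permutation. -/
def oppEquiv : Dir d ≃ Dir d := ⟨opp, opp, opp_opp, opp_opp⟩

theorem sum_opp (f : Dir d → ℝ) : ∑ e, f (opp e) = ∑ e, f e :=
  Equiv.sum_comp (oppEquiv (d := d)) f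

/-- The harmonic restoring force, with the opposite sign. -/
def stiff (α ν : ℝ) (q : Site d N → ℝ) (x : Site d N) : ℝ :=
  2 * ν * q x + ∑ e : Dir d, 2 * α * (q x - q (nbr x e))

theorem stiff_translate (α ν : ℝ) (q : Site d N → ℝ) (z x : Site d N) :
    stiff α ν (fun y => q (y + z)) x = stiff α ν q (x + z) := by
  simp only [stiff, nbr_eq, add_right_comm]

/-- The kernel of the total current. -/
def currentKernel (N : ℕ) (k : Fin d) (z : Site d N) : ℝ :=
  (if z = unitVec N (k, true) then 1 else 0) - (if z = -unitVec N (k, true) then 1 else 0)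

variable [NeZero N]

theorem sum_add_right (f : Site d N → ℝ) (z : Site d N) : ∑ x, f (x + z) = ∑ x, f x :=
  Equiv.sum_comp (Equiv.addRight z) f

theorem sum_neg (f : Site d N → ℝ) : ∑ x, f (-x) = ∑ x, f x :=
  Equiv.sum_comp (Equiv.neg _) f

/-- Reversing all the oriented edges. -/
theorem sum_edge_swap (F : Site d N → Site d N → ℝ) :
    ∑ x, ∑ e, F x (nbr x e) = ∑ x, ∑ e, F (nbr x e) x := by
  rw [Finset.sum_comm, Finset.sum_comm (γ := Site d N), ← sum_opp]
  refine Finset.sum_congr rfl fun e _ => ?_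
  rw [← sum_add_right _ (unitVec N e)]
  refine Finset.sum_congr rfl fun x _ => ?_
  simp [nbr_eq, unitVec_opp]

/-- The diagonal terms agree as they stand, and reversing the edges exchanges the off-diagonal ones:
the stiffness operator is self-adjoint. -/
theorem sum_stiff_mul (α ν : ℝ) (q r : Site d N → ℝ) :
    ∑ x, stiff α ν q x * r x = ∑ x, q x * stiff α ν r x := by
  have h := sum_edge_swap fun x y => 2 * α * (q y * r x)
  simp only [stiff, add_mul, mul_add, Finset.sum_add_distrib, Finset.sum_mul, Finset.mul_sum,
    mul_sub, sub_mul, Finset.sum_sub_distrib]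
  have h1 : ∀ x, ∑ e : Dir d, 2 * α * q (nbr x e) * r x
      = ∑ e : Dir d, 2 * α * (q (nbr x e) * r x) :=
    fun x => Finset.sum_congr rfl fun e _ => by ring
  have h2 : ∀ x, ∑ e : Dir d, q x * (2 * α * r (nbr x e))
      = ∑ e : Dir d, 2 * α * (q x * r (nbr x e)) :=
    fun x => Finset.sum_congr rfl fun e _ => by ring
  rw [Finset.sum_congr rfl fun x _ => h1 x, Finset.sum_congr rfl fun x _ => h2 x, h]
  congr 1
  · exact Finset.sum_congr rfl fun x _ => by ring
  · congr 1
    exact Finset.sum_congr rfl fun x _ => Finset.sum_congr rfl fun e _ => by ring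

/-- The substitution `z ↦ -z` changes the sign of the sum. With `c` an autocorrelation, this is the
cancellation behind the conservation of the current by the flow. -/
theorem sum_odd_mul_even {A c : Site d N → ℝ} (hA : ∀ z, A (-z) = -A z)
    (hc : ∀ z, c (-z) = c z) : ∑ z, A z * c z = 0 := by
  have h := sum_neg fun z => A z * c z
  simp only [hA, hc, neg_mul, Finset.sum_neg_distrib] at h
  linarith

/-- The translation invariant form with kernel `A` in the momenta and the positions. -/
def quad (A : Site d N → ℝ) (ω : Phase d N) : ℝ :=
  ∑ z, A z * ∑ x, ω.2 x * ω.1 (x + z)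

theorem quad_smul (A : Site d N → ℝ) (c : ℝ) (ω : Phase d N) :
    quad (fun z => c * A z) ω = c * quad A ω := by
  simp only [quad, Finset.mul_sum, mul_assoc]

theorem quad_sum {ι : Type*} (s : Finset ι) (A : ι → Site d N → ℝ) (ω : Phase d N) :
    quad (fun z => ∑ i ∈ s, A i z) ω = ∑ i ∈ s, quad (A i) ω := by
  simp only [quad, Finset.sum_mul]
  rw [Finset.sum_comm]

/-- The phase space point with constant positions and zero momenta. -/
def cst (c : ℝ) : Phase d N := (WithLp.toLp 2 fun _ => c, 0)

theorem sum_odd {A : Site d N → ℝ} (hA : ∀ z, A (-z) = -A z) : ∑ z, A z = 0 := by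
  simpa using sum_odd_mul_even (c := fun _ => 1) hA fun _ => rfl

/-- An odd kernel has zero total mass. Hence these forms depend on the deformation field only, which
is what makes them meaningful without pinning. -/
theorem quad_add_cst {A : Site d N → ℝ} (hA : ∀ z, A (-z) = -A z) (ω : Phase d N) (c : ℝ) :
    quad A (ω + cst c) = quad A ω := by
  simp only [quad, cst, Prod.snd_add, Prod.fst_add, add_zero, PiLp.add_apply, mul_add,
    Finset.sum_add_distrib]
  rw [← Finset.sum_mul, sum_odd hA, zero_mul, add_zero]

end Lattice

/-! ### Conservation laws of the flow, and the action of the exchanges. -/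

section Flow

variable {d N : ℕ} [NeZero N]

theorem newtonField_snd (α ν : ℝ) (ω : Phase d N) (x : Site d N) :
    (newtonField α ν ω).2 x = -stiff α ν ω.1 x := by
  simp only [newtonField, LinearMap.coe_mk, AddHom.coe_mk, stiff]
  ring

theorem hasDerivAt_flow_fst (α ν t : ℝ) (ω : Phase d N) (x : Site d N) :
    HasDerivAt (fun s => (flow α ν s ω).1 x) ((flow α ν t ω).2 x) t :=
  (EuclideanSpace.proj (𝕜 := ℝ) x).hasFDerivAt.comp_hasDerivAt t (hasDerivAt_flow α ν t ω).fst

theorem hasDerivAt_flow_snd (α ν t : ℝ) (ω : Phase d N) (x : Site d N) :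
    HasDerivAt (fun s => (flow α ν s ω).2 x) (-stiff α ν (flow α ν t ω).1 x) t := by
  rw [← newtonField_snd]
  exact (EuclideanSpace.proj (𝕜 := ℝ) x).hasFDerivAt.comp_hasDerivAt t
    (hasDerivAt_flow α ν t ω).snd

theorem flow_add (α ν s t : ℝ) (ω : Phase d N) :
    flow α ν (s + t) ω = flow α ν s (flow α ν t ω) := by
  let _ := NormedAlgebra.restrictScalars ℚ ℝ (Phase d N →L[ℝ] Phase d N)
  have hc : Commute (s • LinearMap.toContinuousLinearMap (newtonField (d := d) (N := N) α ν))
      (t • LinearMap.toContinuousLinearMap (newtonField α ν)) := by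
    refine ContinuousLinearMap.ext fun v => ?_
    change s • newtonField α ν (t • newtonField α ν v) = t • newtonField α ν (s • newtonField α ν v)
    rw [map_smul, map_smul, smul_comm]
  have h := NormedSpace.exp_add_of_commute hc
  have h2 : (s + t) • LinearMap.toContinuousLinearMap (newtonField (d := d) (N := N) α ν) =
      s • LinearMap.toContinuousLinearMap (newtonField α ν) +
        t • LinearMap.toContinuousLinearMap (newtonField α ν) :=
    ContinuousLinearMap.ext fun v => add_smul s t (newtonField α ν v)
  rw [flow, h2, h]
  rfl

theorem continuous_flow (α ν : ℝ) :
    Continuous fun z : ℝ × Phase d N => flow α ν z.1 z.2 := by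
  let _ := NormedAlgebra.restrictScalars ℚ ℝ (Phase d N →L[ℝ] Phase d N)
  have h : Continuous fun s : ℝ => flow (d := d) (N := N) α ν s :=
    NormedSpace.exp_continuous.comp (continuous_id.smul continuous_const)
  exact (h.comp continuous_fst).clm_apply continuous_snd

/-- The condition `ν * c = 0` covers both regimes at once: without pinning a constant field feels no
force, and with pinning `c` must be zero. -/
theorem flow_cst {α ν c : ℝ} (h : ν * c = 0) (t : ℝ) :
    flow α ν t (cst c : Phase d N) = cst c := by
  have h0 : newtonField (d := d) (N := N) α ν (cst c) = 0 := by
    refine Prod.ext rfl ?_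
    ext x
    rw [newtonField_snd]
    simp [stiff, cst, mul_assoc, h]
  have hd : ∀ s : ℝ, HasDerivAt (fun s => flow α ν s (cst c : Phase d N)) 0 s := by
    intro s
    have h1 := hasDerivAt_exp_smul_const (𝕂 := ℝ)
      (LinearMap.toContinuousLinearMap (newtonField (d := d) (N := N) α ν)) s
    refine (h1.clm_apply (hasDerivAt_const s (cst c : Phase d N))).congr_deriv ?_
    simp [h0]
  have := is_const_of_deriv_eq_zero (fun s => (hd s).differentiableAt) (fun s => (hd s).deriv) t 0
  rw [this, flow_zero]

theorem exchange_add_cst (b : Site d N × Dir d) (ω : Phase d N) (c : ℝ) :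
    exchange b (ω + cst c) = exchange b ω + cst c := by
  refine Prod.ext rfl ?_
  ext x
  simp [exchange, cst]

/-- The derivative pairs `A` with the autocorrelation of `p` and with the correlation between the
force and `q`. The first is even by translation, the second by translation and self-adjointness of
the stiffness, so both vanish against an odd kernel. -/
theorem quad_flow {A : Site d N → ℝ} (hA : ∀ z, A (-z) = -A z) (α ν t : ℝ) (ω : Phase d N) :
    quad A (flow α ν t ω) = quad A ω := by
  have hd : ∀ s : ℝ, HasDerivAt (fun s => quad A (flow α ν s ω)) 0 s := by
    intro s
    set η := flow α ν s ω with hη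
    have h1 : HasDerivAt (fun s => quad A (flow α ν s ω))
        (∑ z, A z * ∑ x, (-stiff α ν η.1 x * η.1 (x + z) + η.2 x * η.2 (x + z))) s := by
      unfold quad
      refine HasDerivAt.fun_sum fun z _ => HasDerivAt.const_mul _ (HasDerivAt.fun_sum fun x _ => ?_)
      exact (hasDerivAt_flow_snd α ν s ω x).mul (hasDerivAt_flow_fst α ν s ω (x + z))
    convert h1 using 1
    symm
    refine sum_odd_mul_even hA fun z => ?_
    simp only [Finset.sum_add_distrib, neg_mul, Finset.sum_neg_distrib]
    congr 1
    · congr 1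
      rw [← sum_add_right _ z]
      simp only [add_neg_cancel_right, ← stiff_translate]
      rw [sum_stiff_mul]
      exact Finset.sum_congr rfl fun x _ => mul_comm _ _
    · rw [← sum_add_right _ z]
      simp only [add_neg_cancel_right]
      exact Finset.sum_congr rfl fun x _ => mul_comm _ _
  have := is_const_of_deriv_eq_zero (fun s => (hd s).differentiableAt) (fun s => (hd s).deriv) t 0
  simpa only [flow_zero] using this

/-- The energy of the harmonic chain. -/
def energy (α ν : ℝ) (ω : Phase d N) : ℝ := hamiltonian (harmV α) (harmW ν) ω

theorem energy_eq (α ν : ℝ) (ω : Phase d N) :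
    energy α ν ω = ∑ x, ((ω.2 x) ^ 2 / 2 + ν * (ω.1 x) ^ 2 +
      (1 / 2) * ∑ e : Dir d, α * (ω.1 x - ω.1 (nbr x e)) ^ 2) := rfl

theorem energy_flow (α ν t : ℝ) (ω : Phase d N) : energy α ν (flow α ν t ω) = energy α ν ω := by
  have hd : ∀ s : ℝ, HasDerivAt (fun s => energy α ν (flow α ν s ω)) 0 s := by
    intro s
    set η := flow α ν s ω with hη
    have h1 : HasDerivAt (fun s => energy α ν (flow α ν s ω))
        (∑ x, (-stiff α ν η.1 x * η.2 x + 2 * ν * η.1 x * η.2 x +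
          ∑ e : Dir d, α * (η.1 x - η.1 (nbr x e)) * (η.2 x - η.2 (nbr x e)))) s := by
      simp only [energy_eq]
      refine HasDerivAt.fun_sum fun x _ => HasDerivAt.add (HasDerivAt.add ?_ ?_) ?_
      · refine (((hasDerivAt_flow_snd α ν s ω x).pow 2).div_const 2).congr_deriv ?_
        push_cast; ring
      · refine (((hasDerivAt_flow_fst α ν s ω x).pow 2).const_mul ν).congr_deriv ?_
        push_cast; ring
      · have : HasDerivAt (fun s => ∑ e : Dir d,
            α * ((flow α ν s ω).1 x - (flow α ν s ω).1 (nbr x e)) ^ 2)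
            (∑ e : Dir d, 2 * (α * (η.1 x - η.1 (nbr x e)) * (η.2 x - η.2 (nbr x e)))) s := by
          refine HasDerivAt.fun_sum fun e _ => ?_
          refine ((((hasDerivAt_flow_fst α ν s ω x).fun_sub
            (hasDerivAt_flow_fst α ν s ω (nbr x e))).fun_pow 2).const_mul α).congr_deriv ?_
          push_cast; ring
        refine (this.const_mul (1 / 2)).congr_deriv ?_
        rw [← Finset.mul_sum]; ring
    convert h1 using 1
    have h2 := sum_edge_swap fun x y => α * (η.1 x - η.1 y) * η.2 x
    -- What remains at a site is a flux through its edges: the difference of one edge term and the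
    -- same term with the two ends swapped. It need not vanish site by site, but it sums to zero by
    -- edge reversal.
    have h3 : ∀ x, -stiff α ν η.1 x * η.2 x + 2 * ν * η.1 x * η.2 x +
          ∑ e : Dir d, α * (η.1 x - η.1 (nbr x e)) * (η.2 x - η.2 (nbr x e)) =
        (∑ e : Dir d, α * (η.1 (nbr x e) - η.1 x) * η.2 (nbr x e)) -
          ∑ e : Dir d, α * (η.1 x - η.1 (nbr x e)) * η.2 x := by
      intro x
      have h4 : ∑ e : Dir d, α * (η.1 x - η.1 (nbr x e)) * (η.2 x - η.2 (nbr x e)) =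
          ∑ e : Dir d, (2 * α * (η.1 x - η.1 (nbr x e)) * η.2 x +
            (α * (η.1 (nbr x e) - η.1 x) * η.2 (nbr x e) -
              α * (η.1 x - η.1 (nbr x e)) * η.2 x)) :=
        Finset.sum_congr rfl fun e _ => by ring
      rw [h4, Finset.sum_add_distrib, stiff, neg_mul, add_mul, Finset.sum_mul,
        Finset.sum_sub_distrib]
      ring
    rw [Finset.sum_congr rfl fun x _ => h3 x, Finset.sum_sub_distrib, h2, sub_self]
  have := is_const_of_deriv_eq_zero (fun s => (hd s).differentiableAt) (fun s => (hd s).deriv) t 0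
  simpa only [flow_zero] using this

theorem energy_exchange (α ν : ℝ) (b : Site d N × Dir d) (ω : Phase d N) :
    energy α ν (exchange b ω) = energy α ν ω := by
  simp only [energy_eq, Finset.sum_add_distrib]
  congr 2
  exact Equiv.sum_comp (Equiv.swap b.1 (nbr b.1 b.2)) fun x => (ω.2 x) ^ 2 / 2

theorem energy_add_cst {α ν c : ℝ} (h : ν * c = 0) (ω : Phase d N) :
    energy α ν (ω + cst c) = energy α ν ω := by
  simp only [energy_eq, cst, Prod.snd_add, Prod.fst_add, add_zero, PiLp.add_apply,
    add_sub_add_right_eq_sub]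
  refine Finset.sum_congr rfl fun x _ => ?_
  congr 2
  linear_combination (2 * ω.1 x + c) * h

theorem siteEnergy_terms_nonneg {α ν : ℝ} (hα : 0 < α) (hν : 0 ≤ ν) (ω : Phase d N)
    (x : Site d N) : 0 ≤ (ω.2 x) ^ 2 / 2 + ν * (ω.1 x) ^ 2 +
      (1 / 2) * ∑ e : Dir d, α * (ω.1 x - ω.1 (nbr x e)) ^ 2 :=
  add_nonneg (by positivity)
    (mul_nonneg (by norm_num) (Finset.sum_nonneg fun e _ => by positivity))

theorem energy_nonneg {α ν : ℝ} (hα : 0 < α) (hν : 0 ≤ ν) (ω : Phase d N) : 0 ≤ energy α ν ω :=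
  Finset.sum_nonneg fun x _ => siteEnergy_terms_nonneg hα hν ω x

theorem siteEnergy_le_energy {α ν : ℝ} (hα : 0 < α) (hν : 0 ≤ ν) (ω : Phase d N)
    (x : Site d N) : (ω.2 x) ^ 2 / 2 + ν * (ω.1 x) ^ 2 +
      (1 / 2) * ∑ e : Dir d, α * (ω.1 x - ω.1 (nbr x e)) ^ 2 ≤ energy α ν ω :=
  Finset.single_le_sum (f := fun x => (ω.2 x) ^ 2 / 2 + ν * (ω.1 x) ^ 2 +
      (1 / 2) * ∑ e : Dir d, α * (ω.1 x - ω.1 (nbr x e)) ^ 2)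
    (fun x _ => siteEnergy_terms_nonneg hα hν ω x) (Finset.mem_univ x)

theorem sq_snd_le {α ν : ℝ} (hα : 0 < α) (hν : 0 ≤ ν) (ω : Phase d N) (x : Site d N) :
    (ω.2 x) ^ 2 ≤ 2 * energy α ν ω := by
  have h := siteEnergy_le_energy hα hν ω x
  have h1 : 0 ≤ ∑ e : Dir d, α * (ω.1 x - ω.1 (nbr x e)) ^ 2 :=
    Finset.sum_nonneg fun e _ => by positivity
  have h2 : 0 ≤ ν * (ω.1 x) ^ 2 := by positivity
  linarith

theorem sq_fst_le {α ν : ℝ} (hα : 0 < α) (hν : 0 ≤ ν) (ω : Phase d N) (x : Site d N) :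
    ν * (ω.1 x) ^ 2 ≤ energy α ν ω := by
  have h := siteEnergy_le_energy hα hν ω x
  have h1 : 0 ≤ ∑ e : Dir d, α * (ω.1 x - ω.1 (nbr x e)) ^ 2 :=
    Finset.sum_nonneg fun e _ => by positivity
  have h2 := sq_nonneg (ω.2 x)
  linarith

theorem sq_grad_le {α ν : ℝ} (hα : 0 < α) (hν : 0 ≤ ν) (ω : Phase d N) (x : Site d N)
    (e : Dir d) : α * (ω.1 x - ω.1 (nbr x e)) ^ 2 ≤ 2 * energy α ν ω := by
  have h := siteEnergy_le_energy hα hν ω x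
  have h1 := Finset.single_le_sum (f := fun e : Dir d => α * (ω.1 x - ω.1 (nbr x e)) ^ 2)
    (fun e _ => by positivity) (Finset.mem_univ e)
  have h2 := sq_nonneg (ω.2 x)
  have h3 : 0 ≤ ν * (ω.1 x) ^ 2 := by positivity
  simp only at h1
  linarith

theorem current_eq (α : ℝ) (k : Fin d) (x : Site d N) (ω : Phase d N) :
    current (harmV α) k x ω =
      -α * (ω.1 (nbr x (k, true)) - ω.1 x) * (ω.2 (nbr x (k, true)) + ω.2 x) := by
  have : ∀ r, deriv (harmV α) r = 2 * α * r := by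
    intro r
    have : HasDerivAt (fun r => α * r ^ 2) (2 * α * r) r :=
      ((hasDerivAt_pow 2 r).const_mul α).congr_deriv (by push_cast; ring)
    exact this.deriv
  rw [current, this]
  ring

/-- Since the dynamics conserves the energy, a bound by the energy is uniform in time along every
trajectory. This is the only domination used for the expectations of currents. -/
theorem abs_current_le {α ν : ℝ} (hα : 0 < α) (hν : 0 ≤ ν) (k : Fin d) (x : Site d N)
    (ω : Phase d N) : |current (harmV α) k x ω| ≤ (1 + 4 * α) * energy α ν ω := by
  have h1 := sq_grad_le hα hν ω x (k, true)
  have h2 := sq_snd_le hα hν ω x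
  have h3 := sq_snd_le hα hν ω (nbr x (k, true))
  rw [current_eq]
  set a := ω.1 (nbr x (k, true))
  set b := ω.1 x
  set p := ω.2 (nbr x (k, true))
  set r := ω.2 x
  rw [abs_le]
  constructor <;> nlinarith [mul_nonneg hα.le (sq_nonneg ((a - b) - (p + r))),
    mul_nonneg hα.le (sq_nonneg ((a - b) + (p + r))), mul_nonneg hα.le (sq_nonneg (p - r))]

theorem current_add_cst (α c : ℝ) (k : Fin d) (x : Site d N) (ω : Phase d N) :
    current (harmV α) k x (ω + cst c) = current (harmV α) k x ω := by
  simp [current_eq, cst]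

/-- In the product of `q (x + u) - q x` and `p (x + u) + p x` the terms taken at a single site
telescope, and the cross terms form the antisymmetric kernel. -/
theorem sum_current (α : ℝ) (k : Fin d) (ω : Phase d N) :
    ∑ x, current (harmV α) k x ω = -α * quad (currentKernel N k) ω := by
  set u := unitVec N (k, true)
  have h : quad (currentKernel N k) ω =
      ∑ x, ω.2 x * ω.1 (x + u) - ∑ x, ω.2 x * ω.1 (x + -u) := by
    simp only [quad, currentKernel, sub_mul, ite_mul, one_mul, zero_mul, Finset.sum_sub_distrib,
      Finset.sum_ite_eq', Finset.mem_univ, if_true]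
    rfl
  rw [h, ← sum_add_right (fun x => ω.2 x * ω.1 (x + -u)) u]
  simp only [current_eq, add_neg_cancel_right, nbr_eq]
  have h2 := sum_add_right (fun x => ω.2 x * ω.1 x) u
  change ∑ x, -α * (ω.1 (x + u) - ω.1 x) * (ω.2 (x + u) + ω.2 x) = _
  rw [← Finset.sum_sub_distrib, Finset.mul_sum, ← sub_eq_zero, ← Finset.sum_sub_distrib]
  have : ∀ x, -α * (ω.1 (x + u) - ω.1 x) * (ω.2 (x + u) + ω.2 x) -
      -α * (ω.2 x * ω.1 (x + u) - ω.2 (x + u) * ω.1 x) =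
      -α * (ω.2 (x + u) * ω.1 (x + u)) - -α * (ω.2 x * ω.1 x) := fun x => by ring
  simp only [this, Finset.sum_sub_distrib, ← Finset.mul_sum, h2, sub_self]

/-- A pair that avoids `z` leaves `p z` unchanged. Each edge at `z` occurs among the ordered pairs
in both orientations, hence the factor 2. -/
theorem sum_swap (p : Site d N → ℝ) (z : Site d N) :
    ∑ b : Site d N × Dir d, p (Equiv.swap b.1 (nbr b.1 b.2) z) =
      Fintype.card (Site d N × Dir d) * p z + 2 * ∑ e : Dir d, (p (nbr z e) - p z) := by
  have h : ∀ b : Site d N × Dir d, p (Equiv.swap b.1 (nbr b.1 b.2) z) =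
      p z + ((if b.1 = z then p (nbr b.1 b.2) - p z else 0) +
        (if nbr b.1 b.2 = z then p b.1 - p z else 0)) := by
    intro b
    rw [Equiv.swap_apply_def]
    by_cases h1 : b.1 = z
    · by_cases h2 : nbr b.1 b.2 = z
      -- Both ends of the pair are `z`, which happens only for `N = 1`; both corrections are then
      -- zero.
      · simp [h1]
      · simp [h1, h1 ▸ h2]
    · by_cases h2 : nbr b.1 b.2 = z
      · simp [h1, h2, Ne.symm h1]
      · simp [h1, h2, Ne.symm h1, Ne.symm h2]
  have h1 : ∀ e : Dir d, ∑ x : Site d N, (if nbr x e = z then p x - p z else 0) =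
      p (nbr z (opp e)) - p z := by
    intro e
    rw [← sum_add_right _ (-unitVec N e)]
    simp [nbr_eq, unitVec_opp]
  rw [Finset.sum_congr rfl fun b _ => h b, Finset.sum_add_distrib, Finset.sum_add_distrib,
    Finset.sum_const, Finset.card_univ, nsmul_eq_mul, Fintype.sum_prod_type,
    Fintype.sum_prod_type, Finset.sum_comm, Finset.sum_comm (s := Finset.univ (α := Site d N))]
  simp only [h1]
  rw [sum_opp fun e => p (nbr z e) - p z]
  simp only [Finset.sum_ite_eq', Finset.mem_univ, if_true]
  ring

/-- The exchanges produce the discrete Laplacian of the momenta. Translation invariance of the form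
moves it onto the kernel. -/
theorem sum_quad_exchange (A : Site d N → ℝ) (ω : Phase d N) :
    ∑ b : Site d N × Dir d, quad A (exchange b ω) =
      Fintype.card (Site d N × Dir d) * quad A ω +
        2 * quad (fun z => ∑ e : Dir d, (A (nbr z e) - A z)) ω := by
  have h1 : ∑ b : Site d N × Dir d, quad A (exchange b ω) =
      ∑ z, A z * ∑ x, (∑ b : Site d N × Dir d, ω.2 (Equiv.swap b.1 (nbr b.1 b.2) x)) *
        ω.1 (x + z) := by
    simp only [quad, exchange]
    rw [Finset.sum_comm]
    refine Finset.sum_congr rfl fun z _ => ?_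
    rw [← Finset.mul_sum, Finset.sum_comm]
    simp only [Finset.sum_mul]
  have h2 : ∀ e : Dir d, ∑ z, A z * ∑ x, ω.2 (nbr x e) * ω.1 (x + z) =
      ∑ z, A (nbr z e) * ∑ x, ω.2 x * ω.1 (x + z) := by
    intro e
    rw [← sum_add_right _ (unitVec N e)]
    refine Finset.sum_congr rfl fun z _ => ?_
    rw [nbr_eq, ← sum_add_right (fun x => ω.2 x * ω.1 (x + z)) (unitVec N e)]
    simp only [nbr_eq, add_right_comm, add_assoc]
  have h3 := sum_swap (fun x => ω.2 x)
  simp only at h3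
  rw [h1]
  simp only [h3, add_mul, Finset.sum_add_distrib, mul_add]
  congr 1
  · simp only [mul_assoc, ← Finset.mul_sum, quad]
    rw [Finset.mul_sum]
    exact Finset.sum_congr rfl fun z _ => by ring
  · have h4 : ∀ z, A z * ∑ x, 2 * (∑ e : Dir d, (ω.2 (nbr x e) - ω.2 x)) * ω.1 (x + z) =
        2 * ∑ e : Dir d, (A z * ∑ x, ω.2 (nbr x e) * ω.1 (x + z) -
          A z * ∑ x, ω.2 x * ω.1 (x + z)) := by
      intro z
      simp only [mul_assoc, ← mul_sub, ← Finset.mul_sum, ← Finset.sum_sub_distrib, ← sub_mul]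
      rw [Finset.sum_comm]
      simp only [← Finset.sum_mul]
      ring
    rw [Finset.sum_congr rfl fun z _ => h4 z, ← Finset.mul_sum, Finset.sum_comm]
    congr 1
    simp only [Finset.sum_sub_distrib, h2, quad, Finset.sum_mul, sub_mul]
    congr 1 <;> rw [Finset.sum_comm]

end Flow

/-! ### The symbol of the Laplacian and the odd Fourier modes. -/

/-- The symbol of the discrete Laplacian, up to the factor `-4`. -/
def symb {d : ℕ} (ξ : Fin d → ℝ) : ℝ := ∑ j, Real.sin (Real.pi * ξ j) ^ 2

theorem symb_nonneg {d : ℕ} (ξ : Fin d → ℝ) : 0 ≤ symb ξ :=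
  Finset.sum_nonneg fun _ _ => sq_nonneg _

theorem sin_sq_le_symb {d : ℕ} (ξ : Fin d → ℝ) (k : Fin d) :
    Real.sin (Real.pi * ξ k) ^ 2 ≤ symb ξ :=
  Finset.single_le_sum (f := fun j => Real.sin (Real.pi * ξ j) ^ 2) (fun _ _ => sq_nonneg _)
    (Finset.mem_univ k)

/-- The double angle formula gives `4 sin² cos² ≤ 4 sin²`. This keeps the spectral density bounded
where the symbol vanishes. -/
theorem sin_two_sq_le_symb {d : ℕ} (ξ : Fin d → ℝ) (k : Fin d) :
    Real.sin (2 * Real.pi * ξ k) ^ 2 ≤ 4 * symb ξ := by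
  have h := sin_sq_le_symb ξ k
  have h2 := Real.sin_sq_add_cos_sq (Real.pi * ξ k)
  rw [mul_assoc, Real.sin_two_mul]
  nlinarith [sq_nonneg (Real.sin (Real.pi * ξ k)), sq_nonneg (Real.sin (Real.pi * ξ k) ^ 2)]

section Fourier

variable {d N : ℕ} [NeZero N]

/-- The point of the unit cube attached to a frequency. -/
def grid (ξ : Site d N) (j : Fin d) : ℝ := (ξ j).val / N

/-- The characters of the torus. -/
def chi (ξ z : Site d N) : ℂ := ZMod.stdAddChar (∑ j, ξ j * z j)

theorem chi_add (ξ y z : Site d N) : chi ξ (y + z) = chi ξ y * chi ξ z := by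
  simp only [chi, Pi.add_apply, mul_add, Finset.sum_add_distrib, AddChar.map_add_eq_mul]

theorem chi_neg (ξ z : Site d N) : chi ξ (-z) = (starRingEnd ℂ) (chi ξ z) := by
  simp only [chi, Pi.neg_apply, mul_neg, Finset.sum_neg_distrib, AddChar.map_neg_eq_conj]

theorem sum_chi (z : Site d N) : ∑ ξ, chi ξ z = if z = 0 then (N : ℂ) ^ d else 0 := by
  have h : ∀ ξ : Site d N, chi ξ z = ∏ j, ZMod.stdAddChar (ξ j * z j) := fun ξ => by
    rw [chi]
    exact map_prod (AddChar.toMonoidHom ZMod.stdAddChar)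
      (fun j => Multiplicative.ofAdd (ξ j * z j)) Finset.univ
  simp only [h]
  rw [← Fintype.prod_sum fun j (a : ZMod N) => ZMod.stdAddChar (a * z j)]
  simp only [AddChar.sum_mulShift _ (ZMod.isPrimitive_stdAddChar N), ZMod.card]
  split_ifs with hz
  · subst hz; simp
  · obtain ⟨j, hj⟩ := Function.ne_iff.1 hz
    exact Finset.prod_eq_zero (Finset.mem_univ j) (by rw [if_neg (by simpa using hj), Nat.cast_zero])

/-- The odd real Fourier modes. -/
def mode (ξ z : Site d N) : ℝ := (chi ξ z).im

theorem mode_neg (ξ z : Site d N) : mode ξ (-z) = -mode ξ z := by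
  simp [mode, chi_neg]

theorem chi_unitVec (ξ : Site d N) (k : Fin d) :
    chi ξ (unitVec N (k, true)) = Complex.exp ((2 * Real.pi * grid ξ k : ℝ) * Complex.I) := by
  have : ∑ j, ξ j * unitVec N (k, true) j = ξ k := by
    rw [Finset.sum_eq_single k] <;> simp +contextual [unitVec]
  rw [chi, this, ZMod.stdAddChar_apply, ZMod.toCircle_apply, grid]
  congr 1
  push_cast
  ring

theorem mode_unitVec (ξ : Site d N) (k : Fin d) :
    mode ξ (unitVec N (k, true)) = Real.sin (2 * Real.pi * grid ξ k) := by
  rw [mode, chi_unitVec, Complex.exp_ofReal_mul_I_im]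

theorem mode_add_add_mode_sub (ξ y z : Site d N) :
    mode ξ (y + z) + mode ξ (y + -z) = 2 * (chi ξ z).re * mode ξ y := by
  simp only [mode, chi_add, chi_neg, Complex.mul_im, Complex.conj_re, Complex.conj_im]
  ring

/-- Opposite directions combine into a factor `2 cos (2πξ_j) - 2 = -4 sin² (πξ_j)`. -/
theorem sum_mode_nbr (ξ z : Site d N) :
    ∑ e : Dir d, (mode ξ (nbr z e) - mode ξ z) = -4 * symb (grid ξ) * mode ξ z := by
  rw [Fintype.sum_prod_type, symb, Finset.mul_sum, Finset.sum_mul]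
  refine Finset.sum_congr rfl fun j _ => ?_
  rw [Fintype.sum_bool, nbr_eq, nbr_eq, show ((j, false) : Dir d) = opp (j, true) from rfl,
    unitVec_opp]
  have h := mode_add_add_mode_sub ξ z (unitVec N (j, true))
  rw [chi_unitVec, Complex.exp_ofReal_mul_I_re, mul_assoc 2 Real.pi, Real.cos_two_mul'] at h
  have h2 := Real.sin_sq_add_cos_sq (Real.pi * grid ξ j)
  linear_combination h + 2 * mode ξ z * h2

theorem currentKernel_eq_sum_mode (k : Fin d) (z : Site d N) :
    currentKernel N k z =
      ∑ ξ, ((N : ℝ) ^ d)⁻¹ * (2 * Real.sin (2 * Real.pi * grid ξ k)) * mode ξ z := by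
  set u := unitVec N (k, true) with hu
  have hN : (N : ℝ) ^ d ≠ 0 := pow_ne_zero _ (Nat.cast_ne_zero.2 (NeZero.ne N))
  have h1 : ∀ y : Site d N, ∑ ξ, (chi ξ y).re = if y = 0 then (N : ℝ) ^ d else 0 := by
    intro y
    rw [← Complex.re_sum, sum_chi]
    split_ifs
    · exact_mod_cast Complex.ofReal_re ((N : ℝ) ^ d)
    · rfl
  -- A product of two sines is a difference of cosines; summed over the frequencies, these give the
  -- point masses at `u` and `-u`.
  have h2 : ∀ ξ : Site d N, 2 * Real.sin (2 * Real.pi * grid ξ k) * mode ξ z =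
      (chi ξ (z + -u)).re - (chi ξ (z + u)).re := by
    intro ξ
    rw [← mode_unitVec, ← hu, mode, mode, chi_add, chi_add, chi_neg]
    simp only [Complex.mul_re, Complex.conj_re, Complex.conj_im]
    ring
  rw [Finset.sum_congr rfl fun ξ _ => (mul_assoc _ _ _).trans (congrArg _ (h2 ξ)),
    ← Finset.mul_sum, Finset.sum_sub_distrib, h1, h1]
  simp only [currentKernel, ← sub_eq_add_neg, sub_eq_zero, add_eq_zero_iff_eq_neg, ← hu]
  split_ifs <;> simp [hN]

/-- The eigenvalues of the stiffness operator. -/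
def stiffEig (α ν : ℝ) (ξ : Site d N) : ℝ := 2 * ν + 8 * α * symb (grid ξ)

theorem stiff_mode (α ν : ℝ) (ξ x x' : Site d N) :
    stiff α ν (fun y => mode ξ (y - x')) x = stiffEig α ν ξ * mode ξ (x - x') := by
  have h := sum_mode_nbr ξ (x - x')
  simp only [stiff, ← Finset.mul_sum]
  have : ∀ e : Dir d, mode ξ (x - x') - mode ξ (nbr x e - x') =
      -(mode ξ (nbr (x - x') e) - mode ξ (x - x')) := fun e => by
    rw [nbr_eq, nbr_eq, add_sub_right_comm]; ring
  simp only [this, Finset.sum_neg_distrib, h, stiffEig]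
  ring

/-- Each odd mode is an eigenvector of the averaged exchange. Together with conservation by the
flow, this closes the evolution equation of its mean. -/
theorem sum_quad_mode_exchange (ξ : Site d N) (ω : Phase d N) :
    ∑ b : Site d N × Dir d, quad (mode ξ) (exchange b ω) =
      (Fintype.card (Site d N × Dir d) - 8 * symb (grid ξ)) * quad (mode ξ) ω := by
  rw [sum_quad_exchange]
  simp only [sum_mode_nbr, quad_smul]
  ring

/-- The total current in Fourier modes. -/
theorem sum_current_eq_sum_mode (α : ℝ) (k : Fin d) (ω : Phase d N) :
    ∑ x, current (harmV α) k x ω = ∑ ξ : Site d N,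
      -α * ((N : ℝ) ^ d)⁻¹ * (2 * Real.sin (2 * Real.pi * grid ξ k)) * quad (mode ξ) ω := by
  rw [sum_current, show currentKernel N k = fun z => ∑ ξ,
    ((N : ℝ) ^ d)⁻¹ * (2 * Real.sin (2 * Real.pi * grid ξ k)) * mode ξ z from
    funext fun z => currentKernel_eq_sum_mode k z, quad_sum, Finset.mul_sum]
  refine Finset.sum_congr rfl fun ξ _ => ?_
  rw [quad_smul]
  ring

theorem card_pairs (d N : ℕ) [NeZero N] :
    (Fintype.card (Site d N × Dir d) : ℝ) = 2 * d * (N : ℝ) ^ d := by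
  simp [ZMod.card]
  ring

/-- The averaged exchange contracts every mode. -/
theorem abs_one_sub_le_one [NeZero d] (ξ : Site d N) :
    |1 - 8 * symb (grid ξ) / Fintype.card (Site d N × Dir d)| ≤ 1 := by
  have hd : (1 : ℝ) ≤ d := by exact_mod_cast NeZero.one_le
  have hS : symb (grid ξ) ≤ d := by
    refine (Finset.sum_le_sum fun j _ => Real.sin_sq_le_one _).trans ?_
    simp
  have h0 := symb_nonneg (grid ξ)
  -- For `N = 1` the symbol vanishes at the only frequency. For `N ≥ 2` there are at least `4 d`
  -- ordered pairs, while `8 S ≤ 8 d`, so the quotient is at most 2.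
  rcases Nat.lt_or_ge N 2 with h | h
  · obtain rfl : N = 1 := by have := NeZero.ne N; omega
    have : symb (grid ξ) = 0 := by
      refine Finset.sum_eq_zero fun j _ => ?_
      have : (ξ j) = 0 := Subsingleton.elim _ _
      simp [grid, this]
    simp [this]
  · rw [card_pairs]
    have hN : (2 : ℝ) ≤ (N : ℝ) ^ d := by
      have h2 : (2 : ℝ) ≤ N := by exact_mod_cast h
      exact h2.trans (le_self_pow₀ (by linarith) (NeZero.ne d))
    have h3 : 8 * symb (grid ξ) / (2 * d * (N : ℝ) ^ d) ≤ 2 := by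
      rw [div_le_iff₀ (by positivity)]
      nlinarith
    have h4 : 0 ≤ 8 * symb (grid ξ) / (2 * d * (N : ℝ) ^ d) := by positivity
    rw [abs_le]
    constructor <;> linarith

end Fourier

/-! ### Expansion of the energy, and fields with zero gradient. -/

section Energy

variable {d N : ℕ} [NeZero N]

/-- The differential of the energy. -/
def dEnergy (α ν : ℝ) (ω v : Phase d N) : ℝ :=
  ∑ x, (ω.2 x * v.2 x + stiff α ν ω.1 x * v.1 x)

/-- The energy is a quadratic form, so its second order expansion is exact. Edge reversal rewrites
the gradient cross term as a pairing with the stiffness. -/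
theorem energy_add_smul (α ν s : ℝ) (ω v : Phase d N) :
    energy α ν (ω + s • v) = energy α ν ω + s * dEnergy α ν ω v + s ^ 2 * energy α ν v := by
  have h := sum_edge_swap fun x y => α * (ω.1 x - ω.1 y) * v.1 x
  have h1 : ∑ x, ∑ e : Dir d, α * (ω.1 x - ω.1 (nbr x e)) * (v.1 x - v.1 (nbr x e)) =
      ∑ x, ∑ e : Dir d, 2 * α * (ω.1 x - ω.1 (nbr x e)) * v.1 x := by
    have : ∀ x (e : Dir d), α * (ω.1 x - ω.1 (nbr x e)) * (v.1 x - v.1 (nbr x e)) =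
      α * (ω.1 x - ω.1 (nbr x e)) * v.1 x + α * (ω.1 (nbr x e) - ω.1 x) * v.1 (nbr x e) :=
      fun x e => by ring
    simp only [this, Finset.sum_add_distrib]
    rw [← h, ← Finset.sum_add_distrib]
    refine Finset.sum_congr rfl fun x _ => ?_
    rw [← Finset.sum_add_distrib]
    exact Finset.sum_congr rfl fun e _ => by ring
  have h2 : dEnergy α ν ω v = ∑ x, (ω.2 x * v.2 x + 2 * ν * ω.1 x * v.1 x) +
      ∑ x, ∑ e : Dir d, α * (ω.1 x - ω.1 (nbr x e)) * (v.1 x - v.1 (nbr x e)) := by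
    rw [h1, ← Finset.sum_add_distrib]
    refine Finset.sum_congr rfl fun x _ => ?_
    rw [stiff, add_mul, Finset.sum_mul, add_assoc]
  rw [h2, energy_eq, energy_eq, energy_eq, mul_add, Finset.mul_sum, Finset.mul_sum, Finset.mul_sum,
    ← Finset.sum_add_distrib, ← Finset.sum_add_distrib, ← Finset.sum_add_distrib]
  refine Finset.sum_congr rfl fun x _ => ?_
  have h3 : ∑ e : Dir d, α * ((ω + s • v).1 x - (ω + s • v).1 (nbr x e)) ^ 2 =
      ∑ e : Dir d, α * (ω.1 x - ω.1 (nbr x e)) ^ 2 +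
      2 * s * ∑ e : Dir d, α * (ω.1 x - ω.1 (nbr x e)) * (v.1 x - v.1 (nbr x e)) +
      s ^ 2 * ∑ e : Dir d, α * (v.1 x - v.1 (nbr x e)) ^ 2 := by
    rw [Finset.mul_sum, Finset.mul_sum, ← Finset.sum_add_distrib, ← Finset.sum_add_distrib]
    refine Finset.sum_congr rfl fun e _ => ?_
    simp only [Prod.fst_add, Prod.smul_fst, PiLp.add_apply, PiLp.smul_apply, smul_eq_mul]
    ring
  rw [h3]
  simp only [Prod.fst_add, Prod.snd_add, Prod.smul_fst, Prod.smul_snd, PiLp.add_apply,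
    PiLp.smul_apply, smul_eq_mul]
  ring

/-- The periods of `q` form a subgroup containing the unit vectors, which generate the torus. -/
theorem eq_const_of_nbr {q : Site d N → ℝ} (h : ∀ x (e : Dir d), q (nbr x e) = q x)
    (x y : Site d N) : q x = q y := by
  let G : AddSubgroup (Site d N) :=
    { carrier := {z | ∀ x, q (x + z) = q x}
      zero_mem' := fun x => by rw [add_zero]
      add_mem' := fun {a b} ha hb x => by rw [← add_assoc, hb, ha]
      neg_mem' := fun {a} ha x => by rw [← ha (x + -a), neg_add_cancel_right] }
  have h1 : ∀ j : Fin d, ∀ a : ZMod N, (Pi.single j a : Site d N) ∈ G := by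
    intro j a
    have : (Pi.single j a : Site d N) = a.val • unitVec N (j, true) := by
      rw [unitVec, ← Pi.single_smul]; simp
    rw [this]
    exact G.nsmul_mem (fun x => h x (j, true)) _
  have h2 : ∀ z : Site d N, z ∈ G := by
    intro z
    rw [← Finset.univ_sum_single z]
    exact G.sum_mem fun j _ => h1 j (z j)
  have := h2 (x - y) y
  rwa [add_sub_cancel] at this

end Energy

/-! ### Coercivity, integrability and integration by parts for the Gibbs measure. -/

section Reduced

variable {d N : ℕ} [NeZero N]

variable (d N) in
/-- The phase space on which the Gibbs measure lives. -/
abbrev Reduced (ν : ℝ) := posSpace d N ν × Config d N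

instance (ν : ℝ) : (volume : Measure (Reduced d N ν)).IsAddHaarMeasure :=
  Measure.prod.instIsAddHaarMeasure volume volume

/-- The inclusion into the phase space. -/
def incl (ν : ℝ) : Reduced d N ν →ₗ[ℝ] Phase d N :=
  (posSpace d N ν).subtype.prodMap LinearMap.id

/-- The gradients and the momenta. -/
def observables (ν : ℝ) :
    Phase d N →ₗ[ℝ] (Site d N → ℝ) × (Site d N → ℝ) × (Site d N × Dir d → ℝ) where
  toFun ω := (fun x => ω.2 x, fun x => ν * ω.1 x, fun b => ω.1 b.1 - ω.1 (nbr b.1 b.2))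
  map_add' ω ω' := by
    refine Prod.ext ?_ (Prod.ext ?_ ?_) <;> ext <;> simp <;> ring
  map_smul' c ω := by
    refine Prod.ext ?_ (Prod.ext ?_ ?_) <;> ext <;> simp <;> ring

/-- Vanishing gradients force constant positions. The constant is then removed by the pinning when
`ν ≠ 0` and by the zero sum condition when `ν = 0`. -/
theorem observables_incl_injective (ν : ℝ) :
    LinearMap.ker ((observables (d := d) (N := N) ν).comp (incl ν)) = ⊥ := by
  refine LinearMap.ker_eq_bot'.2 fun η h => ?_
  obtain ⟨⟨q, hq⟩, p⟩ := η
  have h1 := congrArg Prod.fst h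
  have h2 := congrArg (fun z => z.2.1) h
  have h3 := congrArg (fun z => z.2.2) h
  have hp : p = 0 := by
    ext x
    exact congrFun h1 x
  have hc : ∀ x y, q x = q y := eq_const_of_nbr (q := fun x => q x) fun x e =>
    (sub_eq_zero.1 (congrFun h3 (x, e))).symm
  have hq0 : q = 0 := by
    ext x
    by_cases hν : ν = 0
    · have hs : ∑ y, q y = 0 := hq hν
      simp only [fun y => hc y x, Finset.sum_const, Finset.card_univ, nsmul_eq_mul, mul_eq_zero,
        Nat.cast_eq_zero, Fintype.card_ne_zero, false_or] at hs
      exact hs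
    · have := congrFun h2 x
      exact (mul_eq_zero.1 this).resolve_left hν
  subst hp hq0
  rfl

/-- Coercivity of the energy. -/
theorem exists_le_energy {α ν : ℝ} (hα : 0 < α) (hν : 0 ≤ ν) :
    ∃ c : ℝ, 0 < c ∧ ∀ η : Reduced d N ν, c * ‖η‖ ^ 2 ≤ energy α ν (incl ν η) := by
  obtain ⟨K, hK, hA⟩ := LinearMap.exists_antilipschitzWith _
    (observables_incl_injective (d := d) (N := N) ν)
  -- The largest of the three constants bounding squared observables by the energy: 2 for the
  -- momenta, `ν` for the pinned positions, `2 / α` for the gradients.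
  set M := max (max 2 ν) (2 / α) with hM
  have hM0 : 0 < M := lt_of_lt_of_le two_pos ((le_max_left _ _).trans (le_max_left _ _))
  have hK' : (0 : ℝ) < K := hK
  refine ⟨(K ^ 2 * M)⁻¹, by positivity, fun η => ?_⟩
  set ω := incl ν η with hω
  have hE := energy_nonneg hα hν ω
  have hb : ∀ a : ℝ, a ^ 2 ≤ M * energy α ν ω → ‖a‖ ≤ √(M * energy α ν ω) := fun a h =>
    Real.abs_le_sqrt h
  have h1 : ‖observables ν ω‖ ≤ √(M * energy α ν ω) := by
    refine max_le ?_ (max_le ?_ ?_) <;>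
      refine (pi_norm_le_iff_of_nonneg (Real.sqrt_nonneg _)).2 fun x => hb _ ?_
    · exact (sq_snd_le hα hν ω x).trans (by gcongr; exact (le_max_left _ _).trans (le_max_left _ _))
    · have := sq_fst_le hα hν ω x
      calc (ν * ω.1 x) ^ 2 = ν * (ν * ω.1 x ^ 2) := by ring
        _ ≤ ν * energy α ν ω := by gcongr
        _ ≤ M * energy α ν ω := by gcongr; exact (le_max_right _ _).trans (le_max_left _ _)
    · have := sq_grad_le hα hν ω x.1 x.2
      calc (ω.1 x.1 - ω.1 (nbr x.1 x.2)) ^ 2 =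
            (α * (ω.1 x.1 - ω.1 (nbr x.1 x.2)) ^ 2) / α := by field_simp
        _ ≤ 2 * energy α ν ω / α := by gcongr
        _ = 2 / α * energy α ν ω := by ring
        _ ≤ M * energy α ν ω := by gcongr; exact le_max_right _ _
  have h2 : ‖η‖ ≤ K * ‖observables ν ω‖ := by
    have := hA.le_mul_dist η 0
    rwa [map_zero, dist_zero_right, dist_zero_right] at this
  have h3 : ‖η‖ ^ 2 ≤ (K * √(M * energy α ν ω)) ^ 2 :=
    pow_le_pow_left₀ (norm_nonneg _) (h2.trans (by gcongr)) 2
  rw [mul_pow, Real.sq_sqrt (by positivity)] at h3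
  rw [inv_mul_le_iff₀ (by positivity)]
  linarith

theorem hasTemperateGrowth_fst (ν : ℝ) (x : Site d N) :
    (fun η : Reduced d N ν => (incl ν η).1 x).HasTemperateGrowth :=
  ContinuousLinearMap.hasTemperateGrowth (((EuclideanSpace.proj (𝕜 := ℝ) x).comp
    ((posSpace d N ν).subtypeL.comp (ContinuousLinearMap.fst ℝ _ _)) : Reduced d N ν →L[ℝ] ℝ))

theorem hasTemperateGrowth_snd (ν : ℝ) (x : Site d N) :
    (fun η : Reduced d N ν => (incl ν η).2 x).HasTemperateGrowth :=
  ((EuclideanSpace.proj (𝕜 := ℝ) x).comp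
    (ContinuousLinearMap.snd ℝ (posSpace d N ν) (Config d N))).hasTemperateGrowth

theorem hasTemperateGrowth_current (α ν : ℝ) (k : Fin d) (x : Site d N) :
    (fun η : Reduced d N ν => current (harmV α) k x (incl ν η)).HasTemperateGrowth := by
  simp only [current_eq]
  have h1 := hasTemperateGrowth_fst (d := d) (N := N) ν
  have h2 := hasTemperateGrowth_snd (d := d) (N := N) ν
  exact ((Function.HasTemperateGrowth.const (-α)).mul ((h1 _).sub (h1 _))).mul
    ((h2 _).add (h2 _))

theorem hasTemperateGrowth_stiff (α ν : ℝ) (x : Site d N) :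
    (fun η : Reduced d N ν => stiff α ν (incl ν η).1 x).HasTemperateGrowth := by
  have h1 := hasTemperateGrowth_fst (d := d) (N := N) ν
  exact ((Function.HasTemperateGrowth.const (2 * ν)).mul (h1 _)).add
    (Function.HasTemperateGrowth.sum fun e _ =>
      (Function.HasTemperateGrowth.const (2 * α)).mul ((h1 _).sub (h1 _)))

theorem hasTemperateGrowth_quad (ν : ℝ) (A : Site d N → ℝ) :
    (fun η : Reduced d N ν => quad A (incl ν η)).HasTemperateGrowth := by
  have h1 := hasTemperateGrowth_fst (d := d) (N := N) ν
  have h2 := hasTemperateGrowth_snd (d := d) (N := N) ν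
  exact Function.HasTemperateGrowth.sum fun z _ => (Function.HasTemperateGrowth.const (A z)).mul
    (Function.HasTemperateGrowth.sum fun x _ => (h2 _).mul (h1 _))

theorem hasTemperateGrowth_energy (α ν : ℝ) :
    (fun η : Reduced d N ν => energy α ν (incl ν η)).HasTemperateGrowth := by
  have h1 := hasTemperateGrowth_fst (d := d) (N := N) ν
  have h2 := hasTemperateGrowth_snd (d := d) (N := N) ν
  have hc := fun c : ℝ =>
    Function.HasTemperateGrowth.const (E := posSpace d N ν × Config d N) c
  have : (fun η : Reduced d N ν => ∑ x : Site d N, ((1 / 2) * ((incl ν η).2 x * (incl ν η).2 x) +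
      ν * ((incl ν η).1 x * (incl ν η).1 x) +
      (1 / 2) * ∑ e : Dir d, α * (((incl ν η).1 x - (incl ν η).1 (nbr x e)) *
        ((incl ν η).1 x - (incl ν η).1 (nbr x e))))).HasTemperateGrowth :=
    Function.HasTemperateGrowth.sum fun x _ =>
      (((hc _).mul ((h2 _).mul (h2 _))).add ((hc _).mul ((h1 _).mul (h1 _)))).add
        ((hc _).mul (Function.HasTemperateGrowth.sum fun e _ =>
          (hc _).mul (((h1 _).sub (h1 _)).mul ((h1 _).sub (h1 _)))))
  convert this using 2 with η
  rw [energy_eq]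
  refine Finset.sum_congr rfl fun x _ => ?_
  simp only [sq]
  ring

theorem integrable_exp_neg_mul_sq_norm {V : Type*} [NormedAddCommGroup V] [InnerProductSpace ℝ V]
    [FiniteDimensional ℝ V] [MeasurableSpace V] [BorelSpace V] {b : ℝ} (hb : 0 < b) :
    Integrable fun v : V => Real.exp (-b * ‖v‖ ^ 2) := by
  have h := (GaussianFourier.integrable_cexp_neg_mul_sq_norm_add (V := V) (b := b)
    (by simpa using hb) 0 0).re
  refine h.congr (Eventually.of_forall fun v => ?_)
  simp only [zero_mul, add_zero]
  rw [show (-(b : ℂ) * (‖v‖ : ℂ) ^ 2) = ((-b * ‖v‖ ^ 2 : ℝ) : ℂ) by push_cast; ring]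
  exact Complex.exp_ofReal_re _

/-- The unnormalized Gibbs weight. -/
def weight (α ν T : ℝ) (η : Reduced d N ν) : ℝ := Real.exp (-energy α ν (incl ν η) / T)

theorem continuous_weight (α ν T : ℝ) : Continuous (weight (d := d) (N := N) α ν T) :=
  Real.continuous_exp.comp
    ((hasTemperateGrowth_energy (d := d) (N := N) α ν).1.continuous.neg.div_const T)

/-- A power is dominated by the exponential series, and completing the square turns the linear
exponent into a quadratic one. -/
theorem one_add_pow_le {b r : ℝ} (hb : 0 < b) (hr : 0 ≤ r) (k : ℕ) :
    (1 + r) ^ k ≤ k.factorial * Real.exp (1 + b⁻¹) * Real.exp (b * r ^ 2) := by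
  have h := Real.pow_div_factorial_le_exp (1 + r) (by positivity) k
  rw [div_le_iff₀ (by positivity)] at h
  refine h.trans ?_
  rw [mul_comm, mul_assoc, ← Real.exp_add]
  refine mul_le_mul_of_nonneg_left (Real.exp_le_exp.2 ?_) (by positivity)
  have h1 : 0 ≤ b⁻¹ * (b * r - 1) ^ 2 := by positivity
  have h2 : b⁻¹ * (b * r - 1) ^ 2 = b * r ^ 2 - 2 * r + b⁻¹ := by field_simp; ring
  linarith

/-- Functions of polynomial growth are integrable against the Gibbs weight. -/
theorem integrable_mul_weight {α ν T : ℝ} (hα : 0 < α) (hν : 0 ≤ ν) (hT : 0 < T)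
    {f : Reduced d N ν → ℝ} (hf : f.HasTemperateGrowth) :
    Integrable fun η => f η * weight α ν T η := by
  obtain ⟨c, hc, hcoer⟩ := exists_le_energy (d := d) (N := N) hα hν
  obtain ⟨k, C, hC⟩ := hf.2 0
  -- One third of the coercivity absorbs the polynomial growth. The norm of a pair is a maximum, so
  -- the other two thirds supply one Gaussian factor for the positions and one for the momenta.
  set b := c / (3 * T) with hb
  have hb0 : 0 < b := by positivity
  have hg : Integrable fun η : Reduced d N ν =>
      C * (k.factorial * Real.exp (1 + b⁻¹)) *
        (Real.exp (-b * ‖η.1‖ ^ 2) * Real.exp (-b * ‖η.2‖ ^ 2)) :=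
    ((integrable_exp_neg_mul_sq_norm hb0).mul_prod
      (integrable_exp_neg_mul_sq_norm hb0)).const_mul _
  refine hg.mono' (hf.1.continuous.mul (continuous_weight α ν T)).aestronglyMeasurable
    (Eventually.of_forall fun η => ?_)
  have h1 : ‖f η‖ ≤ C * (1 + ‖η‖) ^ k := by simpa using hC η
  have hC0 : 0 ≤ C := by
    have := (norm_nonneg _).trans h1
    exact nonneg_of_mul_nonneg_left this (by positivity)
  have h2 := one_add_pow_le hb0 (norm_nonneg η) k
  have h3 : weight α ν T η ≤ Real.exp (-(3 * b * ‖η‖ ^ 2)) := by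
    refine Real.exp_le_exp.2 ?_
    rw [neg_div, neg_le_neg_iff, le_div_iff₀ hT, hb]
    calc 3 * (c / (3 * T)) * ‖η‖ ^ 2 * T = c * ‖η‖ ^ 2 := by field_simp
      _ ≤ _ := hcoer η
  have h4 : ‖η.1‖ ^ 2 ≤ ‖η‖ ^ 2 := pow_le_pow_left₀ (norm_nonneg _) (norm_fst_le η) 2
  have h5 : ‖η.2‖ ^ 2 ≤ ‖η‖ ^ 2 := pow_le_pow_left₀ (norm_nonneg _) (norm_snd_le η) 2
  rw [norm_mul, Real.norm_of_nonneg (Real.exp_pos _).le (r := weight α ν T η)]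
  calc ‖f η‖ * weight α ν T η
      ≤ (C * (k.factorial * Real.exp (1 + b⁻¹) * Real.exp (b * ‖η‖ ^ 2))) *
        Real.exp (-(3 * b * ‖η‖ ^ 2)) := by
        refine mul_le_mul (h1.trans (by gcongr)) h3 (Real.exp_pos _).le (by positivity)
    _ = C * (k.factorial * Real.exp (1 + b⁻¹)) * Real.exp (-(2 * b * ‖η‖ ^ 2)) := by
        rw [mul_assoc C, mul_assoc (_ * _) (Real.exp _), ← Real.exp_add, mul_assoc C]
        congr 3; ring
    _ ≤ _ := by
        rw [← Real.exp_add]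
        gcongr
        nlinarith

theorem integrable_weight {α ν T : ℝ} (hα : 0 < α) (hν : 0 ≤ ν) (hT : 0 < T) :
    Integrable (weight (d := d) (N := N) α ν T) := by
  simpa using integrable_mul_weight hα hν hT
    (Function.HasTemperateGrowth.const (E := Reduced d N ν) (1 : ℝ))

theorem integral_weight_pos {α ν T : ℝ} (hα : 0 < α) (hν : 0 ≤ ν) (hT : 0 < T) :
    0 < ∫ η : Reduced d N ν, weight α ν T η :=
  integral_exp_pos (integrable_weight hα hν hT)

theorem measurableEmbedding_incl (ν : ℝ) : MeasurableEmbedding (incl (d := d) (N := N) ν) := by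
  refine (LinearMap.isClosedEmbedding_of_injective (𝕜 := ℝ) (f := incl (d := d) (N := N) ν) ?_).measurableEmbedding
  refine LinearMap.ker_eq_bot.2 fun η η' h => ?_
  exact Prod.ext (Subtype.ext (congrArg (Prod.fst : Phase d N → _) h))
    (congrArg (Prod.snd : Phase d N → _) h)

theorem lebesgue_eq (ν : ℝ) : lebesgue d N ν = Measure.map (incl ν) volume := by
  have h := Measure.map_prod_map (volume : Measure (posSpace d N ν)) (volume : Measure (Config d N))
    (f := fun q : posSpace d N ν => (q : Config d N)) (g := id) measurable_subtype_coe measurable_id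
  rw [Measure.map_id] at h
  exact h

theorem integrable_exp_lebesgue {α ν T : ℝ} (hα : 0 < α) (hν : 0 ≤ ν) (hT : 0 < T) :
    Integrable (fun ω => Real.exp (-hamiltonian (harmV α) (harmW ν) ω / T))
      (lebesgue d N ν) := by
  rw [lebesgue_eq, (measurableEmbedding_incl ν).integrable_map_iff]
  exact integrable_weight hα hν hT

theorem isProbabilityMeasure_gibbs {α ν T : ℝ} (hα : 0 < α) (hν : 0 ≤ ν) (hT : 0 < T) :
    IsProbabilityMeasure (gibbs d N α ν T) := by
  have : NeZero (lebesgue d N ν) := by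
    refine ⟨?_⟩
    rw [lebesgue_eq, Ne, Measure.map_eq_zero_iff (measurableEmbedding_incl ν).measurable.aemeasurable]
    exact NeZero.ne _
  exact isProbabilityMeasure_tilted (integrable_exp_lebesgue hα hν hT)

theorem integrable_gibbs_iff {α ν T : ℝ} (hα : 0 < α) (hν : 0 ≤ ν) (hT : 0 < T)
    (f : Phase d N → ℝ) : Integrable f (gibbs d N α ν T) ↔
      Integrable fun η => f (incl ν η) * weight α ν T η := by
  rw [gibbs, integrable_tilted_iff (integrable_exp_lebesgue hα hν hT), lebesgue_eq,
    (measurableEmbedding_incl ν).integrable_map_iff]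
  refine integrable_congr (Eventually.of_forall fun η => ?_)
  exact mul_comm _ _

theorem integral_gibbs (α ν T : ℝ) (f : Phase d N → ℝ) :
    ∫ ω, f ω ∂(gibbs d N α ν T) =
      (∫ η : Reduced d N ν, weight α ν T η)⁻¹ * ∫ η, f (incl ν η) * weight α ν T η := by
  rw [gibbs, integral_tilted, lebesgue_eq, (measurableEmbedding_incl ν).integral_map,
    (measurableEmbedding_incl ν).integral_map, ← integral_const_mul]
  refine integral_congr_ae (Eventually.of_forall fun η => ?_)
  simp only [smul_eq_mul]
  rw [div_eq_mul_inv, mul_comm (Real.exp _), mul_assoc, mul_comm (Real.exp _)]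
  rfl

theorem integrable_gibbs {α ν T : ℝ} (hα : 0 < α) (hν : 0 ≤ ν) (hT : 0 < T)
    {f : Phase d N → ℝ} (hf : (fun η => f (incl ν η)).HasTemperateGrowth) :
    Integrable f (gibbs d N α ν T) :=
  (integrable_gibbs_iff hα hν hT f).2 (integrable_mul_weight hα hν hT hf)

/-- Gaussian integration by parts. -/
theorem gibbs_integration_by_parts {α ν T : ℝ} (hα : 0 < α) (hν : 0 ≤ ν) (hT : 0 < T)
    {f f' : Phase d N → ℝ} (v : Reduced d N ν)
    (hf : (fun η => f (incl ν η)).HasTemperateGrowth)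
    (hf' : (fun η => f' (incl ν η)).HasTemperateGrowth)
    (hd : ∀ ω, HasDerivAt (fun s : ℝ => f (ω + s • incl ν v)) (f' ω) 0) :
    ∫ ω, f ω * dEnergy α ν ω (incl ν v) ∂(gibbs d N α ν T) =
      T * ∫ ω, f' ω ∂(gibbs d N α ν T) := by
  have hE : (fun η : Reduced d N ν => dEnergy α ν (incl ν η) (incl ν v)).HasTemperateGrowth :=
    Function.HasTemperateGrowth.sum fun x _ =>
      ((hasTemperateGrowth_snd ν x).mul (Function.HasTemperateGrowth.const _)).add
        ((hasTemperateGrowth_stiff α ν x).mul (Function.HasTemperateGrowth.const _))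
  -- The logarithmic derivative of the weight along `v` is `-dEnergy / T`; this is the source of the
  -- factor `T` in the formula.
  have hw : ∀ η : Reduced d N ν, HasLineDerivAt ℝ (weight α ν T)
      (-(T⁻¹ * (dEnergy α ν (incl ν η) (incl ν v) * weight α ν T η))) η v := by
    intro η
    have h1 : HasDerivAt (fun s : ℝ => energy α ν (incl ν η) +
        s * dEnergy α ν (incl ν η) (incl ν v) + s ^ 2 * energy α ν (incl ν v))
        (dEnergy α ν (incl ν η) (incl ν v)) 0 := by
      refine ((((hasDerivAt_id (0 : ℝ)).mul_const _).const_add _).add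
        (((hasDerivAt_id (0 : ℝ)).pow 2).mul_const _)).congr_deriv ?_
      simp
    have h2 : HasDerivAt (fun s : ℝ => energy α ν (incl ν (η + s • v)))
        (dEnergy α ν (incl ν η) (incl ν v)) 0 := by
      refine h1.congr_of_eventuallyEq (Eventually.of_forall fun s => ?_)
      simp only [map_add, map_smul, energy_add_smul]
    refine ((h2.neg.div_const T).exp).congr_deriv ?_
    simp only [zero_smul, add_zero, weight, Pi.neg_apply]
    ring
  have key := integral_bilinear_hasLineDerivAt_right_eq_neg_left_of_integrable
    (μ := (volume : Measure (Reduced d N ν))) (B := ContinuousLinearMap.mul ℝ ℝ)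
    (f := fun η => f (incl ν η)) (f' := fun η => f' (incl ν η)) (g := weight α ν T)
    (g' := fun η => -(T⁻¹ * (dEnergy α ν (incl ν η) (incl ν v) * weight α ν T η))) (v := v)
    (integrable_mul_weight hα hν hT hf')
    (by
      refine ((integrable_mul_weight hα hν hT (hf.mul hE)).const_mul (-T⁻¹)).congr
        (Eventually.of_forall fun η => ?_)
      simp only [ContinuousLinearMap.mul_apply', Pi.mul_apply]
      ring)
    (integrable_mul_weight hα hν hT hf)
    (fun η _ => by
      have := hd (incl ν η)
      simpa only [HasLineDerivAt, map_add, map_smul] using this)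
    (fun η _ => hw η)
  simp only [ContinuousLinearMap.mul_apply', mul_neg, integral_neg, neg_inj] at key
  rw [integral_gibbs, integral_gibbs, ← key, mul_left_comm, ← integral_const_mul T]
  congr 1
  refine integral_congr_ae (Eventually.of_forall fun η => ?_)
  simp only
  field_simp

end Reduced

/-! ### Equilibrium covariance of the current with the modes. -/

section Moments

variable {d N : ℕ} [NeZero N]

theorem sum_mode_sub (ξ y : Site d N) : ∑ x, mode ξ (x - y) = 0 := by
  have := sum_add_right (mode ξ) (-y)
  simp only [← sub_eq_add_neg] at this
  rw [this, sum_odd (mode_neg ξ)]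

/-- The direction of the positions given by a translated Fourier mode. -/
def modeVec (ν : ℝ) (ξ y : Site d N) : Reduced d N ν :=
  (⟨WithLp.toLp 2 fun x => mode ξ (x - y), fun _ => sum_mode_sub ξ y⟩, 0)

theorem dEnergy_modeVec (α ν : ℝ) (ξ y : Site d N) (ω : Phase d N) :
    dEnergy α ν ω (incl ν (modeVec ν ξ y)) = ∑ x, stiff α ν ω.1 x * mode ξ (x - y) := by
  simp [dEnergy, incl, modeVec]

/-- A translated mode is an eigenvector of the stiffness, and self-adjointness moves the operator
onto the positions. The result is in the form required for integration by parts, and no covariance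
matrix has to be inverted. -/
theorem stiffEig_mul_quad (α ν : ℝ) (ξ : Site d N) (ω : Phase d N) :
    stiffEig α ν ξ * quad (mode ξ) ω =
      ∑ y, ω.2 y * dEnergy α ν ω (incl ν (modeVec ν ξ y)) := by
  have h : quad (mode ξ) ω = ∑ y, ω.2 y * ∑ x, mode ξ (x - y) * ω.1 x := by
    simp only [quad, Finset.mul_sum]
    rw [Finset.sum_comm]
    refine Finset.sum_congr rfl fun y _ => ?_
    rw [← sum_add_right _ (-y)]
    refine Finset.sum_congr rfl fun x _ => ?_
    rw [← sub_eq_add_neg, add_sub_cancel]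
    ring
  rw [h, Finset.mul_sum]
  refine Finset.sum_congr rfl fun y _ => ?_
  rw [dEnergy_modeVec, sum_stiff_mul]
  simp only [stiff_mode]
  rw [mul_left_comm, Finset.mul_sum]
  congr 1
  exact Finset.sum_congr rfl fun x _ => by ring

variable {α ν T : ℝ}

theorem hasTemperateGrowth_dEnergy (α : ℝ) (v : Phase d N) :
    (fun η : Reduced d N ν => dEnergy α ν (incl ν η) v).HasTemperateGrowth :=
  Function.HasTemperateGrowth.sum fun x _ =>
    ((hasTemperateGrowth_snd ν x).mul (Function.HasTemperateGrowth.const _)).add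
      ((hasTemperateGrowth_stiff α ν x).mul (Function.HasTemperateGrowth.const _))

theorem integral_sub_mul_dEnergy (hα : 0 < α) (hν : 0 ≤ ν) (hT : 0 < T) (a b : Site d N)
    (v : Reduced d N ν) :
    ∫ ω, (ω.1 a - ω.1 b) * dEnergy α ν ω (incl ν v) ∂(gibbs d N α ν T) =
      T * ((incl ν v).1 a - (incl ν v).1 b) := by
  have := isProbabilityMeasure_gibbs (d := d) (N := N) hα hν hT
  rw [gibbs_integration_by_parts hα hν hT (f := fun ω => ω.1 a - ω.1 b)
    (f' := fun _ => (incl ν v).1 a - (incl ν v).1 b) v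
    ((hasTemperateGrowth_fst ν a).sub (hasTemperateGrowth_fst ν b))
    (Function.HasTemperateGrowth.const _)]
  · simp
  · intro ω
    have : HasDerivAt (fun s : ℝ => (ω.1 a + s * (incl ν v).1 a) - (ω.1 b + s * (incl ν v).1 b))
        (1 * (incl ν v).1 a - 1 * (incl ν v).1 b) 0 :=
      (((hasDerivAt_id (0 : ℝ)).mul_const _).const_add _).sub
        (((hasDerivAt_id (0 : ℝ)).mul_const _).const_add _)
    simpa using this

theorem integral_mul_snd_mul_snd (hα : 0 < α) (hν : 0 ≤ ν) (hT : 0 < T) (x y : Site d N)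
    {g : Config d N → ℝ} (hg : (fun η : Reduced d N ν => g (incl ν η).1).HasTemperateGrowth) :
    ∫ ω, g ω.1 * ω.2 x * ω.2 y ∂(gibbs d N α ν T) =
      T * ((if x = y then 1 else 0) * ∫ ω, g ω.1 ∂(gibbs d N α ν T)) := by
  set v : Reduced d N ν := (0, EuclideanSpace.single y 1) with hv
  have h1 : ∀ ω : Phase d N, dEnergy α ν ω (incl ν v) = ω.2 y := by
    intro ω
    simp [dEnergy, incl, hv]
  have h2 := gibbs_integration_by_parts hα hν hT (f := fun ω => g ω.1 * ω.2 x)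
    (f' := fun ω => (if x = y then 1 else 0) * g ω.1) v
    (hg.mul (hasTemperateGrowth_snd ν x)) ((Function.HasTemperateGrowth.const _).mul hg)
    (fun ω => by
      have : HasDerivAt (fun s : ℝ => g ω.1 * (ω.2 x + s * (if x = y then 1 else 0)))
          (g ω.1 * (1 * (if x = y then 1 else 0))) 0 :=
        (((hasDerivAt_id (0 : ℝ)).mul_const _).const_add _).const_mul _
      refine (this.congr_of_eventuallyEq (Eventually.of_forall fun s => ?_)).congr_deriv
        (by ring)
      simp [incl, hv])
  simp only [h1, integral_const_mul] at h2
  exact h2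

/-- Equilibrium covariance of a local current and of a Fourier mode of the total current. -/
theorem stiffEig_mul_integral_current_mul_quad (hα : 0 < α) (hν : 0 ≤ ν) (hT : 0 < T)
    (k : Fin d) (x ξ : Site d N) :
    stiffEig α ν ξ * ∫ ω, current (harmV α) k x ω * quad (mode ξ) ω ∂(gibbs d N α ν T) =
      -(2 * α * T ^ 2 * Real.sin (2 * Real.pi * grid ξ k)) := by
  set u := unitVec N (k, true) with hu
  set g : Site d N → Config d N → ℝ := fun y q =>
    (q (x + u) - q x) * dEnergy α ν (q, 0) (incl ν (modeVec ν ξ y)) with hgdef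
  have hdE : ∀ (ω : Phase d N) y, dEnergy α ν (ω.1, 0) (incl ν (modeVec ν ξ y)) =
      dEnergy α ν ω (incl ν (modeVec ν ξ y)) := fun ω y => by
    rw [dEnergy_modeVec, dEnergy_modeVec]
  have hg : ∀ y, (fun η : Reduced d N ν => g y (incl ν η).1).HasTemperateGrowth := by
    intro y
    simp only [hgdef, hdE]
    exact ((hasTemperateGrowth_fst ν (x + u)).sub (hasTemperateGrowth_fst ν x)).mul
      (hasTemperateGrowth_dEnergy α _)
  have hint : ∀ y, ∫ ω : Phase d N, g y ω.1 ∂(gibbs d N α ν T) =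
      T * (mode ξ (x + u - y) - mode ξ (x - y)) := by
    intro y
    simp only [hgdef, hdE]
    rw [integral_sub_mul_dEnergy hα hν hT]
    rfl
  have hi : ∀ y z, Integrable (fun ω : Phase d N => g y ω.1 * ω.2 z * ω.2 y)
      (gibbs d N α ν T) := fun y z => integrable_gibbs hα hν hT
    (((hg y).mul (hasTemperateGrowth_snd ν z)).mul (hasTemperateGrowth_snd ν y))
  have h1 : ∀ ω : Phase d N, stiffEig α ν ξ * (current (harmV α) k x ω * quad (mode ξ) ω) =
      ∑ y, -α * (g y ω.1 * ω.2 (x + u) * ω.2 y + g y ω.1 * ω.2 x * ω.2 y) := by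
    intro ω
    rw [mul_left_comm, stiffEig_mul_quad, current_eq, Finset.mul_sum]
    refine Finset.sum_congr rfl fun y _ => ?_
    simp only [hgdef, hdE]
    rw [nbr_eq]
    ring
  rw [← integral_const_mul]
  simp only [h1]
  rw [integral_finsetSum _ fun y _ => ((hi y (x + u)).fun_add (hi y x)).const_mul (-α)]
  have h0 : mode ξ 0 = 0 := by
    have := mode_neg ξ 0
    rw [neg_zero] at this
    linarith
  -- Integration over the momenta keeps only `y = x + u` and `y = x`. By oddness of the mode, both
  -- give the same value `mode ξ u`.
  have h2 : ∀ y, ∫ ω : Phase d N, -α * (g y ω.1 * ω.2 (x + u) * ω.2 y + g y ω.1 * ω.2 x * ω.2 y)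
      ∂(gibbs d N α ν T) = (if x + u = y then -α * T ^ 2 * mode ξ u else 0) +
        (if x = y then -α * T ^ 2 * mode ξ u else 0) := by
    intro y
    rw [integral_const_mul, integral_add (hi y _) (hi y _),
      integral_mul_snd_mul_snd hα hν hT _ _ (hg y), integral_mul_snd_mul_snd hα hν hT _ _ (hg y),
      hint]
    have h3 : x + u = y → mode ξ (x + u - y) - mode ξ (x - y) = mode ξ u := by
      rintro rfl
      rw [sub_self, h0, sub_add_cancel_left, mode_neg]; ring
    have h4 : x = y → mode ξ (x + u - y) - mode ξ (x - y) = mode ξ u := by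
      rintro rfl
      rw [sub_self, h0, add_sub_cancel_left]; ring
    split_ifs with h5 h6 h6
    · rw [h3 h5]; ring
    · rw [h3 h5]; ring
    · rw [h4 h6]; ring
    · ring
  simp only [h2, Finset.sum_add_distrib, Finset.sum_ite_eq, Finset.mem_univ, if_true]
  rw [← mode_unitVec]
  ring

end Moments

/-! ### Invariance of the Gibbs measure. -/

section Invariance

variable {d N : ℕ} [NeZero N]

/-- The constant to add to the positions to come back to `posSpace`. -/
def drift (ν : ℝ) : Phase d N →ₗ[ℝ] ℝ where
  toFun ω := if ν = 0 then -(∑ x, ω.1 x) / Fintype.card (Site d N) else 0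
  map_add' ω ω' := by
    split_ifs
    · simp only [Prod.fst_add, PiLp.add_apply, Finset.sum_add_distrib]; ring
    · simp
  map_smul' c ω := by
    split_ifs
    · simp only [Prod.smul_fst, PiLp.smul_apply, smul_eq_mul, ← Finset.mul_sum, RingHom.id_apply]
      ring
    · simp

theorem mul_drift (ν : ℝ) (ω : Phase d N) : ν * drift ν ω = 0 := by
  simp only [drift, LinearMap.coe_mk, AddHom.coe_mk]
  split_ifs with h <;> simp [h]

theorem fst_add_cst_drift_mem (ν : ℝ) (ω : Phase d N) :
    (ω + cst (drift ν ω)).1 ∈ posSpace d N ν := by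
  intro h
  have hc : (Fintype.card (Site d N) : ℝ) ≠ 0 := Nat.cast_ne_zero.2 Fintype.card_ne_zero
  simp only [cst, Prod.fst_add, PiLp.add_apply, Finset.sum_add_distrib, drift, h, if_true,
    LinearMap.coe_mk, AddHom.coe_mk, Finset.sum_const, Finset.card_univ, nsmul_eq_mul]
  field_simp
  ring

theorem cst_add (a b : ℝ) : (cst (a + b) : Phase d N) = cst a + cst b := by
  refine Prod.ext ?_ (add_zero _).symm
  ext; simp [cst]

theorem cst_smul (a b : ℝ) : (cst (a * b) : Phase d N) = a • cst b := by
  refine Prod.ext ?_ (smul_zero _).symm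
  ext; simp [cst]

/-- The projection to the reduced phase space. -/
def reduce (ν : ℝ) : Phase d N →ₗ[ℝ] Reduced d N ν where
  toFun ω := (⟨(ω + cst (drift ν ω)).1, fst_add_cst_drift_mem ν ω⟩, ω.2)
  map_add' ω ω' := by
    refine Prod.ext (Subtype.ext ?_) rfl
    change (ω + ω' + cst (drift ν (ω + ω'))).1 = (ω + cst (drift ν ω) + (ω' + cst (drift ν ω'))).1
    rw [map_add, cst_add, add_add_add_comm]
  map_smul' c ω := by
    refine Prod.ext (Subtype.ext ?_) rfl
    change (c • ω + cst (drift ν (c • ω))).1 = (c • (ω + cst (drift ν ω))).1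
    rw [map_smul, smul_eq_mul, cst_smul, smul_add]

theorem incl_reduce (ν : ℝ) (ω : Phase d N) : incl ν (reduce ν ω) = ω + cst (drift ν ω) :=
  Prod.ext rfl (add_zero _).symm

variable {α ν T : ℝ}

/-- Linear maps preserving the energy preserve the Gibbs measure, as far as functions of the
momenta and of the deformation field are concerned. -/
theorem integral_comp_gibbs (hα : 0 < α) (hν : 0 ≤ ν) (hT : 0 < T)
    (Φ : Phase d N →ₗ[ℝ] Phase d N) (hΦ : ∀ ω, energy α ν (Φ ω) = energy α ν ω)
    {F : Phase d N → ℝ} (hF : ∀ ω c, ν * c = 0 → F (ω + cst c) = F ω) :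
    ∫ ω, F (Φ ω) ∂(gibbs d N α ν T) = ∫ ω, F ω ∂(gibbs d N α ν T) := by
  -- The image under `Φ` may leave the reduced space, so it is recentred; neither the energy nor `F`
  -- notices the shift.
  set Ψ : Reduced d N ν →ₗ[ℝ] Reduced d N ν := (reduce ν).comp (Φ.comp (incl ν)) with hΨ
  have hΨe : ∀ η, incl ν (Ψ η) = Φ (incl ν η) + cst (drift ν (Φ (incl ν η))) := fun η =>
    incl_reduce ν _
  have hE : ∀ η, energy α ν (incl ν (Ψ η)) = energy α ν (incl ν η) := fun η => by
    rw [hΨe, energy_add_cst (mul_drift _ _), hΦ]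
  obtain ⟨c, hc, hcoer⟩ := exists_le_energy (d := d) (N := N) hα hν
  have hker : LinearMap.ker Ψ = ⊥ := by
    refine LinearMap.ker_eq_bot'.2 fun η h => ?_
    have h1 := hcoer η
    rw [← hE, h, map_zero] at h1
    have h2 : energy α ν (0 : Phase d N) = 0 := by simp [energy_eq]
    rw [h2] at h1
    have h3 : ‖η‖ ^ 2 ≤ 0 := by
      by_contra h4
      push Not at h4
      exact absurd h1 (not_le.2 (mul_pos hc h4))
    exact norm_eq_zero.1 (pow_eq_zero_iff two_ne_zero |>.1 (le_antisymm h3 (sq_nonneg _)))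
  have hdet : LinearMap.det Ψ ≠ 0 := by
    have := (LinearEquiv.ofInjectiveEndo Ψ (LinearMap.ker_eq_bot.1 hker)).isUnit_det'
    exact this.ne_zero
  have hemb : MeasurableEmbedding Ψ :=
    (LinearMap.isClosedEmbedding_of_injective (𝕜 := ℝ) hker).measurableEmbedding
  have hmap := Measure.map_linearMap_addHaar_eq_smul_addHaar
    (volume : Measure (Reduced d N ν)) hdet
  set r := |(LinearMap.det Ψ)⁻¹| with hr
  have hchange : ∀ G : Reduced d N ν → ℝ, ∫ η, G (Ψ η) = r * ∫ η, G η := by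
    intro G
    rw [← hemb.integral_map, hmap, integral_smul_measure,
      ENNReal.toReal_ofReal (abs_nonneg _), smul_eq_mul]
  have hw : ∀ η, weight α ν T (Ψ η) = weight α ν T η := fun η => by rw [weight, hE, weight]
  -- The Jacobian is not computed: the change of variables is applied to the weight itself, which is
  -- invariant and has positive integral.
  have hr1 : r = 1 := by
    have h1 := hchange (weight α ν T)
    simp only [hw] at h1
    have h2 := integral_weight_pos (d := d) (N := N) hα hν hT
    have h3 : (r - 1) * ∫ η : Reduced d N ν, weight α ν T η = 0 := by linarith
    rcases mul_eq_zero.1 h3 with h | h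
    · linarith
    · exact absurd h h2.ne'
  rw [integral_gibbs, integral_gibbs]
  congr 1
  have h := hchange fun η => F (incl ν η) * weight α ν T η
  rw [hr1, one_mul] at h
  rw [← h]
  refine integral_congr_ae (Eventually.of_forall fun η => ?_)
  simp only [hw, hΨe, hF _ _ (mul_drift ν _)]

/-- The exchange of two momenta, as a linear map. -/
def exchangeLin (b : Site d N × Dir d) : Phase d N →ₗ[ℝ] Phase d N where
  toFun := exchange b
  map_add' ω ω' := by
    refine Prod.ext rfl ?_
    ext x
    simp [exchange]
  map_smul' c ω := by
    refine Prod.ext rfl ?_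
    ext x
    simp [exchange]

theorem integral_flow_gibbs (hα : 0 < α) (hν : 0 ≤ ν) (hT : 0 < T) (t : ℝ)
    {F : Phase d N → ℝ} (hF : ∀ ω c, ν * c = 0 → F (ω + cst c) = F ω) :
    ∫ ω, F (flow α ν t ω) ∂(gibbs d N α ν T) = ∫ ω, F ω ∂(gibbs d N α ν T) :=
  integral_comp_gibbs hα hν hT (flow α ν t).toLinearMap (energy_flow α ν t) hF

theorem integral_exchange_flow_gibbs (hα : 0 < α) (hν : 0 ≤ ν) (hT : 0 < T)
    (b : Site d N × Dir d) (t : ℝ)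
    {F : Phase d N → ℝ} (hF : ∀ ω c, ν * c = 0 → F (ω + cst c) = F ω) :
    ∫ ω, F (exchange b (flow α ν t ω)) ∂(gibbs d N α ν T) = ∫ ω, F ω ∂(gibbs d N α ν T) :=
  integral_comp_gibbs hα hν hT ((exchangeLin b).comp (flow α ν t).toLinearMap)
    (fun ω => (energy_exchange α ν b _).trans (energy_flow α ν t ω)) hF

/-- The forms with odd kernel are controlled by the energy. -/
theorem exists_abs_quad_le (hα : 0 < α) (hν : 0 ≤ ν) {A : Site d N → ℝ}
    (hA : ∀ z, A (-z) = -A z) :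
    ∃ C : ℝ, 0 ≤ C ∧ ∀ ω : Phase d N, |quad A ω| ≤ C * energy α ν ω := by
  obtain ⟨c, hc, hcoer⟩ := exists_le_energy (d := d) (N := N) hα hν
  have hS : 0 ≤ ∑ z, |A z| * Fintype.card (Site d N) := by positivity
  refine ⟨(∑ z, |A z| * Fintype.card (Site d N)) / c, by positivity, fun ω => ?_⟩
  -- Coercivity is available only on the reduced space; both sides are unchanged by recentring
  -- there.
  rw [← quad_add_cst hA ω (drift ν ω), ← energy_add_cst (mul_drift ν ω) ω, ← incl_reduce]
  set η := reduce ν ω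
  have h1 : ∀ x, |(incl ν η).1 x| ≤ ‖η‖ := fun x =>
    ((PiLp.norm_apply_le (p := 2) (incl ν η).1 x)).trans (norm_fst_le η)
  have h2 : ∀ x, |(incl ν η).2 x| ≤ ‖η‖ := fun x =>
    ((PiLp.norm_apply_le (p := 2) (incl ν η).2 x)).trans (norm_snd_le η)
  calc |quad A (incl ν η)|
      ≤ ∑ z, |A z| * (Fintype.card (Site d N) * ‖η‖ ^ 2) := by
        refine (Finset.abs_sum_le_sum_abs _ _).trans (Finset.sum_le_sum fun z _ => ?_)
        rw [abs_mul]
        gcongr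
        refine (Finset.abs_sum_le_sum_abs _ _).trans ?_
        rw [← nsmul_eq_mul, ← Finset.card_univ]
        refine Finset.sum_le_card_nsmul _ _ _ fun x _ => ?_
        rw [abs_mul, sq]
        exact mul_le_mul (h2 x) (h1 _) (abs_nonneg _) (norm_nonneg _)
    _ = (∑ z, |A z| * Fintype.card (Site d N)) / c * (c * ‖η‖ ^ 2) := by
        rw [Finset.sum_div, Finset.sum_mul]
        refine Finset.sum_congr rfl fun z _ => ?_
        field_simp
    _ ≤ _ := by gcongr; exact hcoer η

end Invariance

/-! ### The unit exponential law. -/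

section Exponential

theorem expMeasure_one_eq :
    expMeasure 1 = (volume.restrict (Ioi (0 : ℝ))).withDensity fun s => ENNReal.ofReal (Real.exp (-s)) := by
  have h : expMeasure 1 = volume.withDensity (exponentialPDF 1) := rfl
  rw [h, ← withDensity_indicator measurableSet_Ioi]
  refine withDensity_congr_ae ?_
  have h0 : ∀ᵐ s : ℝ, s ≠ 0 := by simp [ae_iff, measure_singleton]
  filter_upwards [h0] with s hs
  rw [exponentialPDF_eq]
  rcases lt_or_gt_of_ne hs with h1 | h1
  · rw [if_neg (not_le.2 h1), indicator_of_notMem (by simpa using h1.le), ENNReal.ofReal_zero]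
  · rw [if_pos h1.le, indicator_of_mem (by simpa using h1)]
    simp

theorem ae_pos_expMeasure : ∀ᵐ s ∂(expMeasure 1), 0 < s := by
  rw [expMeasure_one_eq]
  exact (withDensity_absolutelyContinuous _ _) (ae_restrict_mem measurableSet_Ioi)

theorem integral_expMeasure (f : ℝ → ℝ) :
    ∫ s, f s ∂(expMeasure 1) = ∫ s in Ioi (0 : ℝ), Real.exp (-s) * f s := by
  rw [expMeasure_one_eq, integral_withDensity_eq_integral_toReal_smul (by fun_prop)
    (Eventually.of_forall fun _ => ENNReal.ofReal_lt_top)]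
  simp only [ENNReal.toReal_ofReal (Real.exp_pos _).le, smul_eq_mul]

/-- Lack of memory of the exponential law. -/
theorem integral_expMeasure_shift {b : ℝ} (hb : 0 ≤ b) (f : ℝ → ℝ) :
    ∫ s, (if s ≤ b then 0 else f (s - b)) ∂(expMeasure 1) =
      Real.exp (-b) * ∫ s, f s ∂(expMeasure 1) := by
  rw [integral_expMeasure, integral_expMeasure, ← integral_const_mul]
  rw [← integral_indicator measurableSet_Ioi, ← integral_indicator measurableSet_Ioi]
  symm
  rw [← integral_sub_right_eq_self _ b]
  refine integral_congr_ae (Eventually.of_forall fun s => ?_)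
  simp only [indicator_apply, mem_Ioi, sub_pos]
  rcases le_or_gt s b with h | h
  · simp [h, not_lt.2 h]
  · rw [if_pos (hb.trans_lt h), if_neg (not_le.2 h), if_pos h, ← mul_assoc, ← Real.exp_add]
    congr 2
    ring

theorem expMeasure_real_Iic {b : ℝ} (hb : 0 ≤ b) :
    (expMeasure 1).real (Iic b) = 1 - Real.exp (-b) := by
  rw [← cdf_eq_real, cdf_expMeasure_eq one_pos, if_pos hb, one_mul]

end Exponential

/-! ### Prepending a term to an independent sequence. -/

section Cons

variable {X : Type*} [MeasurableSpace X]

/-- Adding a first term to a sequence. -/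
def consSeq (p : X × (ℕ → X)) : ℕ → X
  | 0 => p.1
  | n + 1 => p.2 n

theorem measurable_consSeq : Measurable (consSeq (X := X)) := by
  refine measurable_pi_iff.2 fun n => ?_
  cases n with
  | zero => exact measurable_fst
  | succ n => exact (measurable_pi_apply n).comp measurable_snd

/-- The two laws are compared on cylinders, first enlarged to an initial segment of coordinates so
that the first factor splits off. Conditioning on the first exchange rests on this. -/
theorem map_consSeq (μ : Measure X) [IsProbabilityMeasure μ] :
    Measure.map consSeq (μ.prod (Measure.infinitePi fun _ : ℕ => μ)) =
      Measure.infinitePi fun _ : ℕ => μ := by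
  classical
  refine Measure.eq_infinitePi _ fun s t ht => ?_
  obtain ⟨m, hm⟩ : ∃ m : ℕ, s ⊆ Finset.range (m + 1) := by
    refine ⟨s.sup id, fun i hi => ?_⟩
    have := Finset.le_sup (f := id) hi
    simp only [id] at this
    simpa [Nat.lt_succ_iff] using this
  set t' : ℕ → Set X := fun i => if i ∈ s then t i else univ with ht'
  have hmeas : ∀ i, MeasurableSet (t' i) := fun i => by
    simp only [ht']; split_ifs; exacts [ht i, MeasurableSet.univ]
  have h1 : (s : Set ℕ).pi t = (Finset.range (m + 1) : Set ℕ).pi t' := by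
    ext x
    simp only [Set.mem_pi, ht', Finset.mem_coe]
    refine ⟨fun h i _ => ?_, fun h i hi => ?_⟩
    · split_ifs with hi
      exacts [h i hi, mem_univ _]
    · simpa [hi] using h i (hm hi)
  have h2 : ∏ i ∈ s, μ (t i) = ∏ i ∈ Finset.range (m + 1), μ (t' i) := by
    rw [← Finset.prod_subset hm (f := fun i => μ (t' i))]
    · exact Finset.prod_congr rfl fun i hi => by simp [ht', hi]
    · intro i _ hi
      simp [ht', hi]
  have h3 : consSeq ⁻¹' ((Finset.range (m + 1) : Set ℕ).pi t') =
      t' 0 ×ˢ ((Finset.range m : Set ℕ).pi fun i => t' (i + 1)) := by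
    ext p
    simp only [mem_preimage, Set.mem_pi, Finset.coe_range, mem_Iio, mem_prod]
    refine ⟨fun h => ⟨h 0 (Nat.succ_pos _), fun i hi => h (i + 1) (Nat.succ_lt_succ hi)⟩,
      fun h i hi => ?_⟩
    cases i with
    | zero => exact h.1
    | succ i => exact h.2 i (Nat.lt_of_succ_lt_succ hi)
  rw [h1, h2, Measure.map_apply measurable_consSeq
    (MeasurableSet.pi (Finset.countable_toSet _) fun i _ => hmeas i), h3, Measure.prod_prod,
    Measure.infinitePi_pi _ (fun i _ => hmeas (i + 1)), Finset.prod_range_succ', mul_comm]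

end Cons

/-! ### Non-explosion, renewal and measurability of the trajectories. -/

section Clock

variable {d N : ℕ}

/-- Clocks with positive waiting times and without explosion. -/
def Good (c : Clock d N) : Prop :=
  (∀ n, 0 < (c n).1) ∧ ∀ K : ℕ, ∃ n, (K : ℝ) < ∑ i ∈ Finset.range n, (c i).1

theorem measurable_sum_clock (n : ℕ) :
    Measurable fun c : Clock d N => ∑ i ∈ Finset.range n, (c i).1 :=
  Finset.measurable_fun_sum _ fun i _ => measurable_fst.comp (measurable_pi_apply i)

theorem measurable_exp_neg_sum_clock (n : ℕ) : Measurable fun c : Clock d N =>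
    ENNReal.ofReal (Real.exp (-∑ i ∈ Finset.range n, (c i).1)) :=
  (measurable_sum_clock n).neg.exp.ennreal_ofReal

theorem Good.cons {p : (ℝ × (Site d N × Dir d)) × Clock d N} (h1 : 0 < p.1.1) (h2 : Good p.2) :
    Good (consSeq p) := by
  refine ⟨fun n => ?_, fun K => ?_⟩
  · cases n with
    | zero => exact h1
    | succ n => exact h2.1 n
  · obtain ⟨n, hn⟩ := h2.2 K
    refine ⟨n + 1, ?_⟩
    rw [Finset.sum_range_succ']
    simp only [consSeq]
    linarith

variable [NeZero N]

/-- The law of one waiting time and of the pair which is exchanged. -/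
def stepLaw (d N : ℕ) [NeZero d] [NeZero N] : Measure (ℝ × (Site d N × Dir d)) :=
  (expMeasure 1).prod (PMF.uniformOfFintype (Site d N × Dir d)).toMeasure

instance [NeZero d] : IsProbabilityMeasure (stepLaw d N) := by
  unfold stepLaw; infer_instance

theorem clockLaw_eq [NeZero d] : clockLaw d N = Measure.infinitePi fun _ : ℕ => stepLaw d N := rfl

instance [NeZero d] : IsProbabilityMeasure (clockLaw d N) := by
  rw [clockLaw_eq]; infer_instance

theorem measurePreserving_consSeq [NeZero d] :
    MeasurePreserving consSeq ((stepLaw d N).prod (clockLaw d N)) (clockLaw d N) :=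
  ⟨measurable_consSeq, map_consSeq _⟩

theorem ae_pos_stepLaw [NeZero d] : ∀ᵐ p ∂(stepLaw d N), 0 < p.1 :=
  Measure.quasiMeasurePreserving_fst.ae ae_pos_expMeasure

theorem ae_pos_clockLaw [NeZero d] : ∀ᵐ c ∂(clockLaw d N), ∀ n, 0 < (c n).1 := by
  rw [ae_all_iff]
  intro n
  exact (measurePreserving_eval_infinitePi (fun _ : ℕ => stepLaw d N) n).quasiMeasurePreserving.ae
    ae_pos_stepLaw

/-- The Laplace transform of one waiting time. -/
theorem lintegral_exp_neg_stepLaw_lt_one [NeZero d] :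
    ∫⁻ p, ENNReal.ofReal (Real.exp (-p.1)) ∂(stepLaw d N) < 1 := by
  have h : ∫⁻ _ : ℝ × (Site d N × Dir d), (1 : ENNReal) ∂(stepLaw d N) = 1 := by simp
  rw [← h]
  have hlt : ∀ᵐ p ∂(stepLaw d N), ENNReal.ofReal (Real.exp (-p.1)) < 1 := by
    filter_upwards [ae_pos_stepLaw] with p hp
    rw [ENNReal.ofReal_lt_one]
    simpa using hp
  refine lintegral_strict_mono (NeZero.ne _) (by fun_prop) (ne_of_lt ?_) hlt
  calc ∫⁻ p, ENNReal.ofReal (Real.exp (-p.1)) ∂(stepLaw d N)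
      ≤ ∫⁻ _, 1 ∂(stepLaw d N) := lintegral_mono_ae (hlt.mono fun _ h => h.le)
    _ < ⊤ := by simp

theorem lintegral_exp_neg_sum [NeZero d] (n : ℕ) :
    ∫⁻ c, ENNReal.ofReal (Real.exp (-∑ i ∈ Finset.range n, (c i).1)) ∂(clockLaw d N) =
      (∫⁻ p, ENNReal.ofReal (Real.exp (-p.1)) ∂(stepLaw d N)) ^ n := by
  induction n with
  | zero => simp
  | succ n ih =>
    have hm := measurable_exp_neg_sum_clock (d := d) (N := N)
    rw [← measurePreserving_consSeq.lintegral_comp (hm (n + 1)), pow_succ',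
      ← ih, ← lintegral_prod_mul (by fun_prop) (hm n).aemeasurable]
    refine lintegral_congr fun p => ?_
    rw [← ENNReal.ofReal_mul (Real.exp_pos _).le, ← Real.exp_add, Finset.sum_range_succ']
    congr 2
    simp only [consSeq]
    ring

/-- Exponential Markov inequality: if all partial sums stay below `K` on an event, its probability
times `exp (-K)` is at most the `n`-th power of a Laplace transform less than 1, for every `n`. -/
theorem ae_good [NeZero d] : ∀ᵐ c ∂(clockLaw d N), Good c := by
  refine ae_pos_clockLaw.and (ae_all_iff.2 fun K => ?_)
  set r := ∫⁻ p, ENNReal.ofReal (Real.exp (-p.1)) ∂(stepLaw d N) with hr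
  set B : Set (Clock d N) := {c | ¬ ∃ n, (K : ℝ) < ∑ i ∈ Finset.range n, (c i).1} with hB
  change clockLaw d N B = 0
  have h1 : ∀ n, ENNReal.ofReal (Real.exp (-K)) * clockLaw d N B ≤ r ^ n := by
    intro n
    rw [hr, ← lintegral_exp_neg_sum n]
    refine le_trans ?_ (mul_meas_ge_le_lintegral₀
      (measurable_exp_neg_sum_clock n).aemeasurable (ENNReal.ofReal (Real.exp (-K))))
    gcongr
    intro c hc
    simp only [hB, mem_ofPred_eq, not_exists, not_lt] at hc
    exact ENNReal.ofReal_le_ofReal (Real.exp_le_exp.2 (neg_le_neg (hc n)))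
  have h2 := ge_of_tendsto' (ENNReal.tendsto_pow_atTop_nhds_zero_of_lt_one
    (lintegral_exp_neg_stepLaw_lt_one (d := d) (N := N))) h1
  have h3 := le_antisymm h2 (zero_le)
  rcases mul_eq_zero.1 h3 with h | h
  · simp only [ENNReal.ofReal_eq_zero] at h
    exact absurd h (not_le.2 (Real.exp_pos _))
  · exact h

/-- The total rate of the exchanges. -/
def rate (d N : ℕ) [NeZero N] (γ : ℝ) : ℝ := γ * Fintype.card (Site d N × Dir d)

theorem rate_pos [NeZero d] {γ : ℝ} (hγ : 0 < γ) : 0 < rate d N γ :=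
  mul_pos hγ (Nat.cast_pos.2 Fintype.card_pos)

variable {α ν γ : ℝ}

theorem jumpTime_zero (c : Clock d N) : jumpTime γ c 0 = 0 := rfl

theorem jumpTime_consSeq (p : (ℝ × (Site d N × Dir d)) × Clock d N) (n : ℕ) :
    jumpTime γ (consSeq p) (n + 1) = p.1.1 / rate d N γ + jumpTime γ p.2 n := by
  rw [jumpTime, Finset.sum_range_succ', add_comm]
  rfl

theorem stateAfter_consSeq (ω : Phase d N) (p : (ℝ × (Site d N × Dir d)) × Clock d N) (n : ℕ) :
    stateAfter α ν γ ω (consSeq p) (n + 1) =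
      stateAfter α ν γ (exchange p.1.2 (flow α ν (p.1.1 / rate d N γ) ω)) p.2 n := by
  induction n with
  | zero =>
    change exchange p.1.2 (flow α ν (jumpTime γ (consSeq p) (0 + 1) - jumpTime γ (consSeq p) 0) ω) = _
    rw [jumpTime_consSeq, jumpTime_zero, jumpTime_zero, add_zero, sub_zero]
    rfl
  | succ n ih =>
    rw [stateAfter, ih, jumpTime_consSeq, jumpTime_consSeq, add_sub_add_left_eq_sub]
    rfl

theorem jumpTime_eq_div (c : Clock d N) (n : ℕ) :
    jumpTime γ c n = (∑ i ∈ Finset.range n, (c i).1) / rate d N γ := by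
  rw [jumpTime, Finset.sum_div]; rfl

theorem Good.jumpTime_mono [NeZero d] (hγ : 0 < γ) {c : Clock d N} (hc : Good c) :
    Monotone (jumpTime γ c) := by
  refine monotone_nat_of_le_succ fun n => ?_
  rw [jumpTime, jumpTime, Finset.sum_range_succ]
  have h1 := hc.1 n
  have h2 := rate_pos (d := d) (N := N) hγ
  have h3 : 0 ≤ (c n).1 / (γ * Fintype.card (Site d N × Dir d)) := (div_pos h1 h2).le
  linarith

theorem Good.finite [NeZero d] (hγ : 0 < γ) {c : Clock d N} (hc : Good c) (t : ℝ) :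
    {n : ℕ | jumpTime γ c (n + 1) ≤ t}.Finite := by
  obtain ⟨K, hK⟩ := exists_nat_gt (t * rate d N γ)
  obtain ⟨n, hn⟩ := hc.2 K
  refine (Set.finite_Iio n).subset fun m hm => ?_
  by_contra h
  simp only [mem_Iio, not_lt] at h
  have h1 := hc.jumpTime_mono hγ (h.trans (Nat.le_succ m))
  have h2 : jumpTime γ c n ≤ t := h1.trans hm
  rw [jumpTime_eq_div, div_le_iff₀ (rate_pos hγ)] at h2
  linarith

theorem trajectory_consSeq_of_lt [NeZero d] (hγ : 0 < γ) {t : ℝ} (ω : Phase d N)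
    {p : (ℝ × (Site d N × Dir d)) × Clock d N} (h1 : 0 < p.1.1) (h2 : Good p.2)
    (h : t < p.1.1 / rate d N γ) :
    trajectory α ν γ t (ω, consSeq p) = flow α ν t ω := by
  have hS : jumpCount γ (consSeq p) t = 0 := by
    rw [jumpCount, show {n : ℕ | jumpTime γ (consSeq p) (n + 1) ≤ t} = ∅ from ?_, Set.ncard_empty]
    refine Set.eq_empty_of_forall_notMem fun n hn => ?_
    have h3 := (Good.cons h1 h2).jumpTime_mono hγ (Nat.succ_le_succ (Nat.zero_le n))
    rw [jumpTime_consSeq, jumpTime_zero, add_zero] at h3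
    exact absurd (h3.trans hn) (not_le.2 h)
  rw [trajectory, hS, jumpTime_zero, sub_zero]
  rfl

/-- After its first exchange the process restarts with the shifted clock. An exchange occurring
exactly at time `t` counts as done, hence the weak inequality here and the strict one in
`trajectory_consSeq_of_lt`. -/
theorem trajectory_consSeq_of_le [NeZero d] (hγ : 0 < γ) {t : ℝ} (ω : Phase d N)
    {p : (ℝ × (Site d N × Dir d)) × Clock d N} (h2 : Good p.2)
    (h : p.1.1 / rate d N γ ≤ t) :
    trajectory α ν γ t (ω, consSeq p) = trajectory α ν γ (t - p.1.1 / rate d N γ)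
      (exchange p.1.2 (flow α ν (p.1.1 / rate d N γ) ω), p.2) := by
  have hS : jumpCount γ (consSeq p) t = jumpCount γ p.2 (t - p.1.1 / rate d N γ) + 1 := by
    have h3 : {n : ℕ | jumpTime γ (consSeq p) (n + 1) ≤ t} =
        insert 0 (Nat.succ '' {n : ℕ | jumpTime γ p.2 (n + 1) ≤ t - p.1.1 / rate d N γ}) := by
      ext n
      cases n with
      | zero => simp [jumpTime_consSeq, jumpTime_zero, h]
      | succ n =>
        simp only [mem_ofPred_eq, jumpTime_consSeq, mem_insert_iff, Nat.succ_ne_zero, mem_image,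
          Nat.succ_inj, exists_eq_right, false_or]
        rw [le_sub_iff_add_le']
    have hf := h2.finite hγ (t - p.1.1 / rate d N γ)
    rw [jumpCount, h3, Set.ncard_insert_of_notMem (by simp) (hf.image _),
      Set.ncard_image_of_injective _ Nat.succ_injective]
    rfl
  rw [trajectory, trajectory, hS, jumpTime_consSeq, stateAfter_consSeq, sub_add_eq_sub_sub]

theorem trajectory_zero [NeZero d] (hγ : 0 < γ) (ω : Phase d N) {c : Clock d N} (hc : Good c) :
    trajectory α ν γ 0 (ω, c) = ω := by
  have hS : jumpCount γ c 0 = 0 := by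
    rw [jumpCount, show {n : ℕ | jumpTime γ c (n + 1) ≤ 0} = ∅ from ?_, Set.ncard_empty]
    refine Set.eq_empty_of_forall_notMem fun n hn => ?_
    have h3 := hc.jumpTime_mono hγ (Nat.succ_le_succ (Nat.zero_le n))
    have h4 : 0 < jumpTime γ c (0 + 1) := by
      rw [jumpTime_eq_div]
      exact div_pos (by simpa using hc.1 0) (rate_pos hγ)
    exact absurd (h3.trans hn) (not_le.2 h4)
  rw [trajectory, hS, jumpTime_zero, sub_zero]
  exact flow_zero α ν ω

/-- The evolution before the first exchange can be removed. -/
theorem trajectory_add [NeZero d] (hγ : 0 < γ) {u h s : ℝ}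
    (ω : Phase d N) (b : Site d N × Dir d) {c : Clock d N} (hc : Good c) (hs : 0 < s)
    (hu : 0 ≤ u) :
    trajectory α ν γ (u + h) (ω, consSeq ((s + rate d N γ * u, b), c)) =
      trajectory α ν γ h (flow α ν u ω, consSeq ((s, b), c)) := by
  have ha := rate_pos (d := d) (N := N) hγ
  have h1 : (s + rate d N γ * u) / rate d N γ = u + s / rate d N γ := by
    field_simp; ring
  rcases lt_or_ge h (s / rate d N γ) with hlt | hle
  · have hl := trajectory_consSeq_of_lt (α := α) (ν := ν) hγ (t := u + h) ω
      (p := ((s + rate d N γ * u, b), c)) (by positivity) hc (by simp only [h1]; linarith)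
    have hr := trajectory_consSeq_of_lt (α := α) (ν := ν) hγ (flow α ν u ω)
      (p := ((s, b), c)) hs hc hlt
    rw [hl, hr, add_comm, flow_add]
  · have hl := trajectory_consSeq_of_le (α := α) (ν := ν) hγ (t := u + h) ω
      (p := ((s + rate d N γ * u, b), c)) hc (by simp only [h1]; linarith)
    have hr := trajectory_consSeq_of_le (α := α) (ν := ν) hγ (flow α ν u ω)
      (p := ((s, b), c)) hc hle
    rw [hl, hr]
    simp only [h1]
    rw [add_sub_add_left_eq_sub, add_comm u, flow_add]

theorem energy_stateAfter (ω : Phase d N) (c : Clock d N) (n : ℕ) :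
    energy α ν (stateAfter α ν γ ω c n) = energy α ν ω := by
  induction n with
  | zero => rfl
  | succ n ih => rw [stateAfter, energy_exchange, energy_flow, ih]

/-- The dynamics preserves the energy. -/
theorem energy_trajectory (t : ℝ) (z : Phase d N × Clock d N) :
    energy α ν (trajectory α ν γ t z) = energy α ν z.1 := by
  rw [trajectory, energy_flow, energy_stateAfter]

theorem stateAfter_add_cst {a : ℝ} (ha : ν * a = 0) (ω : Phase d N) (c : Clock d N) (n : ℕ) :
    stateAfter α ν γ (ω + cst a) c n = stateAfter α ν γ ω c n + cst a := by
  induction n with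
  | zero => rfl
  | succ n ih => rw [stateAfter, stateAfter, ih, map_add, flow_cst ha, exchange_add_cst]

/-- The dynamics commutes with admissible constant shifts, so an observable insensitive to such
shifts remains so at later times and the invariance of the Gibbs measure applies to it. -/
theorem trajectory_add_cst {a : ℝ} (ha : ν * a = 0) (t : ℝ) (ω : Phase d N) (c : Clock d N) :
    trajectory α ν γ t (ω + cst a, c) = trajectory α ν γ t (ω, c) + cst a := by
  rw [trajectory, trajectory, stateAfter_add_cst ha, map_add, flow_cst ha]

theorem measurable_jumpTime (n : ℕ) : Measurable fun c : Clock d N => jumpTime γ c n := by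
  simp only [jumpTime_eq_div]
  exact (measurable_sum_clock n).div_const _

theorem measurable_jumpCount :
    Measurable fun z : ℝ × Clock d N => jumpCount γ z.2 z.1 := by
  refine measurable_ncard.comp (measurable_set_iff.2 fun n => measurableSet_setOfPred.1 ?_)
  exact measurableSet_le ((measurable_jumpTime (d := d) (N := N) (n + 1)).comp measurable_snd) measurable_fst

theorem measurable_exchange :
    Measurable fun z : (Site d N × Dir d) × Phase d N => exchange z.1 z.2 :=
  measurable_from_prod_countable_right fun b =>
    (LinearMap.continuous_of_finiteDimensional (exchangeLin (d := d) (N := N) b)).measurable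

theorem measurable_stateAfter (n : ℕ) :
    Measurable fun z : Phase d N × Clock d N => stateAfter α ν γ z.1 z.2 n := by
  induction n with
  | zero => exact measurable_fst
  | succ n ih =>
    refine measurable_exchange.comp (Measurable.prodMk
      (measurable_snd.comp ((measurable_pi_apply n).comp measurable_snd)) ?_)
    exact (continuous_flow α ν).measurable.comp (Measurable.prodMk
      (((measurable_jumpTime (n + 1)).sub (measurable_jumpTime n)).comp measurable_snd) ih)

/-- Joint measurability of the trajectories. -/
theorem measurable_trajectory :
    Measurable fun z : ℝ × (Phase d N × Clock d N) => trajectory α ν γ z.1 z.2 := by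
  have h1 : Measurable fun w : ℕ × (ℝ × (Phase d N × Clock d N)) =>
      flow α ν (w.2.1 - jumpTime γ w.2.2.2 w.1) (stateAfter α ν γ w.2.2.1 w.2.2.2 w.1) := by
    refine measurable_from_prod_countable_right fun n => ?_
    exact (continuous_flow α ν).measurable.comp (Measurable.prodMk
      (measurable_fst.sub ((measurable_jumpTime n).comp (measurable_snd.comp measurable_snd)))
      ((measurable_stateAfter n).comp measurable_snd))
  exact h1.comp (Measurable.prodMk (measurable_jumpCount.comp
    (Measurable.prodMk measurable_fst (measurable_snd.comp measurable_snd))) measurable_id)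

end Clock

/-- Iterating the improvement of the bound gives `r ^ n * B`, which tends to zero. This is the
uniqueness principle for the renewal equations; no regularity in time is needed. -/
theorem eq_zero_of_contraction {ι : Type*} {D : ι → ℝ} {B r : ℝ} (hr0 : 0 ≤ r) (hr : r < 1)
    (hB : ∀ i, |D i| ≤ B)
    (h : ∀ B', 0 ≤ B' → (∀ i, |D i| ≤ B') → ∀ i, |D i| ≤ r * B') (i : ι) : D i = 0 := by
  have hB0 : 0 ≤ B := (abs_nonneg _).trans (hB i)
  have hn : ∀ n : ℕ, ∀ i, |D i| ≤ r ^ n * B := by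
    intro n
    induction n with
    | zero => simpa using hB
    | succ n ih =>
      intro i
      rw [pow_succ', mul_assoc]
      exact h _ (by positivity) ih i
  have h1 : Tendsto (fun n : ℕ => r ^ n * B) atTop (𝓝 (0 * B)) :=
    (tendsto_pow_atTop_nhds_zero_of_lt_one hr0 hr).mul_const B
  rw [zero_mul] at h1
  exact abs_nonpos_iff.1 (ge_of_tendsto' h1 fun n => hn n i)

/-- Comparison for the renewal equation. -/
theorem abs_integral_ite_le {b B : ℝ} (hb : 0 ≤ b) {φ : ℝ → ℝ}
    (hφ : ∀ s, 0 < s → s ≤ b → |φ s| ≤ B) :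
    |∫ s, (if s ≤ b then φ s else 0) ∂(expMeasure 1)| ≤ (1 - Real.exp (-b)) * B := by
  have h1 : Integrable ((Iic b).indicator fun _ : ℝ => B) (expMeasure 1) :=
    (integrable_const B).indicator measurableSet_Iic
  have h2 := norm_integral_le_of_norm_le (f := fun s => if s ≤ b then φ s else 0) h1 (by
    filter_upwards [ae_pos_expMeasure] with s hs
    by_cases h : s ≤ b
    · simpa [h] using hφ s hs h
    · simp [h])
  rw [integral_indicator_const _ measurableSet_Iic, expMeasure_real_Iic hb, smul_eq_mul] at h2
  exact h2

/-- With exchanges at rate `a`, each multiplying a mean by `z`, the mean at time `t` is the Poisson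
generating function `exp (-a(1-z)t)`. The lemma checks that it solves the renewal equation. -/
theorem integral_ite_exp {a z t : ℝ} (ha : 0 < a) (ht : 0 ≤ t) :
    ∫ s, (if s ≤ a * t then Real.exp (-(a * (1 - z) * (t - s / a))) * z else 1)
      ∂(expMeasure 1) = Real.exp (-(a * (1 - z) * t)) := by
  have hb : 0 ≤ a * t := by positivity
  set φ : ℝ → ℝ := fun s => Real.exp (-(a * (1 - z) * (t - s / a))) * z with hφ
  have hφc : Continuous φ := by fun_prop
  have h1 : IntegrableOn φ (Iic (a * t)) (expMeasure 1) := by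
    obtain ⟨C, hC⟩ := (isCompact_Icc (a := (0 : ℝ)) (b := a * t)).exists_bound_of_continuousOn
      hφc.continuousOn
    refine Integrable.of_bound hφc.aestronglyMeasurable C ?_
    rw [ae_restrict_iff' measurableSet_Iic]
    filter_upwards [ae_pos_expMeasure] with s hs h
    exact hC s ⟨hs.le, h⟩
  have h2 : ∫ s, (if s ≤ a * t then φ s else 1) ∂(expMeasure 1) =
      ∫ s, (if s ≤ a * t then φ s else 0) ∂(expMeasure 1) +
        ∫ s, (if s ≤ a * t then (0 : ℝ) else 1) ∂(expMeasure 1) := by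
    rw [← integral_add]
    · refine integral_congr_ae (Eventually.of_forall fun s => ?_)
      simp only
      split_ifs <;> simp
    · exact (integrable_indicator_iff measurableSet_Iic).2 h1 |>.congr
        (Eventually.of_forall fun s => by simp [indicator_apply])
    · exact ((integrable_const (1 : ℝ)).indicator (measurableSet_Ioi (a := a * t))).congr
        (Eventually.of_forall fun s => by
          by_cases h : s ≤ a * t
          · simp [h]
          · simp [h, not_le.1 h])
  have h9 : ∫ s, (if s ≤ a * t then (0 : ℝ) else 1) ∂(expMeasure 1) = Real.exp (-(a * t)) :=
    (integral_expMeasure_shift hb fun _ => (1 : ℝ)).trans (by simp)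
  rw [h2, h9, integral_expMeasure]
  have h3 : ∫ s in Ioi (0 : ℝ), Real.exp (-s) * (if s ≤ a * t then φ s else 0) =
      ∫ s in (0 : ℝ)..(a * t), z * Real.exp (-(a * (1 - z) * t)) * Real.exp (-(s * z)) := by
    rw [intervalIntegral.integral_of_le hb, ← integral_indicator measurableSet_Ioi,
      ← integral_indicator measurableSet_Ioc]
    refine integral_congr_ae (Eventually.of_forall fun s => ?_)
    simp only [indicator_apply, mem_Ioi, mem_Ioc]
    by_cases h4 : 0 < s
    · by_cases h5 : s ≤ a * t
      · simp only [h4, h5, if_true, and_self, hφ]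
        have h6 : Real.exp (-(a * (1 - z) * t)) * Real.exp (-(s * z)) =
            Real.exp (-s) * Real.exp (-(a * (1 - z) * (t - s / a))) := by
          rw [← Real.exp_add, ← Real.exp_add]
          congr 1
          field_simp
          ring
        linear_combination (-z) * h6
      · simp [h4, h5]
    · simp [h4]
  have h6 : ∀ s : ℝ, HasDerivAt (fun s => -(Real.exp (-(a * (1 - z) * t)) * Real.exp (-(s * z))))
      (z * Real.exp (-(a * (1 - z) * t)) * Real.exp (-(s * z))) s := by
    intro s
    have h7 : HasDerivAt (fun s : ℝ => -(s * z)) (-(1 * z)) s :=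
      ((hasDerivAt_id s).mul_const z).neg
    refine ((h7.exp.const_mul (Real.exp (-(a * (1 - z) * t)))).neg).congr_deriv ?_
    ring
  rw [h3, intervalIntegral.integral_eq_sub_of_hasDerivAt (fun s _ => h6 s)
    (Continuous.intervalIntegrable (by fun_prop) _ _), ← Real.exp_add]
  have h8 : -(a * (1 - z) * t) + -(a * t * z) = -(a * t) := by ring
  rw [h8]
  simp

/-! ### Expectations given the initial configuration. -/

section Expectation

variable {d N : ℕ} [NeZero N] {α ν γ T : ℝ}

theorem continuous_quad (A : Site d N → ℝ) : Continuous (quad (d := d) (N := N) A) := by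
  unfold quad
  fun_prop

theorem integrable_energy_sq (hα : 0 < α) (hν : 0 ≤ ν) (hT : 0 < T) :
    Integrable (fun ω => energy α ν ω ^ 2) (gibbs d N α ν T) := by
  simp only [sq]
  exact integrable_gibbs hα hν hT
    ((hasTemperateGrowth_energy α ν).mul (hasTemperateGrowth_energy α ν))

theorem abs_comp_trajectory_le {f : Phase d N → ℝ} {K : ℝ} (hK : ∀ ω, |f ω| ≤ K * energy α ν ω)
    (t : ℝ) (z : Phase d N × Clock d N) :
    |f (trajectory α ν γ t z)| ≤ K * energy α ν z.1 := by
  rw [← energy_trajectory (γ := γ) t z]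
  exact hK _

theorem measurable_comp_trajectory {f : Phase d N → ℝ} (hf : Measurable f) (t : ℝ) :
    Measurable fun z => f (trajectory α ν γ t z) :=
  hf.comp (measurable_trajectory.comp (measurable_const.prodMk measurable_id))

theorem abs_mul_comp_trajectory_le {f g : Phase d N → ℝ} {K L : ℝ}
    (hK : ∀ ω, |f ω| ≤ K * energy α ν ω) (hL : ∀ ω, |g ω| ≤ L * energy α ν ω) (s t : ℝ)
    (z : Phase d N × Clock d N) :
    |f (trajectory α ν γ s z) * g (trajectory α ν γ t z)| ≤ K * L * energy α ν z.1 ^ 2 := by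
  have h1 := abs_comp_trajectory_le (γ := γ) hK s z
  have h2 := abs_comp_trajectory_le (γ := γ) hL t z
  rw [abs_mul]
  calc _ ≤ (K * energy α ν z.1) * (L * energy α ν z.1) :=
        mul_le_mul h1 h2 (abs_nonneg _) ((abs_nonneg _).trans h1)
    _ = _ := by ring

variable [NeZero d]

theorem integral_stepLaw {G : ℝ × (Site d N × Dir d) → ℝ} (hG : Integrable G (stepLaw d N)) :
    ∫ q, G q ∂(stepLaw d N) = ∫ s, (Fintype.card (Site d N × Dir d) : ℝ)⁻¹ *
      ∑ b, G (s, b) ∂(expMeasure 1) ∧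
    Integrable (fun s => (Fintype.card (Site d N × Dir d) : ℝ)⁻¹ * ∑ b, G (s, b))
      (expMeasure 1) := by
  have h : ∀ s, ∫ b, G (s, b) ∂(PMF.uniformOfFintype (Site d N × Dir d)).toMeasure =
      (Fintype.card (Site d N × Dir d) : ℝ)⁻¹ * ∑ b, G (s, b) := by
    intro s
    rw [PMF.integral_eq_sum, Finset.mul_sum]
    refine Finset.sum_congr rfl fun b _ => ?_
    rw [PMF.uniformOfFintype_apply, ENNReal.toReal_inv, ENNReal.toReal_natCast, smul_eq_mul]
  unfold stepLaw at hG ⊢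
  refine ⟨?_, ?_⟩
  · rw [integral_prod _ hG]
    simp only [h]
  · have := hG.integral_prod_left
    simpa only [h] using this

/-- Conditioning on the first exchange. -/
theorem integral_clockLaw {F : Clock d N → ℝ} {B : ℝ} (hF : Measurable F) (hB : ∀ c, |F c| ≤ B) :
    ∫ c, F c ∂(clockLaw d N) = ∫ s, (Fintype.card (Site d N × Dir d) : ℝ)⁻¹ *
      ∑ b, ∫ c, F (consSeq ((s, b), c)) ∂(clockLaw d N) ∂(expMeasure 1) ∧
    Integrable (fun s => (Fintype.card (Site d N × Dir d) : ℝ)⁻¹ *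
      ∑ b, ∫ c, F (consSeq ((s, b), c)) ∂(clockLaw d N)) (expMeasure 1) := by
  have hi : Integrable (fun p => F (consSeq p)) ((stepLaw d N).prod (clockLaw d N)) :=
    Integrable.of_bound (hF.comp measurable_consSeq).aestronglyMeasurable B
      (Eventually.of_forall fun p => hB _)
  have h1 : ∫ c, F c ∂(clockLaw d N) = ∫ p, F (consSeq p) ∂((stepLaw d N).prod (clockLaw d N)) := by
    conv_lhs => rw [← measurePreserving_consSeq.map_eq]
    exact integral_map measurable_consSeq.aemeasurable hF.aestronglyMeasurable
  rw [h1, integral_prod _ hi]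
  exact integral_stepLaw hi.integral_prod_left

/-- The expectation at time `t` of an observable, for a given initial configuration. -/
def expect (α ν γ : ℝ) (f : Phase d N → ℝ) (t : ℝ) (ω : Phase d N) : ℝ :=
  ∫ c, f (trajectory α ν γ t (ω, c)) ∂(clockLaw d N)

theorem abs_expect_le {f : Phase d N → ℝ} {K : ℝ} (hK : ∀ ω, |f ω| ≤ K * energy α ν ω)
    (t : ℝ) (ω : Phase d N) : |expect α ν γ f t ω| ≤ K * energy α ν ω := by
  have := norm_integral_le_of_norm_le_const (μ := clockLaw d N)
    (f := fun c => f (trajectory α ν γ t (ω, c))) (C := K * energy α ν ω)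
    (Eventually.of_forall fun c => abs_comp_trajectory_le hK t (ω, c))
  rwa [probReal_univ, mul_one] at this

/-- The renewal equation for expectations. -/
theorem expect_eq (hγ : 0 < γ) {f : Phase d N → ℝ} (hf : Measurable f) {K : ℝ}
    (hK : ∀ ω, |f ω| ≤ K * energy α ν ω) {t : ℝ} (ω : Phase d N) :
    expect α ν γ f t ω = ∫ s, (if s ≤ rate d N γ * t then
      (Fintype.card (Site d N × Dir d) : ℝ)⁻¹ * ∑ b, expect α ν γ f (t - s / rate d N γ)
        (exchange b (flow α ν (s / rate d N γ) ω)) else f (flow α ν t ω)) ∂(expMeasure 1) ∧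
    Integrable (fun s => if s ≤ rate d N γ * t then
      (Fintype.card (Site d N × Dir d) : ℝ)⁻¹ * ∑ b, expect α ν γ f (t - s / rate d N γ)
        (exchange b (flow α ν (s / rate d N γ) ω)) else f (flow α ν t ω)) (expMeasure 1) := by
  have ha := rate_pos (d := d) (N := N) hγ
  have hF : Measurable fun c => f (trajectory α ν γ t (ω, c)) :=
    (measurable_comp_trajectory hf t).comp (measurable_const.prodMk measurable_id)
  obtain ⟨h1, h2⟩ := integral_clockLaw (B := K * energy α ν ω) hF
    fun c => abs_comp_trajectory_le hK t (ω, c)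
  have h3 : (fun s => (Fintype.card (Site d N × Dir d) : ℝ)⁻¹ *
      ∑ b, ∫ c, f (trajectory α ν γ t (ω, consSeq ((s, b), c))) ∂(clockLaw d N)) =ᵐ[expMeasure 1]
      fun s => if s ≤ rate d N γ * t then
      (Fintype.card (Site d N × Dir d) : ℝ)⁻¹ * ∑ b, expect α ν γ f (t - s / rate d N γ)
        (exchange b (flow α ν (s / rate d N γ) ω)) else f (flow α ν t ω) := by
    filter_upwards [ae_pos_expMeasure] with s hs
    split_ifs with h
    · congr 1
      refine Finset.sum_congr rfl fun b _ => integral_congr_ae ?_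
      filter_upwards [ae_good] with c hc
      rw [trajectory_consSeq_of_le (p := ((s, b), c)) hγ ω hc ((div_le_iff₀' ha).2 h)]
    · have h4 : ∀ b, ∫ c, f (trajectory α ν γ t (ω, consSeq ((s, b), c))) ∂(clockLaw d N) =
          f (flow α ν t ω) := by
        intro b
        have : ∫ _, f (flow α ν t ω) ∂(clockLaw d N) = f (flow α ν t ω) := by simp
        rw [← this]
        refine integral_congr_ae ?_
        filter_upwards [ae_good] with c hc
        rw [trajectory_consSeq_of_lt (p := ((s, b), c)) hγ ω hs hc
          ((lt_div_iff₀' ha).2 (not_le.1 h))]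
      have h5 : (Fintype.card (Site d N × Dir d) : ℝ) ≠ 0 :=
        Nat.cast_ne_zero.2 Fintype.card_ne_zero
      simp only [h4, Finset.sum_const, Finset.card_univ, nsmul_eq_mul]
      field_simp
  exact ⟨h1.trans (integral_congr_ae h3), h2.congr h3⟩

/-- The Fourier modes of the total current decay exponentially in mean. -/
theorem expect_quad_mode (hα : 0 < α) (hν : 0 ≤ ν) (hγ : 0 < γ) (ξ : Site d N) {t : ℝ}
    (ht : 0 ≤ t) (ω : Phase d N) :
    expect α ν γ (quad (mode ξ)) t ω =
      Real.exp (-(8 * γ * t * symb (grid ξ))) * quad (mode ξ) ω := by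
  obtain ⟨K, hK0, hK⟩ := exists_abs_quad_le (d := d) (N := N) hα hν (mode_neg ξ)
  have ha := rate_pos (d := d) (N := N) hγ
  set a := rate d N γ with hadef
  have hcard : (Fintype.card (Site d N × Dir d) : ℝ) ≠ 0 :=
    Nat.cast_ne_zero.2 Fintype.card_ne_zero
  set M := (Fintype.card (Site d N × Dir d) : ℝ) with hM
  -- The factor by which one uniformly chosen exchange multiplies the mode in mean; the total rate
  -- times `1 - z` is `8γS`.
  set z := 1 - 8 * symb (grid ξ) / M with hz
  have hκ : ∀ s : ℝ, Real.exp (-(8 * γ * s * symb (grid ξ))) = Real.exp (-(a * (1 - z) * s)) := by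
    intro s
    rw [hz, hadef, rate, ← hM]
    congr 2
    field_simp
    ring
  have hz1 : |z| ≤ 1 := abs_one_sub_le_one ξ
  have hmeas := (continuous_quad (mode ξ)).measurable
  set f : Phase d N → ℝ := quad (mode ξ) with hf
  have hsum : ∀ ω', M⁻¹ * ∑ b, f (exchange b ω') = z * f ω' := by
    intro ω'
    rw [hf, sum_quad_mode_exchange, ← hM, hz]
    field_simp
  clear_value z
  set D : ℝ → Phase d N → ℝ := fun s ω' => expect α ν γ f s ω' -
    Real.exp (-(a * (1 - z) * s)) * f ω' with hD
  have heq : ∀ s, 0 ≤ s → ∀ ω', D s ω' = ∫ r, (if r ≤ a * s then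
      M⁻¹ * ∑ b, D (s - r / a) (exchange b (flow α ν (r / a) ω')) else 0) ∂(expMeasure 1) := by
    intro s hs ω'
    obtain ⟨h1, h2⟩ := expect_eq (α := α) (ν := ν) hγ hmeas hK (t := s) ω'
    rw [← hadef, ← hM] at h1 h2
    have h3 := integral_ite_exp (z := z) ha hs
    have h4 : Integrable (fun r => (if r ≤ a * s then
        Real.exp (-(a * (1 - z) * (s - r / a))) * z else 1) * f ω') (expMeasure 1) := by
      refine Integrable.mul_const ?_ _
      by_contra h
      have := integral_undef h
      rw [h3] at this
      exact (Real.exp_pos _).ne' this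
    simp only [hD]
    rw [h1, ← h3, ← integral_mul_const, ← integral_sub h2 h4]
    refine integral_congr_ae (Eventually.of_forall fun r => ?_)
    simp only
    split_ifs with h
    · have h5 : ∀ (E : Site d N × Dir d → ℝ) (e : ℝ) (ω'' : Phase d N),
          M⁻¹ * ∑ b, (E b - e * f (exchange b ω'')) = M⁻¹ * ∑ b, E b - e * (z * f ω'') := by
        intro E e ω''
        rw [Finset.sum_sub_distrib, ← Finset.mul_sum, ← hsum]
        ring
      rw [h5, hf, quad_flow (mode_neg ξ)]
      ring
    · rw [hf, quad_flow (mode_neg ξ)]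
      ring
  -- This set is stable under restarting at the first exchange, since time decreases and energy is
  -- conserved, and the difference `D` is bounded on it.
  let ι := {p : ℝ × Phase d N // (0 ≤ p.1 ∧ p.1 ≤ t) ∧ energy α ν p.2 ≤ energy α ν ω}
  have hE := energy_nonneg hα hν ω
  have hmain := eq_zero_of_contraction (ι := ι) (D := fun p => D p.1.1 p.1.2)
    (B := 2 * (K * energy α ν ω)) (r := 1 - Real.exp (-(a * t)))
    (by
      have : Real.exp (-(a * t)) ≤ 1 := Real.exp_le_one_iff.2 (neg_nonpos.2 (by positivity))
      linarith)
    (by linarith [Real.exp_pos (-(a * t))])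
    (by
      rintro ⟨⟨s, ω'⟩, ⟨hs0, hs⟩, hω'⟩
      simp only at hs0 hs hω' ⊢
      have h1 := abs_expect_le (γ := γ) hK s ω'
      have h2 : |Real.exp (-(a * (1 - z) * s)) * f ω'| ≤ K * energy α ν ω' := by
        rw [abs_mul, Real.abs_exp]
        have h3 : Real.exp (-(a * (1 - z) * s)) ≤ 1 := by
          refine Real.exp_le_one_iff.2 (neg_nonpos.2 ?_)
          have := (abs_le.1 hz1).2
          have h4 : 0 ≤ 1 - z := by linarith
          positivity
        calc _ ≤ 1 * |f ω'| := by gcongr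
          _ ≤ _ := by rw [one_mul]; exact hK ω'
      have h5 : K * energy α ν ω' ≤ K * energy α ν ω := by gcongr
      have h6 := abs_sub (expect α ν γ f s ω') (Real.exp (-(a * (1 - z) * s)) * f ω')
      simp only [hD]
      linarith)
    (by
      rintro B' hB' h ⟨⟨s, ω'⟩, ⟨hs0, hs⟩, hω'⟩
      simp only at hs0 hs hω' ⊢
      rw [heq s hs0]
      refine (abs_integral_ite_le (B := B') (by positivity) fun r hr0 hr => ?_).trans ?_
      · have h1 : 0 ≤ s - r / a := sub_nonneg.2 ((div_le_iff₀' ha).2 hr)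
        have h2 : 0 ≤ r / a := by positivity
        rw [abs_mul, abs_of_nonneg (inv_nonneg.2 (Nat.cast_nonneg _)), inv_mul_le_iff₀
          (Nat.cast_pos.2 Fintype.card_pos)]
        refine (Finset.abs_sum_le_sum_abs _ _).trans ?_
        rw [hM, ← nsmul_eq_mul, ← Finset.card_univ]
        refine Finset.sum_le_card_nsmul _ _ _ fun b _ => ?_
        refine h ⟨(s - r / a, exchange b (flow α ν (r / a) ω')), ⟨h1, ?_⟩, ?_⟩
        · simp only; linarith
        · simp only; rwa [energy_exchange, energy_flow]
      · gcongr)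
    ⟨(t, ω), ⟨ht, le_rfl⟩, le_rfl⟩
  rw [hκ]
  simp only [hD] at hmain
  linarith

end Expectation

/-! ### Stationarity of two-time correlations. -/

section Stationarity

variable {d N : ℕ} [NeZero N] [NeZero d] {α ν γ T : ℝ}

theorem integrable_energy_sq_fst (hα : 0 < α) (hν : 0 ≤ ν) (hT : 0 < T) :
    Integrable (fun z => energy α ν z.1 ^ 2) (equilibrium d N α ν T) := by
  have := isProbabilityMeasure_gibbs (d := d) (N := N) hα hν hT
  exact (integrable_energy_sq hα hν hT).comp_fst (clockLaw d N)

variable {f g : Phase d N → ℝ} {K L : ℝ}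

theorem integrable_mul_comp_trajectory (hα : 0 < α) (hν : 0 ≤ ν) (hT : 0 < T)
    (hf : Measurable f) (hg : Measurable g)
    (hK : ∀ ω, |f ω| ≤ K * energy α ν ω) (hL : ∀ ω, |g ω| ≤ L * energy α ν ω) (s t : ℝ) :
    Integrable (fun z => f (trajectory α ν γ s z) * g (trajectory α ν γ t z))
      (equilibrium d N α ν T) :=
  ((integrable_energy_sq_fst hα hν hT).const_mul (K * L)).mono'
    ((measurable_comp_trajectory hf s).mul (measurable_comp_trajectory hg t)).aestronglyMeasurable
    (Eventually.of_forall fun z => abs_mul_comp_trajectory_le hK hL s t z)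

/-- Two time correlations at equilibrium only depend on the difference of the times. -/
theorem integral_mul_comp_trajectory_add (hα : 0 < α) (hν : 0 ≤ ν) (hγ : 0 < γ) (hT : 0 < T)
    (hf : Measurable f) (hg : Measurable g)
    (hK : ∀ ω, |f ω| ≤ K * energy α ν ω) (hL : ∀ ω, |g ω| ≤ L * energy α ν ω)
    (hfc : ∀ ω c, ν * c = 0 → f (ω + cst c) = f ω) (hgc : ∀ ω c, ν * c = 0 → g (ω + cst c) = g ω)
    {u h : ℝ} (hu : 0 ≤ u) (hh : 0 ≤ h) :
    ∫ z, f (trajectory α ν γ u z) * g (trajectory α ν γ (u + h) z) ∂(equilibrium d N α ν T) =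
      ∫ z, f (trajectory α ν γ 0 z) * g (trajectory α ν γ (0 + h) z)
        ∂(equilibrium d N α ν T) := by
  have hprob := isProbabilityMeasure_gibbs (d := d) (N := N) hα hν hT
  have ha := rate_pos (d := d) (N := N) hγ
  set a := rate d N γ with hadef
  set M := (Fintype.card (Site d N × Dir d) : ℝ) with hM
  have hM0 : M ≠ 0 := Nat.cast_ne_zero.2 Fintype.card_ne_zero
  -- The initial configuration is integrated out with the clock frozen, so that the invariance of
  -- the Gibbs measure can be used clock by clock.
  set Γ : ℝ → Clock d N → ℝ := fun s c => ∫ ω, f (trajectory α ν γ s (ω, c)) *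
    g (trajectory α ν γ (s + h) (ω, c)) ∂(gibbs d N α ν T) with hΓ
  set G : ℝ → ℝ := fun s => ∫ c, Γ s c ∂(clockLaw d N) with hG
  set B := K * L * ∫ ω, energy α ν ω ^ 2 ∂(gibbs d N α ν T) with hBdef
  have hGeq : ∀ s, ∫ z, f (trajectory α ν γ s z) * g (trajectory α ν γ (s + h) z)
      ∂(equilibrium d N α ν T) = G s := fun s =>
    integral_prod_symm _ (integrable_mul_comp_trajectory hα hν hT hf hg hK hL s (s + h))
  have hΓm : ∀ s, Measurable (Γ s) := fun s =>
    (((measurable_comp_trajectory hf s).mul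
      (measurable_comp_trajectory hg (s + h))).stronglyMeasurable.integral_prod_left').measurable
  have hΓB : ∀ s c, |Γ s c| ≤ B := by
    intro s c
    rw [hBdef, ← integral_const_mul]
    exact norm_integral_le_of_norm_le (f := fun ω => f (trajectory α ν γ s (ω, c)) *
      g (trajectory α ν γ (s + h) (ω, c))) ((integrable_energy_sq hα hν hT).const_mul _)
      (Eventually.of_forall fun ω => abs_mul_comp_trajectory_le hK hL s (s + h) (ω, c))
  have hGB : ∀ s, |G s| ≤ B := by
    intro s
    have := norm_integral_le_of_norm_le_const (μ := clockLaw d N) (f := Γ s) (C := B)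
      (Eventually.of_forall fun c => hΓB s c)
    simpa using this
  have hinv : ∀ (s r : ℝ) (c : Clock d N) (ω : Phase d N) (x : ℝ), ν * x = 0 →
      f (trajectory α ν γ s (ω + cst x, c)) * g (trajectory α ν γ r (ω + cst x, c)) =
      f (trajectory α ν γ s (ω, c)) * g (trajectory α ν γ r (ω, c)) := by
    intro s r c ω x hx
    rw [trajectory_add_cst hx, trajectory_add_cst hx, hfc _ _ hx, hgc _ _ hx]
  -- First exchange before `s`: the initial flow and the exchange are absorbed by invariance, and
  -- the time origin moves to the exchange.
  have hΓle : ∀ s r (b : Site d N × Dir d) (c : Clock d N), Good c → r ≤ a * s →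
      Γ s (consSeq ((r, b), c)) = Γ (s - r / a) c := by
    intro s r b c hc hr
    have hr' : r / a ≤ s := (div_le_iff₀' ha).2 hr
    simp only [hΓ]
    rw [← integral_exchange_flow_gibbs hα hν hT b (r / a)
      (F := fun ω => f (trajectory α ν γ (s - r / a) (ω, c)) *
        g (trajectory α ν γ (s - r / a + h) (ω, c))) (fun ω x hx => hinv _ _ _ _ _ hx)]
    refine integral_congr_ae (Eventually.of_forall fun ω => ?_)
    simp only
    rw [trajectory_consSeq_of_le (p := ((r, b), c)) hγ ω hc hr',
      trajectory_consSeq_of_le (p := ((r, b), c)) hγ ω hc (hr'.trans (by linarith)),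
      sub_add_eq_add_sub]
  -- First exchange after `s`: the evolution up to `s` is a pure flow, absorbed by invariance, and
  -- only the remaining waiting time matters.
  have hΓlt : ∀ s r (b : Site d N × Dir d) (c : Clock d N), Good c → 0 ≤ s → a * s < r →
      Γ s (consSeq ((r, b), c)) = Γ 0 (consSeq ((r - a * s, b), c)) := by
    intro s r b c hc hs hr
    simp only [hΓ]
    rw [← integral_flow_gibbs hα hν hT s
      (F := fun ω => f (trajectory α ν γ 0 (ω, consSeq ((r - a * s, b), c))) *
        g (trajectory α ν γ (0 + h) (ω, consSeq ((r - a * s, b), c))))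
      (fun ω x hx => hinv _ _ _ _ _ hx)]
    refine integral_congr_ae (Eventually.of_forall fun ω => ?_)
    have h1 := fun h => trajectory_add (α := α) (ν := ν) (h := h) hγ ω b hc (sub_pos.2 hr) hs
    simp only [← hadef, sub_add_cancel] at h1
    simp only
    rw [zero_add, ← h1, ← h1, add_zero]
  set ψ : ℝ → ℝ := fun r => M⁻¹ * ∑ b, ∫ c, Γ 0 (consSeq ((r, b), c)) ∂(clockLaw d N) with hψ
  have hG0 : G 0 = ∫ r, ψ r ∂(expMeasure 1) := (integral_clockLaw (hΓm 0) (hΓB 0)).1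
  have hrenew : ∀ s, 0 ≤ s → G s = ∫ r, (if r ≤ a * s then G (s - r / a) else ψ (r - a * s))
      ∂(expMeasure 1) ∧ Integrable (fun r => if r ≤ a * s then G (s - r / a) else ψ (r - a * s))
        (expMeasure 1) := by
    intro s hs
    obtain ⟨h1, h2⟩ := integral_clockLaw (hΓm s) (hΓB s)
    have h3 : (fun r => M⁻¹ * ∑ b, ∫ c, Γ s (consSeq ((r, b), c)) ∂(clockLaw d N))
        =ᵐ[expMeasure 1] fun r => if r ≤ a * s then G (s - r / a) else ψ (r - a * s) := by
      refine Eventually.of_forall fun r => ?_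
      simp only
      split_ifs with hr
      · have h4 : ∀ b, ∫ c, Γ s (consSeq ((r, b), c)) ∂(clockLaw d N) = G (s - r / a) := by
          intro b
          refine integral_congr_ae ?_
          filter_upwards [ae_good] with c hc using hΓle s r b c hc hr
        simp only [h4, Finset.sum_const, Finset.card_univ, nsmul_eq_mul]
        rw [← hM, inv_mul_cancel_left₀ hM0]
      · simp only [hψ]
        congr 1
        refine Finset.sum_congr rfl fun b _ => integral_congr_ae ?_
        filter_upwards [ae_good] with c hc using hΓlt s r b c hc hs (not_le.1 hr)
    exact ⟨h1.trans (integral_congr_ae h3), h2.congr h3⟩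
  have hD : ∀ s, 0 ≤ s → G s - G 0 = ∫ r, (if r ≤ a * s then G (s - r / a) - G 0 else 0)
      ∂(expMeasure 1) := by
    intro s hs
    obtain ⟨h1, h2⟩ := hrenew s hs
    have has : 0 ≤ a * s := by positivity
    -- By lack of memory the remaining waiting time is again exponential, and `ψ` averages to `G 0`.
    have h3 : ∫ r, (if r ≤ a * s then 0 else (ψ (r - a * s) - G 0)) ∂(expMeasure 1) = 0 := by
      have h4 := integral_expMeasure_shift has fun r => ψ r - G 0
      have h5 : Integrable ψ (expMeasure 1) := (integral_clockLaw (hΓm 0) (hΓB 0)).2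
      rw [integral_sub h5 (integrable_const _), ← hG0, integral_const, probReal_univ, one_smul,
        sub_self, mul_zero] at h4
      exact h4
    have h6 : Integrable (fun r => (if r ≤ a * s then G (s - r / a) else ψ (r - a * s)) - G 0)
        (expMeasure 1) := h2.sub (integrable_const _)
    have h7 : G s - G 0 = ∫ r, ((if r ≤ a * s then G (s - r / a) else ψ (r - a * s)) - G 0)
        ∂(expMeasure 1) := by
      rw [integral_sub h2 (integrable_const _), ← h1, integral_const, probReal_univ, one_smul]
    have h8 : ∫ r, ((if r ≤ a * s then G (s - r / a) else ψ (r - a * s)) - G 0) ∂(expMeasure 1) =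
        ∫ r, (if r ≤ a * s then G (s - r / a) - G 0 else 0) ∂(expMeasure 1) +
        ∫ r, (if r ≤ a * s then 0 else (ψ (r - a * s) - G 0)) ∂(expMeasure 1) := by
      rw [← integral_add]
      · refine integral_congr_ae (Eventually.of_forall fun r => ?_)
        simp only
        split_ifs <;> simp
      · refine (h6.indicator (measurableSet_Iic (a := a * s))).congr
          (Eventually.of_forall fun r => ?_)
        by_cases hr : r ≤ a * s <;> simp [hr]
      · refine (h6.indicator (measurableSet_Ioi (a := a * s))).congr
          (Eventually.of_forall fun r => ?_)
        by_cases hr : r ≤ a * s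
        · simp [hr]
        · simp [hr, not_le.1 hr]
    rw [h7, h8, h3, add_zero]
  have hmain := eq_zero_of_contraction (ι := Icc 0 u) (D := fun s => G s - G 0)
    (B := 2 * B) (r := 1 - Real.exp (-(a * u)))
    (by
      have : Real.exp (-(a * u)) ≤ 1 := Real.exp_le_one_iff.2 (neg_nonpos.2 (by positivity))
      linarith)
    (by linarith [Real.exp_pos (-(a * u))])
    (fun s => by
      have h1 := hGB s
      have h2 := hGB 0
      have h3 := abs_sub (G s) (G 0)
      linarith)
    (by
      rintro B' hB' hle ⟨s, hs0, hs⟩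
      simp only
      rw [hD s hs0]
      refine (abs_integral_ite_le (B := B') (by positivity) fun r hr0 hr => ?_).trans ?_
      · have h1 : 0 ≤ s - r / a := sub_nonneg.2 ((div_le_iff₀' ha).2 hr)
        have h2 : 0 ≤ r / a := by positivity
        exact hle ⟨s - r / a, h1, by linarith⟩
      · gcongr)
    ⟨u, hu, le_rfl⟩
  rw [hGeq, hGeq]
  linarith

end Stationarity

/-! ### Exact formulas in finite volume. -/

/-- Spectral density of the energy current at temperature one. -/
def density {d : ℕ} (α ν : ℝ) (k : Fin d) (ξ : Fin d → ℝ) : ℝ :=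
  2 * α ^ 2 * Real.sin (2 * Real.pi * ξ k) ^ 2 / (ν + 4 * α * symb ξ)

theorem density_nonneg {d : ℕ} {α ν : ℝ} (hα : 0 < α) (hν : 0 ≤ ν) (k : Fin d) (ξ : Fin d → ℝ) :
    0 ≤ density α ν k ξ := by
  have := symb_nonneg ξ
  unfold density
  positivity

/-- The numerator is at most `8α²S` and the denominator at least `4αS`; where the denominator
vanishes the quotient is zero by convention. The bound does not depend on `ν`. -/
theorem density_le {d : ℕ} {α ν : ℝ} (hα : 0 < α) (hν : 0 ≤ ν) (k : Fin d) (ξ : Fin d → ℝ) :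
    density α ν k ξ ≤ 2 * α := by
  have h1 := symb_nonneg ξ
  have h2 := sin_two_sq_le_symb ξ k
  have h3 : 0 ≤ ν + 4 * α * symb ξ := by positivity
  rcases h3.eq_or_lt with h | h
  · rw [density, ← h, div_zero]
    positivity
  · rw [density, div_le_iff₀ h]
    have h4 : α ^ 2 * Real.sin (2 * Real.pi * ξ k) ^ 2 ≤ α ^ 2 * (4 * symb ξ) := by gcongr
    have h5 : 0 ≤ α * ν := by positivity
    nlinarith

section Formula

variable {d N : ℕ} [NeZero N]

/-- The sum of the current correlations at temperature one, in finite volume. -/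
def spectralSum (N : ℕ) [NeZero N] (α ν γ : ℝ) (k : Fin d) (t : ℝ) : ℝ :=
  ((N : ℝ) ^ d)⁻¹ * ∑ ξ : Site d N,
    density α ν k (grid ξ) * Real.exp (-(8 * γ * t * symb (grid ξ)))

theorem continuous_spectralSum (α ν γ : ℝ) (k : Fin d) :
    Continuous (spectralSum N α ν γ k) := by
  unfold spectralSum
  fun_prop

theorem continuous_current (α : ℝ) (k : Fin d) (x : Site d N) :
    Continuous (current (harmV α) k x) := by
  simp only [funext fun ω => current_eq (N := N) α k x ω]
  fun_prop

/-- The total current. -/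
def totalCurrent (N : ℕ) [NeZero N] (α : ℝ) (k : Fin d) (ω : Phase d N) : ℝ :=
  ∑ x, current (harmV α) k x ω

theorem continuous_totalCurrent (α : ℝ) (k : Fin d) : Continuous (totalCurrent N α k) :=
  continuous_finsetSum _ fun x _ => continuous_current α k x

theorem totalCurrent_add_cst (α c : ℝ) (k : Fin d) (ω : Phase d N) :
    totalCurrent N α k (ω + cst c) = totalCurrent N α k ω := by
  simp only [totalCurrent, current_add_cst]

theorem abs_totalCurrent_le {α ν : ℝ} (hα : 0 < α) (hν : 0 ≤ ν) (k : Fin d) (ω : Phase d N) :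
    |totalCurrent N α k ω| ≤
      (Fintype.card (Site d N) * (1 + 4 * α)) * energy α ν ω := by
  refine (Finset.abs_sum_le_sum_abs _ _).trans ?_
  refine (Finset.sum_le_card_nsmul _ _ _ fun x _ => abs_current_le hα hν k x ω).trans_eq ?_
  rw [Finset.card_univ, nsmul_eq_mul, mul_assoc]

variable {α ν γ T : ℝ}

theorem measurable_currentAt (k : Fin d) (x : Site d N) :
    Measurable fun p : ℝ × (Phase d N × Clock d N) => currentAt α ν γ k x p.1 p.2 :=
  (continuous_current α k x).measurable.comp measurable_trajectory

theorem sq_integral_totalCurrent {t : ℝ} (ht : 0 ≤ t) (k : Fin d) (z : Phase d N × Clock d N) :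
    (∫ s in (0 : ℝ)..t, totalCurrent N α k (trajectory α ν γ s z)) ^ 2 =
      ∫ p : ℝ × ℝ, totalCurrent N α k (trajectory α ν γ p.1 z) *
        totalCurrent N α k (trajectory α ν γ p.2 z)
          ∂((volume.restrict (Ioc 0 t)).prod (volume.restrict (Ioc 0 t))) := by
  rw [sq, intervalIntegral.integral_of_le ht]
  exact (integral_prod_mul (μ := volume.restrict (Ioc 0 t)) (ν := volume.restrict (Ioc 0 t))
    (fun s => totalCurrent N α k (trajectory α ν γ s z))
    (fun s => totalCurrent N α k (trajectory α ν γ s z))).symm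

theorem intervalIntegrable_currentAt (hα : 0 < α) (hν : 0 ≤ ν) (k : Fin d) (x : Site d N)
    (z : Phase d N × Clock d N) (a b : ℝ) :
    IntervalIntegrable (fun s => currentAt α ν γ k x s z) volume a b := by
  refine (intervalIntegrable_const (c := (1 + 4 * α) * energy α ν z.1)).mono_fun'
    ((measurable_currentAt k x).comp (measurable_id.prodMk measurable_const)).aestronglyMeasurable
    (Eventually.of_forall fun s => abs_comp_trajectory_le (abs_current_le hα hν k x) s z)

theorem sum_integral_currentAt (hα : 0 < α) (hν : 0 ≤ ν) (k : Fin d) (t : ℝ)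
    (z : Phase d N × Clock d N) :
    ∑ x : Site d N, ∫ s in (0 : ℝ)..t, currentAt α ν γ k x s z =
      ∫ s in (0 : ℝ)..t, totalCurrent N α k (trajectory α ν γ s z) :=
  (intervalIntegral.integral_finsetSum fun x _ =>
    intervalIntegrable_currentAt hα hν k x z 0 t).symm

variable [NeZero d]

theorem expect_totalCurrent (hα : 0 < α) (hν : 0 ≤ ν) (hγ : 0 < γ) (k : Fin d) {t : ℝ}
    (ht : 0 ≤ t) (ω : Phase d N) :
    expect α ν γ (totalCurrent N α k) t ω = ∑ ξ : Site d N,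
      (-α * ((N : ℝ) ^ d)⁻¹ * (2 * Real.sin (2 * Real.pi * grid ξ k)) *
        Real.exp (-(8 * γ * t * symb (grid ξ)))) * quad (mode ξ) ω := by
  simp only [expect, totalCurrent, sum_current_eq_sum_mode]
  rw [integral_finsetSum]
  · refine Finset.sum_congr rfl fun ξ _ => ?_
    rw [integral_const_mul, mul_assoc (_ * _) (Real.exp _), ← expect_quad_mode hα hν hγ ξ ht ω,
      expect]
  · intro ξ _
    obtain ⟨K, hK0, hK⟩ := exists_abs_quad_le (d := d) (N := N) hα hν (mode_neg ξ)
    refine Integrable.const_mul ?_ _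
    exact Integrable.of_bound (((measurable_comp_trajectory (continuous_quad _).measurable t).comp
      (measurable_const.prodMk measurable_id)).aestronglyMeasurable) (K * energy α ν ω)
      (Eventually.of_forall fun c => abs_comp_trajectory_le hK t (ω, c))

theorem integral_comp_trajectory_zero_mul (hα : 0 < α) (hν : 0 ≤ ν) (hγ : 0 < γ) (hT : 0 < T)
    {f g : Phase d N → ℝ} {K L : ℝ} (hf : Measurable f) (hg : Measurable g)
    (hK : ∀ ω, |f ω| ≤ K * energy α ν ω) (hL : ∀ ω, |g ω| ≤ L * energy α ν ω) (t : ℝ) :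
    ∫ z, f (trajectory α ν γ 0 z) * g (trajectory α ν γ t z) ∂(equilibrium d N α ν T) =
      ∫ ω, f ω * expect α ν γ g t ω ∂(gibbs d N α ν T) := by
  have hprob := isProbabilityMeasure_gibbs (d := d) (N := N) hα hν hT
  rw [equilibrium, integral_prod _ (integrable_mul_comp_trajectory hα hν hT hf hg hK hL 0 t)]
  refine integral_congr_ae (Eventually.of_forall fun ω => ?_)
  simp only
  rw [expect, ← integral_const_mul]
  refine integral_congr_ae ?_
  filter_upwards [ae_good] with c hc
  rw [trajectory_zero hγ ω hc]

/-- Expanding the total current in modes and averaging over the noise leaves equal-time covariances,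
each with its exponential factor. -/
theorem integral_current_mul_totalCurrent (hα : 0 < α) (hν : 0 ≤ ν) (hγ : 0 < γ) (hT : 0 < T)
    (k : Fin d) (x : Site d N) {t : ℝ} (ht : 0 ≤ t) :
    ∫ z, current (harmV α) k x (trajectory α ν γ 0 z) *
      totalCurrent N α k (trajectory α ν γ t z) ∂(equilibrium d N α ν T) =
      T ^ 2 * spectralSum N α ν γ k t := by
  rw [integral_comp_trajectory_zero_mul hα hν hγ hT (continuous_current α k x).measurable
    (continuous_totalCurrent α k).measurable (abs_current_le hα hν k x)
    (abs_totalCurrent_le hα hν k)]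
  simp only [expect_totalCurrent hα hν hγ k ht, Finset.mul_sum]
  rw [integral_finsetSum, spectralSum, Finset.mul_sum, Finset.mul_sum]
  · refine Finset.sum_congr rfl fun ξ _ => ?_
    simp only [mul_left_comm (current (harmV α) k x _)]
    rw [integral_const_mul]
    have h1 := stiffEig_mul_integral_current_mul_quad (d := d) (N := N) hα hν hT k x ξ
    set I := ∫ ω, current (harmV α) k x ω * quad (mode ξ) ω ∂(gibbs d N α ν T)
    set s := Real.sin (2 * Real.pi * grid ξ k) with hs
    rw [stiffEig] at h1
    have h2 := symb_nonneg (grid ξ)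
    have h3 : 0 ≤ ν + 4 * α * symb (grid ξ) := by positivity
    rw [density, ← hs]
    -- If the eigenvalue vanishes, so does the sine, and both sides are zero; otherwise the
    -- covariance identity can be divided by it.
    rcases h3.eq_or_lt with h | h
    · have h4 : symb (grid ξ) = 0 := by
        have : 0 ≤ 4 * α * symb (grid ξ) := by positivity
        have h5 : 4 * α * symb (grid ξ) = 0 := by linarith
        exact (mul_eq_zero.1 h5).resolve_left (by positivity)
      have h5 := sin_two_sq_le_symb (grid ξ) k
      rw [h4, mul_zero, ← hs] at h5
      have h6 : s = 0 := pow_eq_zero_iff two_ne_zero |>.1 (le_antisymm h5 (sq_nonneg s))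
      simp [h6]
    · have h4 : I = -(α * T ^ 2 * s) / (ν + 4 * α * symb (grid ξ)) := by
        rw [eq_div_iff h.ne']
        linarith
      rw [h4]
      field_simp
  · intro ξ _
    simp only [mul_left_comm (current (harmV α) k x _)]
    exact (integrable_gibbs hα hν hT ((hasTemperateGrowth_current α ν k x).mul
      (hasTemperateGrowth_quad ν (mode ξ)))).const_mul _

theorem integrable_currentAt_mul (hα : 0 < α) (hν : 0 ≤ ν) (hT : 0 < T) (k : Fin d)
    (x y : Site d N) (s t : ℝ) :
    Integrable (fun z => currentAt α ν γ k x s z * currentAt α ν γ k y t z)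
      (equilibrium d N α ν T) :=
  integrable_mul_comp_trajectory hα hν hT (continuous_current α k x).measurable
    (continuous_current α k y).measurable (abs_current_le hα hν k x) (abs_current_le hα hν k y) s t

theorem sum_correlation (hα : 0 < α) (hν : 0 ≤ ν) (hγ : 0 < γ) (hT : 0 < T) (k : Fin d) {t : ℝ}
    (ht : 0 ≤ t) :
    ∑ x, correlation d N α ν γ T k x t = T ^ 2 * spectralSum N α ν γ k t := by
  simp only [correlation]
  rw [← integral_finsetSum _ fun x _ => integrable_currentAt_mul hα hν hT k 0 x 0 t,
    ← integral_current_mul_totalCurrent hα hν hγ hT k 0 ht]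
  simp only [totalCurrent, Finset.mul_sum]
  rfl

theorem integral_totalCurrent_mul_zero (hα : 0 < α) (hν : 0 ≤ ν) (hγ : 0 < γ) (hT : 0 < T)
    (k : Fin d) {t : ℝ} (ht : 0 ≤ t) :
    ∫ z, totalCurrent N α k (trajectory α ν γ 0 z) *
      totalCurrent N α k (trajectory α ν γ t z) ∂(equilibrium d N α ν T) =
      (N : ℝ) ^ d * (T ^ 2 * spectralSum N α ν γ k t) := by
  conv_lhs => enter [2, z]; rw [totalCurrent, Finset.sum_mul]
  rw [integral_finsetSum _ fun x _ => integrable_mul_comp_trajectory hα hν hT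
    (continuous_current α k x).measurable (continuous_totalCurrent α k).measurable
    (abs_current_le hα hν k x) (abs_totalCurrent_le hα hν k) 0 t]
  simp only [integral_current_mul_totalCurrent hα hν hγ hT k _ ht, Finset.sum_const,
    Finset.card_univ, nsmul_eq_mul]
  simp [ZMod.card]

theorem integral_totalCurrent_mul (hα : 0 < α) (hν : 0 ≤ ν) (hγ : 0 < γ) (hT : 0 < T)
    (k : Fin d) {s t : ℝ} (hs : 0 ≤ s) (ht : 0 ≤ t) :
    ∫ z, totalCurrent N α k (trajectory α ν γ s z) *
      totalCurrent N α k (trajectory α ν γ t z) ∂(equilibrium d N α ν T) =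
      (N : ℝ) ^ d * (T ^ 2 * spectralSum N α ν γ k |t - s|) := by
  have key : ∀ {s t : ℝ}, 0 ≤ s → s ≤ t → ∫ z, totalCurrent N α k (trajectory α ν γ s z) *
      totalCurrent N α k (trajectory α ν γ t z) ∂(equilibrium d N α ν T) =
      (N : ℝ) ^ d * (T ^ 2 * spectralSum N α ν γ k |t - s|) := by
    intro s t hs hst
    have h1 := integral_mul_comp_trajectory_add hα hν hγ hT
      (continuous_totalCurrent (N := N) α k).measurable
      (continuous_totalCurrent (N := N) α k).measurable
      (abs_totalCurrent_le hα hν k) (abs_totalCurrent_le hα hν k)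
      (fun ω c _ => totalCurrent_add_cst α c k ω) (fun ω c _ => totalCurrent_add_cst α c k ω)
      hs (sub_nonneg.2 hst)
    rw [add_sub_cancel, zero_add] at h1
    rw [h1, integral_totalCurrent_mul_zero hα hν hγ hT k (sub_nonneg.2 hst),
      abs_of_nonneg (sub_nonneg.2 hst)]
  rcases le_total s t with h | h
  · exact key hs h
  · rw [abs_sub_comm, ← key ht h]
    simp only [mul_comm]

theorem measurable_correlation (hα : 0 < α) (hν : 0 ≤ ν) (hT : 0 < T) (k : Fin d)
    (x : Site d N) : Measurable (correlation d N α ν γ T k x) := by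
  have hprob := isProbabilityMeasure_gibbs (d := d) (N := N) hα hν hT
  have : SFinite (equilibrium d N α ν T) := by unfold equilibrium; infer_instance
  refine StronglyMeasurable.measurable ?_
  exact StronglyMeasurable.integral_prod_right (f := fun t z =>
    currentAt α ν γ k 0 0 z * currentAt α ν γ k x t z)
    ((((measurable_currentAt k 0).comp (measurable_const.prodMk measurable_snd)).mul
      (measurable_currentAt k x)).stronglyMeasurable)

theorem exists_abs_correlation_le (hα : 0 < α) (hν : 0 ≤ ν) (hT : 0 < T) (k : Fin d)
    (x : Site d N) : ∃ B, ∀ t, |correlation d N α ν γ T k x t| ≤ B := by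
  refine ⟨∫ z, (1 + 4 * α) * (1 + 4 * α) * energy α ν z.1 ^ 2 ∂(equilibrium d N α ν T),
    fun t => ?_⟩
  exact norm_integral_le_of_norm_le
    (f := fun z => currentAt α ν γ k 0 0 z * currentAt α ν γ k x t z)
    ((integrable_energy_sq_fst hα hν hT).const_mul _) (Eventually.of_forall fun z => abs_mul_comp_trajectory_le (abs_current_le hα hν k 0)
      (abs_current_le hα hν k x) 0 t z)

theorem intervalIntegrable_correlation (hα : 0 < α) (hν : 0 ≤ ν) (hT : 0 < T) (k : Fin d)
    (x : Site d N) (a b : ℝ) :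
    IntervalIntegrable (correlation d N α ν γ T k x) volume a b := by
  obtain ⟨B, hB⟩ := exists_abs_correlation_le (γ := γ) hα hν hT k x
  exact (intervalIntegrable_const (c := B)).mono_fun'
    (measurable_correlation hα hν hT k x).aestronglyMeasurable (Eventually.of_forall hB)

theorem integrable_prod_totalCurrent (hα : 0 < α) (hν : 0 ≤ ν) (hT : 0 < T) (t : ℝ) (k : Fin d) :
    Integrable (fun q : (Phase d N × Clock d N) × (ℝ × ℝ) =>
      totalCurrent N α k (trajectory α ν γ q.2.1 q.1) *
        totalCurrent N α k (trajectory α ν γ q.2.2 q.1))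
      ((equilibrium d N α ν T).prod
        ((volume.restrict (Ioc 0 t)).prod (volume.restrict (Ioc 0 t)))) := by
  have hprob := isProbabilityMeasure_gibbs (d := d) (N := N) hα hν hT
  have : SFinite (equilibrium d N α ν T) := by unfold equilibrium; infer_instance
  have hm : Measurable fun p : ℝ × (Phase d N × Clock d N) =>
      totalCurrent N α k (trajectory α ν γ p.1 p.2) :=
    (continuous_totalCurrent (N := N) α k).measurable.comp measurable_trajectory
  set L : ℝ := Fintype.card (Site d N) * (1 + 4 * α)
  have h1 : Integrable (fun z : Phase d N × Clock d N => L * L * energy α ν z.1 ^ 2)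
    (equilibrium d N α ν T) := (integrable_energy_sq_fst hα hν hT).const_mul (L * L)
  have h2 := h1.comp_fst ((volume.restrict (Ioc 0 t)).prod (volume.restrict (Ioc 0 t)))
  have h3 : Measurable fun q : (Phase d N × Clock d N) × (ℝ × ℝ) =>
      totalCurrent N α k (trajectory α ν γ q.2.1 q.1) :=
    hm.comp (f := fun q : (Phase d N × Clock d N) × (ℝ × ℝ) => (q.2.1, q.1))
      ((measurable_fst.comp measurable_snd).prodMk measurable_fst)
  have h4 : Measurable fun q : (Phase d N × Clock d N) × (ℝ × ℝ) =>
      totalCurrent N α k (trajectory α ν γ q.2.2 q.1) :=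
    hm.comp (f := fun q : (Phase d N × Clock d N) × (ℝ × ℝ) => (q.2.2, q.1))
      ((measurable_snd.comp measurable_snd).prodMk measurable_fst)
  refine h2.mono' (h3.mul h4).aestronglyMeasurable (Eventually.of_forall fun q => ?_)
  exact
    abs_mul_comp_trajectory_le (abs_totalCurrent_le hα hν k) (abs_totalCurrent_le hα hν k)
      q.2.1 q.2.2 q.1

theorem integrable_sq_sum_integral (hα : 0 < α) (hν : 0 ≤ ν) (hT : 0 < T) {t : ℝ} (ht : 0 ≤ t)
    (k : Fin d) :
    Integrable (fun z => (∑ x : Site d N, ∫ s in (0 : ℝ)..t, currentAt α ν γ k x s z) ^ 2)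
      (equilibrium d N α ν T) := by
  simp only [sum_integral_currentAt hα hν, sq_integral_totalCurrent ht]
  exact (integrable_prod_totalCurrent hα hν hT t k).integral_prod_left

/-- Splitting the inner integral at the diagonal gives `F u + F (t - u)` with `F` a primitive of
`c`; an integration by parts then yields the weight `t - h`. -/
theorem integral_abs_sub {c : ℝ → ℝ} (hc : Continuous c) {t : ℝ} (ht : 0 ≤ t) :
    ∫ u in (0 : ℝ)..t, ∫ s in (0 : ℝ)..t, c |s - u| = 2 * ∫ h in (0 : ℝ)..t, (t - h) * c h := by
  set F : ℝ → ℝ := fun s => ∫ h in (0 : ℝ)..s, c h with hF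
  have hF' : ∀ s, HasDerivAt F (c s) s := fun s => hc.integral_hasStrictDerivAt 0 s |>.hasDerivAt
  have hFc : Continuous F := continuous_iff_continuousAt.2 fun s => (hF' s).continuousAt
  have h1 : ∀ u ∈ uIcc 0 t, ∫ s in (0 : ℝ)..t, c |s - u| = F u + F (t - u) := by
    intro u hu
    rw [uIcc_of_le ht] at hu
    rw [← intervalIntegral.integral_add_adjacent_intervals (b := u)
      (Continuous.intervalIntegrable (by fun_prop) _ _)
      (Continuous.intervalIntegrable (by fun_prop) _ _)]
    congr 1
    · have h2 : ∫ s in (0 : ℝ)..u, c |s - u| = ∫ s in (0 : ℝ)..u, c (u - s) := by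
        refine intervalIntegral.integral_congr fun s hs => ?_
        rw [uIcc_of_le hu.1] at hs
        rw [abs_sub_comm, abs_of_nonneg (sub_nonneg.2 hs.2)]
      rw [h2, intervalIntegral.integral_comp_sub_left (fun s => c s) u]
      simp [hF]
    · have h2 : ∫ s in u..t, c |s - u| = ∫ s in u..t, c (s - u) := by
        refine intervalIntegral.integral_congr fun s hs => ?_
        rw [uIcc_of_le hu.2] at hs
        rw [abs_of_nonneg (sub_nonneg.2 hs.1)]
      rw [h2, intervalIntegral.integral_comp_sub_right (fun s => c s) u]
      simp [hF]
  rw [intervalIntegral.integral_congr h1, intervalIntegral.integral_add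
    (hFc.intervalIntegrable _ _) (Continuous.intervalIntegrable (by fun_prop) _ _),
    intervalIntegral.integral_comp_sub_left F t, sub_self, sub_zero]
  have h3 := intervalIntegral.integral_mul_deriv_eq_deriv_mul (a := 0) (b := t)
    (u := fun h => t - h) (u' := fun _ => -1) (v := F) (v' := c)
    (fun x _ => by simpa using (hasDerivAt_id x).const_sub t) (fun x _ => hF' x)
    (by simp) (hc.intervalIntegrable _ _)
  have h4 : F 0 = 0 := by simp [hF]
  simp only [sub_self, zero_mul, h4, mul_zero, neg_one_mul, intervalIntegral.integral_neg,
    sub_zero, zero_sub, neg_neg] at h3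
  rw [h3]
  ring

theorem integral_sq_sum_integral (hα : 0 < α) (hν : 0 ≤ ν) (hγ : 0 < γ) (hT : 0 < T) {t : ℝ}
    (ht : 0 ≤ t) (k : Fin d) :
    ∫ z, (∑ x : Site d N, ∫ s in (0 : ℝ)..t, currentAt α ν γ k x s z) ^ 2
      ∂(equilibrium d N α ν T) =
    (N : ℝ) ^ d * T ^ 2 * (2 * ∫ h in (0 : ℝ)..t, (t - h) * spectralSum N α ν γ k h) := by
  have hprob := isProbabilityMeasure_gibbs (d := d) (N := N) hα hν hT
  have : SFinite (equilibrium d N α ν T) := by unfold equilibrium; infer_instance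
  have hc := continuous_spectralSum (N := N) α ν γ k
  simp only [sum_integral_currentAt hα hν, sq_integral_totalCurrent ht]
  rw [integral_integral_swap (integrable_prod_totalCurrent hα hν hT t k),
    ← integral_abs_sub hc ht, ← intervalIntegral.integral_const_mul,
    intervalIntegral.integral_of_le ht]
  have h1 := (integrable_prod_totalCurrent (γ := γ) (N := N) hα hν hT t k).integral_prod_right
  rw [integral_prod _ h1]
  refine setIntegral_congr_fun measurableSet_Ioc fun u hu => ?_
  simp only
  rw [intervalIntegral.integral_of_le ht, ← integral_const_mul]
  refine setIntegral_congr_fun measurableSet_Ioc fun s hs => ?_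
  rw [integral_totalCurrent_mul hα hν hγ hT k hu.1.le hs.1.le, mul_assoc]

theorem greenKuboVariance_eq (hα : 0 < α) (hν : 0 ≤ ν) (hγ : 0 < γ) (hT : 0 < T) {t : ℝ}
    (ht : 0 < t) (k : Fin d) :
    greenKuboVariance d N α ν γ T k t =
      γ + ∫ h in (0 : ℝ)..t, (1 - h / t) * spectralSum N α ν γ k h := by
  rw [greenKuboVariance, integral_sq_sum_integral hα hν hγ hT ht.le]
  have hN : (N : ℝ) ≠ 0 := Nat.cast_ne_zero.2 (NeZero.ne N)
  have h1 : ∫ h in (0 : ℝ)..t, (t - h) * spectralSum N α ν γ k h =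
      t * ∫ h in (0 : ℝ)..t, (1 - h / t) * spectralSum N α ν γ k h := by
    rw [← intervalIntegral.integral_const_mul]
    refine intervalIntegral.integral_congr fun h _ => ?_
    field_simp
  rw [h1]
  field_simp
  ring

theorem setIntegral_max_mul {c : ℝ → ℝ} {t : ℝ} (ht : 0 < t) :
    ∫ s in Ioi (0 : ℝ), max (1 - s / t) 0 * c s = ∫ s in (0 : ℝ)..t, (1 - s / t) * c s := by
  rw [intervalIntegral.integral_of_le ht.le, ← integral_indicator measurableSet_Ioi,
    ← integral_indicator measurableSet_Ioc]
  refine integral_congr_ae (Eventually.of_forall fun s => ?_)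
  simp only [indicator_apply, mem_Ioi, mem_Ioc]
  by_cases h1 : 0 < s
  · by_cases h2 : s ≤ t
    · have : 0 ≤ 1 - s / t := sub_nonneg.2 ((div_le_one ht).2 h2)
      simp [h1, h2, this]
    · have : 1 - s / t ≤ 0 := sub_nonpos.2 ((one_le_div ht).2 (not_le.1 h2).le)
      simp [h1, h2, this]
  · simp [h1]

theorem greenKuboCorrelation_eq (hα : 0 < α) (hν : 0 ≤ ν) (hγ : 0 < γ) (hT : 0 < T) {t : ℝ}
    (ht : 0 < t) (k : Fin d) :
    greenKuboCorrelation d N α ν γ T k t =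
      γ + ∫ h in (0 : ℝ)..t, (1 - h / t) * spectralSum N α ν γ k h := by
  rw [greenKuboCorrelation]
  simp only [setIntegral_max_mul ht]
  rw [← intervalIntegral.integral_finsetSum fun x _ =>
    (intervalIntegrable_correlation hα hν hT k x 0 t).continuousOn_mul (by fun_prop)]
  have h1 : ∫ s in (0 : ℝ)..t, ∑ x, (1 - s / t) * correlation d N α ν γ T k x s =
      T ^ 2 * ∫ h in (0 : ℝ)..t, (1 - h / t) * spectralSum N α ν γ k h := by
    rw [← intervalIntegral.integral_const_mul]
    refine intervalIntegral.integral_congr fun s hs => ?_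
    rw [uIcc_of_le ht.le] at hs
    rw [← Finset.mul_sum, sum_correlation hα hν hγ hT k hs.1]
    ring
  rw [h1]
  field_simp
  ring

end Formula

/-! ### Riemann sums over the torus as integrals over the unit cube. -/

section Cube

variable {d : ℕ}

/-- The faces of the cube are negligible. Passing to the open cube avoids the corners, where the
symbol vanishes. -/
theorem restrict_Icc_eq_pi :
    (volume : Measure (Fin d → ℝ)).restrict (Icc 0 1) =
      Measure.pi fun _ => (volume : Measure ℝ).restrict (Ioo 0 1) := by
  rw [← pi_univ_Icc, volume_pi, Measure.restrict_pi_pi]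
  simp only [Pi.zero_apply, Pi.one_apply]
  congr 1
  funext _
  exact Measure.restrict_congr_set Ioo_ae_eq_Icc.symm

theorem ae_mem_Ioo : ∀ᵐ ξ ∂((volume : Measure (Fin d → ℝ)).restrict (Icc 0 1)),
    ∀ j, ξ j ∈ Ioo (0 : ℝ) 1 := by
  rw [restrict_Icc_eq_pi]
  refine ae_all_iff.2 fun j => ?_
  exact (Measure.quasiMeasurePreserving_eval (fun _ : Fin d => volume.restrict (Ioo (0 : ℝ) 1)) j).ae
    (ae_restrict_mem measurableSet_Ioo)

instance : IsProbabilityMeasure ((volume : Measure (Fin d → ℝ)).restrict (Icc 0 1)) := by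
  have : IsProbabilityMeasure ((volume : Measure ℝ).restrict (Ioo 0 1)) := ⟨by simp⟩
  rw [restrict_Icc_eq_pi]
  infer_instance

/-- The point of the grid of mesh `1 / M` just below a point of the unit cube. -/
def toSite (M : ℕ) (x : ℝ) : ZMod M := (⌊(M : ℝ) * x⌋₊ : ℕ)

theorem measurable_toSite (M : ℕ) : Measurable (toSite M) :=
  (measurable_of_countable fun n : ℕ => (n : ZMod M)).comp
    (Nat.measurable_floor.comp (measurable_const_mul _))

theorem val_toSite {M : ℕ} [NeZero M] {x : ℝ} (hx : x ∈ Ioo (0 : ℝ) 1) :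
    (toSite M x).val = ⌊(M : ℝ) * x⌋₊ := by
  have hM : (0 : ℝ) < M := Nat.cast_pos.2 (NeZero.pos M)
  rw [toSite, ZMod.val_natCast, Nat.mod_eq_of_lt]
  rw [Nat.floor_lt (by have := hx.1.le; positivity)]
  nlinarith [hx.2]

theorem map_toSite_singleton {M : ℕ} [NeZero M] (η : ZMod M) :
    (Measure.map (toSite M) (volume.restrict (Ioo 0 1))) {η} = ENNReal.ofReal (M : ℝ)⁻¹ := by
  have hM : (0 : ℝ) < M := Nat.cast_pos.2 (NeZero.pos M)
  rw [Measure.map_apply (measurable_toSite M) (measurableSet_singleton η),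
    Measure.restrict_congr_set Ioo_ae_eq_Ico, Measure.restrict_apply]
  -- On the half-open interval the preimage of a residue is exactly one cell of the grid, of length
  -- `1 / M`.
  · have h : toSite M ⁻¹' {η} ∩ Ico 0 1 = Ico ((η.val : ℝ) / M) ((η.val + 1) / M) := by
      ext x
      simp only [mem_inter_iff, mem_preimage, mem_singleton_iff, mem_Ico]
      have hη : (η.val : ℝ) + 1 ≤ M := by exact_mod_cast ZMod.val_lt η
      rw [div_le_iff₀' hM, lt_div_iff₀' hM]
      constructor
      · rintro ⟨h1, h2, h3⟩
        have h4 : (toSite M x).val = ⌊(M : ℝ) * x⌋₊ := by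
          rw [toSite, ZMod.val_natCast, Nat.mod_eq_of_lt]
          rw [Nat.floor_lt (by positivity)]
          nlinarith
        rw [h1] at h4
        rw [h4]
        exact ⟨Nat.floor_le (by positivity), Nat.lt_floor_add_one _⟩
      · rintro ⟨h1, h2⟩
        have h3 : 0 ≤ x := by
          by_contra h
          have : (M : ℝ) * x < 0 := mul_neg_of_pos_of_neg hM (not_le.1 h)
          have h5 : (0 : ℝ) ≤ η.val := Nat.cast_nonneg _
          linarith
        refine ⟨?_, h3, ?_⟩
        · have h6 : ⌊(M : ℝ) * x⌋₊ = η.val := (Nat.floor_eq_iff (by positivity)).2 ⟨h1, h2⟩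
          rw [toSite, h6, ZMod.natCast_zmod_val]
        · nlinarith
    rw [h, Real.volume_Ico]
    congr 1
    field_simp
    ring
  · exact measurable_toSite M (measurableSet_singleton η)

/-- The Riemann sum is the integral of a step function, so that its convergence becomes a case of
dominated convergence. -/
theorem integral_comp_toSite {M : ℕ} [NeZero M] (f : Site d M → ℝ) :
    ∫ ξ in Icc (0 : Fin d → ℝ) 1, f (fun j => toSite M (ξ j)) =
      ((M : ℝ) ^ d)⁻¹ * ∑ ξ, f ξ := by
  have hM : (0 : ℝ) ≤ (M : ℝ)⁻¹ := by positivity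
  have h1 : ∀ j : Fin d, AEMeasurable (toSite M) ((volume : Measure ℝ).restrict (Ioo 0 1)) :=
    fun _ => (measurable_toSite M).aemeasurable
  have h2 := Measure.pi_map_pi (ι := Fin d) (μ := fun _ => (volume : Measure ℝ).restrict (Ioo 0 1))
    h1
  have h3 : Measurable fun (ξ : Fin d → ℝ) j => toSite M (ξ j) :=
    measurable_pi_lambda _ fun j => (measurable_toSite M).comp (measurable_pi_apply j)
  rw [restrict_Icc_eq_pi, ← integral_map h3.aemeasurable
    (measurable_of_countable f).aestronglyMeasurable, h2, integral_fintype Integrable.of_finite,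
    Finset.mul_sum]
  refine Finset.sum_congr rfl fun η _ => ?_
  rw [measureReal_def, Measure.pi_singleton]
  simp only [map_toSite_singleton, Finset.prod_const, Finset.card_univ, Fintype.card_fin,
    ENNReal.toReal_pow, ENNReal.toReal_ofReal hM, inv_pow, smul_eq_mul]

/-- Riemann sums over the discrete torus. -/
theorem tendsto_riemannSum {f : (Fin d → ℝ) → ℝ} {B : ℝ} (hB : ∀ ξ, |f ξ| ≤ B)
    (hf : ∀ ξ : Fin d → ℝ, (∀ j, ξ j ∈ Ioo (0 : ℝ) 1) → ContinuousAt f ξ) :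
    Tendsto (fun N : ℕ => (((N + 1 : ℕ) : ℝ) ^ d)⁻¹ * ∑ ξ : Site d (N + 1), f (grid ξ)) atTop
      (𝓝 (∫ ξ in Icc (0 : Fin d → ℝ) 1, f ξ)) := by
  simp only [← integral_comp_toSite (fun ξ => f (grid ξ))]
  refine tendsto_integral_of_dominated_convergence (fun _ => B) (fun N => ?_)
    (integrable_const B) (fun N => Eventually.of_forall fun ξ => hB _) ?_
  · exact ((measurable_of_countable fun ξ : Site d (N + 1) => f (grid ξ)).comp
      (measurable_pi_lambda _ fun j =>
        (measurable_toSite (N + 1)).comp (measurable_pi_apply j))).aestronglyMeasurable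
  · filter_upwards [ae_mem_Ioo] with ξ hξ
    refine (hf ξ hξ).tendsto.comp (tendsto_pi_nhds.2 fun j => ?_)
    have h1 := (tendsto_nat_floor_mul_div_atTop (R := ℝ) (hξ j).1.le).comp
      ((tendsto_natCast_atTop_atTop (R := ℝ)).comp (tendsto_add_atTop_nat 1))
    refine h1.congr fun N => ?_
    simp only [Function.comp, grid, val_toSite (hξ j)]
    rw [mul_comm]

end Cube

/-! ### Infinite volume limit at fixed time. -/

section Limit

variable {d : ℕ} {α ν γ : ℝ}

theorem continuous_symb : Continuous (symb (d := d)) := by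
  unfold symb
  fun_prop

theorem symb_pos [NeZero d] {ξ : Fin d → ℝ} (hξ : ∀ j, ξ j ∈ Ioo (0 : ℝ) 1) : 0 < symb ξ := by
  refine lt_of_lt_of_le ?_ (sin_sq_le_symb ξ 0)
  have := Real.sin_pos_of_mem_Ioo (x := Real.pi * ξ 0)
    ⟨mul_pos Real.pi_pos (hξ 0).1, mul_lt_of_lt_one_right Real.pi_pos (hξ 0).2⟩
  positivity

theorem measurable_density (k : Fin d) : Measurable (density α ν k) := by
  have := (continuous_symb (d := d)).measurable
  unfold density
  fun_prop

/-- The limiting current correlation at temperature one. -/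
def limitCorr (α ν γ : ℝ) (k : Fin d) (t : ℝ) : ℝ :=
  ∫ ξ in Icc (0 : Fin d → ℝ) 1, density α ν k ξ * Real.exp (-(8 * γ * t * symb ξ))

theorem density_mul_exp_nonneg (hα : 0 < α) (hν : 0 ≤ ν) (k : Fin d) (t : ℝ) (ξ : Fin d → ℝ) :
    0 ≤ density α ν k ξ * Real.exp (-(8 * γ * t * symb ξ)) :=
  mul_nonneg (density_nonneg hα hν k ξ) (Real.exp_pos _).le

theorem density_mul_exp_le (hα : 0 < α) (hν : 0 ≤ ν) (hγ : 0 < γ) (k : Fin d) {t : ℝ}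
    (ht : 0 ≤ t) (ξ : Fin d → ℝ) :
    density α ν k ξ * Real.exp (-(8 * γ * t * symb ξ)) ≤ 2 * α := by
  have h1 := symb_nonneg ξ
  have h2 : Real.exp (-(8 * γ * t * symb ξ)) ≤ 1 :=
    Real.exp_le_one_iff.2 (neg_nonpos.2 (by positivity))
  calc _ ≤ (2 * α) * 1 := mul_le_mul (density_le hα hν k ξ) h2 (Real.exp_pos _).le (by positivity)
    _ = _ := mul_one _

theorem measurable_density_mul_exp (k : Fin d) :
    Measurable fun p : ℝ × (Fin d → ℝ) =>
      density α ν k p.2 * Real.exp (-(8 * γ * p.1 * symb p.2)) := by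
  have h1 := (continuous_symb (d := d)).measurable
  have h2 := measurable_density (α := α) (ν := ν) k
  fun_prop

theorem measurable_density_mul_exp_right (k : Fin d) (t : ℝ) :
    Measurable fun ξ : Fin d → ℝ => density α ν k ξ * Real.exp (-(8 * γ * t * symb ξ)) := by
  have h1 := (continuous_symb (d := d)).measurable
  have h2 := measurable_density (α := α) (ν := ν) k
  fun_prop

theorem measurable_limitCorr (k : Fin d) : Measurable (limitCorr α ν γ k) :=
  (StronglyMeasurable.integral_prod_right (f := fun t ξ =>
    density α ν k ξ * Real.exp (-(8 * γ * t * symb ξ)))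
    (measurable_density_mul_exp k).stronglyMeasurable).measurable

theorem limitCorr_nonneg (hα : 0 < α) (hν : 0 ≤ ν) (k : Fin d) (t : ℝ) :
    0 ≤ limitCorr α ν γ k t :=
  integral_nonneg fun ξ => density_mul_exp_nonneg hα hν k t ξ

theorem integrable_density_mul_exp (hα : 0 < α) (hν : 0 ≤ ν) (hγ : 0 < γ) (k : Fin d) {t : ℝ}
    (ht : 0 ≤ t) :
    IntegrableOn (fun ξ => density α ν k ξ * Real.exp (-(8 * γ * t * symb ξ))) (Icc 0 1) :=
  Integrable.of_bound (measurable_density_mul_exp_right k t).aestronglyMeasurable (2 * α)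
    (Eventually.of_forall fun ξ => by
      rw [Real.norm_of_nonneg (density_mul_exp_nonneg hα hν k t ξ)]
      exact density_mul_exp_le hα hν hγ k ht ξ)

theorem limitCorr_le (hα : 0 < α) (hν : 0 ≤ ν) (hγ : 0 < γ) (k : Fin d) {t : ℝ} (ht : 0 ≤ t) :
    limitCorr α ν γ k t ≤ 2 * α := by
  have := integral_mono (integrable_density_mul_exp hα hν hγ k ht) (integrable_const (2 * α))
    fun ξ => density_mul_exp_le hα hν hγ k ht ξ
  rw [integral_const, probReal_univ, one_smul] at this
  exact this

/-- Without pinning the denominator vanishes at the corners of the cube. Boundedness together with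
continuity inside the open cube is enough. -/
theorem tendsto_spectralSum [NeZero d] (hα : 0 < α) (hν : 0 ≤ ν) (hγ : 0 < γ) (k : Fin d) {t : ℝ}
    (ht : 0 ≤ t) :
    Tendsto (fun N : ℕ => spectralSum (N + 1) α ν γ k t) atTop (𝓝 (limitCorr α ν γ k t)) := by
  refine tendsto_riemannSum (f := fun ξ => density α ν k ξ * Real.exp (-(8 * γ * t * symb ξ)))
    (B := 2 * α) (fun ξ => ?_) fun ξ hξ => ?_
  · rw [abs_of_nonneg (density_mul_exp_nonneg hα hν k t ξ)]
    exact density_mul_exp_le hα hν hγ k ht ξ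
  · have h1 := (continuous_symb (d := d)).continuousAt (x := ξ)
    have h2 := symb_pos hξ
    have h3 : ν + 4 * α * symb ξ ≠ 0 := by positivity
    have h4 : ContinuousAt (density α ν k) ξ := by
      unfold density
      refine ContinuousAt.div ?_ ?_ h3
      · exact Continuous.continuousAt (by fun_prop)
      · exact continuousAt_const.add (continuousAt_const.mul h1)
    fun_prop

theorem spectralSum_nonneg {N : ℕ} [NeZero N] (hα : 0 < α) (hν : 0 ≤ ν) (k : Fin d) (t : ℝ) :
    0 ≤ spectralSum N α ν γ k t :=
  mul_nonneg (by positivity) (Finset.sum_nonneg fun ξ _ => density_mul_exp_nonneg hα hν k t _)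

theorem spectralSum_le {N : ℕ} [NeZero N] (hα : 0 < α) (hν : 0 ≤ ν) (hγ : 0 < γ) (k : Fin d)
    {t : ℝ} (ht : 0 ≤ t) : spectralSum N α ν γ k t ≤ 2 * α := by
  have hN : (0 : ℝ) < N := Nat.cast_pos.2 (NeZero.pos N)
  rw [spectralSum, inv_mul_le_iff₀ (by positivity)]
  refine (Finset.sum_le_card_nsmul _ _ (2 * α) fun ξ _ =>
    density_mul_exp_le hα hν hγ k ht (grid ξ)).trans_eq ?_
  simp [ZMod.card]

theorem tendsto_integral_spectralSum [NeZero d] (hα : 0 < α) (hν : 0 ≤ ν) (hγ : 0 < γ)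
    (k : Fin d) {t : ℝ} (ht : 0 < t) :
    Tendsto (fun N : ℕ => γ + ∫ h in (0 : ℝ)..t, (1 - h / t) * spectralSum (N + 1) α ν γ k h)
      atTop (𝓝 (γ + ∫ h in (0 : ℝ)..t, (1 - h / t) * limitCorr α ν γ k h)) := by
  refine tendsto_const_nhds.add ?_
  refine intervalIntegral.tendsto_integral_filter_of_dominated_convergence (fun _ => 2 * α)
    (Eventually.of_forall fun N => ?_) (Eventually.of_forall fun N => ?_)
    intervalIntegrable_const ?_
  · have := continuous_spectralSum (N := N + 1) α ν γ k
    exact Continuous.aestronglyMeasurable (by fun_prop)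
  · refine Eventually.of_forall fun h hh => ?_
    rw [uIoc_of_le ht.le] at hh
    have h1 : 0 ≤ 1 - h / t := sub_nonneg.2 ((div_le_one ht).2 hh.2)
    have h2 : 1 - h / t ≤ 1 := by have := div_nonneg hh.1.le ht.le; linarith
    have h3 := spectralSum_nonneg (N := N + 1) (γ := γ) hα hν k h
    rw [Real.norm_of_nonneg (mul_nonneg h1 h3)]
    calc _ ≤ 1 * (2 * α) := mul_le_mul h2 (spectralSum_le hα hν hγ k hh.1.le) h3 one_pos.le
      _ = _ := one_mul _
  · refine Eventually.of_forall fun h hh => ?_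
    rw [uIoc_of_le ht.le] at hh
    exact (tendsto_spectralSum hα hν hγ k hh.1.le).const_mul _

end Limit

/-! ### Passage to the centred cube and diffusive scaling. -/

section Fold

variable {d : ℕ}

/-- Every interval of length one is a fundamental domain of the circle, and the fractional part
factors through the circle. -/
theorem map_fract (a : ℝ) :
    Measure.map Int.fract ((volume : Measure ℝ).restrict (Ioc a (a + 1))) =
      volume.restrict (Ioo 0 1) := by
  have h1 : (fun x : ℝ => ((AddCircle.equivIco (1 : ℝ) 0 (x : UnitAddCircle) : Ico (0 : ℝ) (0 + 1)) : ℝ)) =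
      Int.fract := by
    funext x
    simp [AddCircle.coe_equivIco_mk_apply (p := (1 : ℝ)) x]
  have h2 : Measurable fun y : UnitAddCircle =>
      ((AddCircle.equivIco (1 : ℝ) 0 y : Ico (0 : ℝ) (0 + 1)) : ℝ) :=
    measurable_subtype_coe.comp (AddCircle.measurableEquivIco (1 : ℝ) 0).measurable
  have h3 : ∀ b : ℝ, Measure.map Int.fract ((volume : Measure ℝ).restrict (Ioc b (b + 1))) =
      Measure.map (fun y : UnitAddCircle =>
        ((AddCircle.equivIco (1 : ℝ) 0 y : Ico (0 : ℝ) (0 + 1)) : ℝ)) volume := by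
    intro b
    rw [← (UnitAddCircle.measurePreserving_mk b).map_eq,
      Measure.map_map h2 (UnitAddCircle.measurePreserving_mk b).measurable, ← h1]
    rfl
  rw [h3 a, ← h3 0, zero_add, Measure.restrict_congr_set Ioo_ae_eq_Ioc.symm]
  conv_rhs => rw [← Measure.map_id (μ := (volume : Measure ℝ).restrict (Ioo 0 1))]
  refine Measure.map_congr ?_
  filter_upwards [ae_restrict_mem measurableSet_Ioo] with x hx
  exact Int.fract_eq_self.2 ⟨hx.1.le, hx.2⟩

/-- The centred unit cube. -/
def centredCube (d : ℕ) : Set (Fin d → ℝ) := univ.pi fun _ => Ioc (-(1 / 2) : ℝ) (1 / 2)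

theorem measurableSet_centredCube : MeasurableSet (centredCube d) :=
  MeasurableSet.univ_pi fun _ => measurableSet_Ioc

/-- The symbol vanishes at all corners of the unit cube; by periodicity the whole contribution of
these points is gathered at the origin, where scaling applies. -/
theorem setIntegral_Icc_eq_centredCube {f : (Fin d → ℝ) → ℝ} (hf : Measurable f)
    (hper : ∀ ξ, f (fun j => Int.fract (ξ j)) = f ξ) :
    ∫ ξ in Icc (0 : Fin d → ℝ) 1, f ξ = ∫ ξ in centredCube d, f ξ := by
  have h1 : (volume : Measure (Fin d → ℝ)).restrict (centredCube d) =
      Measure.pi fun _ => (volume : Measure ℝ).restrict (Ioc (-(1 / 2)) (-(1 / 2) + 1)) := by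
    rw [centredCube, volume_pi, Measure.restrict_pi_pi]
    norm_num
  have h2 : ∀ j : Fin d, AEMeasurable Int.fract
      ((volume : Measure ℝ).restrict (Ioc (-(1 / 2)) (-(1 / 2) + 1))) :=
    fun _ => measurable_fract.aemeasurable
  have h3 : (volume : Measure (Fin d → ℝ)).restrict (Icc 0 1) =
      Measure.map (fun ξ j => Int.fract (ξ j)) (volume.restrict (centredCube d)) := by
    rw [h1, Measure.pi_map_pi h2, restrict_Icc_eq_pi]
    simp only [map_fract]
  have h4 : Measurable fun (ξ : Fin d → ℝ) j => Int.fract (ξ j) :=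
    measurable_pi_lambda _ fun j => measurable_fract.comp (measurable_pi_apply j)
  rw [h3, integral_map h4.aemeasurable hf.aestronglyMeasurable]
  simp only [hper]

theorem sin_sq_int_mul_fract (n : ℤ) (x : ℝ) :
    Real.sin (n * Real.pi * Int.fract x) ^ 2 = Real.sin (n * Real.pi * x) ^ 2 := by
  have h : (n : ℝ) * Real.pi * Int.fract x = n * Real.pi * x - ((n * ⌊x⌋ : ℤ) : ℝ) * Real.pi := by
    rw [Int.fract]
    push_cast
    ring
  rw [h, Real.sin_sub_int_mul_pi, mul_pow, ← sq_abs ((-1 : ℝ) ^ _), abs_zpow]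
  simp

theorem symb_fract (ξ : Fin d → ℝ) : symb (fun j => Int.fract (ξ j)) = symb ξ := by
  unfold symb
  refine Finset.sum_congr rfl fun j _ => ?_
  simpa using sin_sq_int_mul_fract 1 (ξ j)

theorem density_fract (α ν : ℝ) (k : Fin d) (ξ : Fin d → ℝ) :
    density α ν k (fun j => Int.fract (ξ j)) = density α ν k ξ := by
  rw [density, density, symb_fract]
  have := sin_sq_int_mul_fract 2 (ξ k)
  push_cast at this
  rw [this]

/-- Jordan's inequality for the sine, coordinate by coordinate. It gives the Gaussian domination on
the centred cube. -/
theorem four_mul_sum_sq_le_symb {ξ : Fin d → ℝ} (hξ : ξ ∈ centredCube d) :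
    4 * ∑ j, ξ j ^ 2 ≤ symb ξ := by
  rw [symb, Finset.mul_sum]
  refine Finset.sum_le_sum fun j _ => ?_
  have h := hξ j (mem_univ j)
  have h1 : |ξ j| ≤ 1 / 2 := abs_le.2 ⟨h.1.le, h.2⟩
  have h2 : |Real.pi * ξ j| ≤ Real.pi / 2 := by
    rw [abs_mul, abs_of_pos Real.pi_pos]
    nlinarith [Real.pi_pos]
  have h3 := Real.mul_abs_le_abs_sin h2
  rw [abs_mul, abs_of_pos Real.pi_pos] at h3
  have h4 : 2 / Real.pi * (Real.pi * |ξ j|) = 2 * |ξ j| := by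
    have := Real.pi_pos.ne'
    field_simp
  rw [h4] at h3
  have h5 := abs_nonneg (ξ j)
  rw [← sq_abs (Real.sin _), ← sq_abs (ξ j)]
  nlinarith

theorem limitCorr_eq_centred (α ν γ : ℝ) (k : Fin d) (t : ℝ) :
    limitCorr α ν γ k t =
      ∫ ξ in centredCube d, density α ν k ξ * Real.exp (-(8 * γ * t * symb ξ)) :=
  setIntegral_Icc_eq_centredCube (measurable_density_mul_exp_right k t)
    fun ξ => by simp only [density_fract, symb_fract]

/-- Diffusive scaling of the limiting correlation. -/
theorem pow_mul_limitCorr_sq (α ν γ : ℝ) (k : Fin d) {r : ℝ} (hr : 0 < r) :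
    r ^ d * limitCorr α ν γ k (r ^ 2) =
      ∫ η : Fin d → ℝ, (centredCube d).indicator (fun ξ => density α ν k ξ *
        Real.exp (-(8 * γ * r ^ 2 * symb ξ))) (r⁻¹ • η) := by
  rw [limitCorr_eq_centred, ← integral_indicator measurableSet_centredCube,
    Measure.integral_comp_smul]
  simp [abs_of_pos hr]

end Fold

/-! ### Laplace asymptotics. -/

section Laplace

variable {d : ℕ} {α ν γ : ℝ}

theorem tendsto_mul_sin_inv (a : ℝ) :
    Tendsto (fun r : ℝ => r * Real.sin (a * r⁻¹)) atTop (𝓝 a) := by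
  have h1 : HasDerivAt (fun x => Real.sin (a * x)) a 0 := by
    have := ((hasDerivAt_id (0 : ℝ)).const_mul a).sin
    simpa using this
  have h2 := (hasDerivAt_iff_tendsto_slope_zero.1 h1).mono_left
    (nhdsWithin_mono _ (fun x (hx : 0 < x) => hx.ne'))
  have h3 := h2.comp tendsto_inv_atTop_nhdsGT_zero
  refine h3.congr fun r => ?_
  simp

theorem tendsto_sq_mul_symb (η : Fin d → ℝ) :
    Tendsto (fun r : ℝ => r ^ 2 * symb (r⁻¹ • η)) atTop (𝓝 (Real.pi ^ 2 * ∑ j, η j ^ 2)) := by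
  simp only [symb, Finset.mul_sum]
  refine tendsto_finsetSum _ fun j _ => ?_
  have h := (tendsto_mul_sin_inv (Real.pi * η j)).pow 2
  rw [mul_pow] at h
  refine h.congr fun r => ?_
  simp only [Pi.smul_apply, smul_eq_mul]
  rw [mul_pow, show Real.pi * η j * r⁻¹ = Real.pi * (r⁻¹ * η j) by ring]

theorem integrable_exp_neg_sum_sq {b : ℝ} (hb : 0 < b) :
    Integrable fun η : Fin d → ℝ => Real.exp (-(b * ∑ j, η j ^ 2)) := by
  have h := Integrable.fintype_prod (f := fun (_ : Fin d) (x : ℝ) => Real.exp (-b * x ^ 2))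
    (μ := fun _ => volume) fun _ => integrable_exp_neg_mul_sq hb
  refine h.congr (Eventually.of_forall fun η => ?_)
  simp only [← Real.exp_sum]
  rw [Finset.mul_sum, ← Finset.sum_neg_distrib]
  congr 1
  exact Finset.sum_congr rfl fun j _ => by ring

/-- Laplace asymptotics of the limiting correlation. -/
theorem exists_tendsto_mul_limitCorr_sq (hα : 0 < α) (hν : 0 ≤ ν) (hγ : 0 < γ) (k : Fin d)
    {p : ℝ → ℝ} (hp : ∀ r, 0 < r → 0 ≤ p r) {A : ℝ}
    (hA : ∀ r, 0 < r → ∀ η : Fin d → ℝ,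
      p r * density α ν k (r⁻¹ • η) ≤ A * Real.exp (16 * γ * ∑ j, η j ^ 2))
    {G : (Fin d → ℝ) → ℝ} (hG0 : ∀ η, 0 ≤ G η) (hGpos : ∀ η, η k ≠ 0 → 0 < G η)
    (hG : ∀ η, η k ≠ 0 → Tendsto (fun r => p r * density α ν k (r⁻¹ • η)) atTop (𝓝 (G η))) :
    ∃ c : ℝ, 0 < c ∧
      Tendsto (fun r : ℝ => p r * (r ^ d * limitCorr α ν γ k (r ^ 2))) atTop (𝓝 c) := by
  set F : ℝ → (Fin d → ℝ) → ℝ := fun r η => (centredCube d).indicator (fun ξ => p r *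
    (density α ν k ξ * Real.exp (-(8 * γ * r ^ 2 * symb ξ)))) (r⁻¹ • η) with hF
  set Φ : (Fin d → ℝ) → ℝ := fun η =>
    G η * Real.exp (-(8 * γ * (Real.pi ^ 2 * ∑ j, η j ^ 2))) with hΦ
  have hae : ∀ᵐ η : Fin d → ℝ, η k ≠ 0 := by
    have : ∀ᵐ x : ℝ, x ≠ 0 := by simp [ae_iff]
    exact (Measure.quasiMeasurePreserving_eval (fun _ : Fin d => (volume : Measure ℝ)) k).ae this
  have hbound : ∀ r, 0 < r → ∀ η, ‖F r η‖ ≤ A * Real.exp (-(16 * γ * ∑ j, η j ^ 2)) := by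
    intro r hr η
    have hA0 : 0 ≤ A := by
      have h1 := hA r hr 0
      have h2 := mul_nonneg (hp r hr) (density_nonneg hα hν k (r⁻¹ • (0 : Fin d → ℝ)))
      simp only [Pi.zero_apply] at h1
      norm_num at h1
      simp only [smul_zero] at h2
      linarith
    by_cases hη : r⁻¹ • η ∈ centredCube d
    · have h1 := four_mul_sum_sq_le_symb hη
      simp only [Pi.smul_apply, smul_eq_mul, mul_pow, ← Finset.mul_sum] at h1
      have h2 : 4 * ∑ j, η j ^ 2 ≤ r ^ 2 * symb (r⁻¹ • η) := by
        calc _ = r ^ 2 * (4 * (r⁻¹ ^ 2 * ∑ j, η j ^ 2)) := by field_simp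
          _ ≤ _ := by gcongr
      have h3 := density_mul_exp_nonneg (γ := γ) hα hν k (r ^ 2) (r⁻¹ • η)
      rw [hF]
      simp only [indicator_of_mem hη]
      rw [Real.norm_of_nonneg (mul_nonneg (hp r hr) h3), ← mul_assoc]
      -- The factor 4 from Jordan's inequality makes the rate `32γ`; half of it pays for the growth
      -- allowed in `hA`, and the other half remains integrable.
      have h4 : Real.exp (-(8 * γ * r ^ 2 * symb (r⁻¹ • η))) ≤
          Real.exp (-(32 * γ * ∑ j, η j ^ 2)) := by
        refine Real.exp_le_exp.2 ?_
        nlinarith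
      calc _ ≤ (A * Real.exp (16 * γ * ∑ j, η j ^ 2)) * Real.exp (-(32 * γ * ∑ j, η j ^ 2)) :=
            mul_le_mul (hA r hr η) h4 (Real.exp_pos _).le (by positivity)
        _ = _ := by
            rw [mul_assoc, ← Real.exp_add]
            congr 2
            ring
    · rw [hF]
      simp only [indicator_of_notMem hη]
      rw [norm_zero]
      positivity
  have hlim : ∀ η : Fin d → ℝ, η k ≠ 0 → Tendsto (fun r => F r η) atTop (𝓝 (Φ η)) := by
    intro η hη
    have h1 : ∀ᶠ r : ℝ in atTop, r⁻¹ • η ∈ centredCube d := by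
      have h2 : Tendsto (fun r : ℝ => r⁻¹ • η) atTop (𝓝 ((0 : ℝ) • η)) :=
        tendsto_inv_atTop_zero.smul_const η
      rw [zero_smul] at h2
      refine h2.eventually (mem_of_superset (set_pi_mem_nhds finite_univ fun j _ =>
        Ioo_mem_nhds (a := -(1 / 2 : ℝ)) (b := 1 / 2) ?_ ?_) ?_)
      · norm_num
      · norm_num
      · exact pi_mono fun j _ => Ioo_subset_Ioc_self
    have h2 : Tendsto (fun r : ℝ => p r * density α ν k (r⁻¹ • η) *
        Real.exp (-(8 * γ * (r ^ 2 * symb (r⁻¹ • η))))) atTop (𝓝 (Φ η)) :=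
      (hG η hη).mul ((Real.continuous_exp.tendsto _).comp
        ((tendsto_sq_mul_symb η).const_mul (8 * γ)).neg)
    refine h2.congr' ?_
    filter_upwards [h1] with r hr
    rw [hF]
    simp only [indicator_of_mem hr]
    rw [mul_assoc, mul_assoc (8 * γ)]
  have hmeas : ∀ r, AEStronglyMeasurable (F r) volume := by
    intro r
    refine Measurable.aestronglyMeasurable ?_
    exact (((measurable_density_mul_exp_right k (r ^ 2)).const_mul (p r)).indicator measurableSet_centredCube).comp
      (measurable_const_smul r⁻¹)
  have hint : Integrable fun η : Fin d → ℝ => A * Real.exp (-(16 * γ * ∑ j, η j ^ 2)) :=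
    (integrable_exp_neg_sum_sq (by positivity)).const_mul A
  have hmain := tendsto_integral_filter_of_dominated_convergence (l := atTop) (F := F) (f := Φ)
    (μ := volume) _ (Eventually.of_forall hmeas)
    ((eventually_gt_atTop 0).mono fun r hr => Eventually.of_forall (hbound r hr)) hint
    (hae.mono hlim)
  refine ⟨∫ η, Φ η, ?_, hmain.congr' ?_⟩
  · have hΦm : AEStronglyMeasurable Φ volume :=
      aestronglyMeasurable_of_tendsto_ae atTop hmeas (hae.mono hlim)
    have hΦi : Integrable Φ := by
      refine hint.mono' hΦm (hae.mono fun η hη => ?_)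
      exact le_of_tendsto (hlim η hη).norm
        ((eventually_gt_atTop 0).mono fun r hr => hbound r hr η)
    rw [integral_pos_iff_support_of_nonneg
      (fun η => mul_nonneg (hG0 η) (Real.exp_pos _).le) hΦi]
    have h1 : IsOpen {η : Fin d → ℝ | η k ≠ 0} :=
      isOpen_ne_fun (continuous_apply k) continuous_const
    refine (h1.measure_pos volume ⟨fun _ => 1, one_ne_zero⟩).trans_le (measure_mono fun η hη => ?_)
    exact (mul_pos (hGpos η hη) (Real.exp_pos _)).ne'
  · filter_upwards [eventually_gt_atTop 0] with r hr
    rw [pow_mul_limitCorr_sq α ν γ k hr, ← integral_const_mul]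
    refine integral_congr_ae (Eventually.of_forall fun η => ?_)
    rw [hF]
    by_cases h : r⁻¹ • η ∈ centredCube d <;> simp [h]

/-- Numerator and denominator of the density both vanish to second order at the origin, so no extra
normalization is needed and the limit is homogeneous of degree zero. -/
theorem exists_tendsto_limitCorr_unpinned (hα : 0 < α) (hγ : 0 < γ) (k : Fin d) :
    ∃ c : ℝ, 0 < c ∧
      Tendsto (fun r : ℝ => 1 * (r ^ d * limitCorr α 0 γ k (r ^ 2))) atTop (𝓝 c) := by
  refine exists_tendsto_mul_limitCorr_sq (p := fun _ => 1) (A := 2 * α)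
    (G := fun η => 2 * α * η k ^ 2 / ∑ j, η j ^ 2) hα le_rfl hγ k (fun _ _ => zero_le_one)
    (fun r _ η => ?_) (fun η => by positivity) (fun η hη => ?_) fun η hη => ?_
  · rw [one_mul]
    have h1 : 1 ≤ Real.exp (16 * γ * ∑ j, η j ^ 2) := Real.one_le_exp (by positivity)
    have h2 := density_le hα le_rfl k (r⁻¹ • η)
    nlinarith
  · have h1 : η k ^ 2 ≤ ∑ j, η j ^ 2 :=
      Finset.single_le_sum (f := fun j => η j ^ 2) (fun _ _ => sq_nonneg _) (Finset.mem_univ k)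
    have h2 : 0 < η k ^ 2 := by positivity
    have h3 : 0 < ∑ j, η j ^ 2 := h2.trans_le h1
    positivity
  · have h1 : η k ^ 2 ≤ ∑ j, η j ^ 2 :=
      Finset.single_le_sum (f := fun j => η j ^ 2) (fun _ _ => sq_nonneg _) (Finset.mem_univ k)
    have h2 : 0 < η k ^ 2 := by positivity
    have h3 : 0 < ∑ j, η j ^ 2 := h2.trans_le h1
    have h4 := ((tendsto_mul_sin_inv (2 * Real.pi * η k)).pow 2).const_mul (2 * α ^ 2)
    have h5 := (tendsto_sq_mul_symb η).const_mul (4 * α)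
    have h6 := h4.div h5 (by have := Real.pi_pos; positivity)
    have h7 : 2 * α ^ 2 * (2 * Real.pi * η k) ^ 2 / (4 * α * (Real.pi ^ 2 * ∑ j, η j ^ 2)) =
        2 * α * η k ^ 2 / ∑ j, η j ^ 2 := by
      have := Real.pi_pos
      field_simp
      ring
    rw [h7] at h6
    refine h6.congr' ?_
    filter_upwards [eventually_gt_atTop 0] with r hr
    simp only [density, one_mul, zero_add, Pi.smul_apply, smul_eq_mul, Pi.div_apply]
    rw [show 2 * Real.pi * η k * r⁻¹ = 2 * Real.pi * (r⁻¹ * η k) by ring,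
      show 2 * α ^ 2 * (r * Real.sin (2 * Real.pi * (r⁻¹ * η k))) ^ 2 =
        r ^ 2 * (2 * α ^ 2 * Real.sin (2 * Real.pi * (r⁻¹ * η k)) ^ 2) by ring,
      show 4 * α * (r ^ 2 * symb (r⁻¹ • η)) = r ^ 2 * (4 * α * symb (r⁻¹ • η)) by ring,
      mul_div_mul_left _ _ (by positivity)]

/-- The denominator now tends to `ν`, while the numerator still vanishes to second order; the factor
`r ^ 2` compensates. -/
theorem exists_tendsto_limitCorr_pinned (hα : 0 < α) (hν : 0 < ν) (hγ : 0 < γ) (k : Fin d) :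
    ∃ c : ℝ, 0 < c ∧
      Tendsto (fun r : ℝ => r ^ 2 * (r ^ d * limitCorr α ν γ k (r ^ 2))) atTop (𝓝 c) := by
  have hπ := Real.pi_pos
  refine exists_tendsto_mul_limitCorr_sq (p := fun r => r ^ 2)
    -- The rescaled density grows quadratically in `η`; the growth is absorbed through `x ≤ exp x`
    -- with `x = 16γ|η|²`, hence the division by `16γ`.
    (A := 2 * α ^ 2 * (2 * Real.pi) ^ 2 / ν / (16 * γ))
    (G := fun η => 2 * α ^ 2 * (2 * Real.pi * η k) ^ 2 / ν) hα hν.le hγ k (fun _ _ => sq_nonneg _)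
    (fun r hr η => ?_) (fun η => by positivity) (fun η hη => by positivity) fun η hη => ?_
  · have h0 := symb_nonneg (r⁻¹ • η)
    have h1 : Real.sin (2 * Real.pi * (r⁻¹ • η) k) ^ 2 ≤ (2 * Real.pi) ^ 2 * (r⁻¹ * η k) ^ 2 := by
      rw [← mul_pow, Pi.smul_apply, smul_eq_mul]
      exact sq_le_sq.2 Real.abs_sin_le_abs
    have h2 : η k ^ 2 ≤ ∑ j, η j ^ 2 :=
      Finset.single_le_sum (f := fun j => η j ^ 2) (fun _ _ => sq_nonneg _) (Finset.mem_univ k)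
    have h3 : 16 * γ * ∑ j, η j ^ 2 ≤ Real.exp (16 * γ * ∑ j, η j ^ 2) := by
      linarith [Real.add_one_le_exp (16 * γ * ∑ j, η j ^ 2)]
    have h4 : density α ν k (r⁻¹ • η) ≤
        2 * α ^ 2 * ((2 * Real.pi) ^ 2 * (r⁻¹ * η k) ^ 2) / ν := by
      rw [density]
      gcongr
      have : 0 ≤ 4 * α * symb (r⁻¹ • η) := by positivity
      linarith
    calc r ^ 2 * density α ν k (r⁻¹ • η)
        ≤ r ^ 2 * (2 * α ^ 2 * ((2 * Real.pi) ^ 2 * (r⁻¹ * η k) ^ 2) / ν) := by gcongr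
      _ = 2 * α ^ 2 * (2 * Real.pi) ^ 2 / ν / (16 * γ) * (16 * γ * η k ^ 2) := by field_simp
      _ ≤ 2 * α ^ 2 * (2 * Real.pi) ^ 2 / ν / (16 * γ) * (16 * γ * ∑ j, η j ^ 2) := by gcongr
      _ ≤ _ := by gcongr
  · have h4 := ((tendsto_mul_sin_inv (2 * Real.pi * η k)).pow 2).const_mul (2 * α ^ 2)
    have h5 : Tendsto (fun r : ℝ => ν + 4 * α * symb (r⁻¹ • η)) atTop (𝓝 ν) := by
      have h2 : Tendsto (fun r : ℝ => r⁻¹ • η) atTop (𝓝 ((0 : ℝ) • η)) :=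
        tendsto_inv_atTop_zero.smul_const η
      have h3 := (((continuous_symb.tendsto _).comp h2).const_mul (4 * α)).const_add ν
      simpa [symb] using h3
    refine (h4.div h5 hν.ne').congr fun r => ?_
    simp only [density, Pi.smul_apply, smul_eq_mul, Pi.div_apply]
    rw [show 2 * Real.pi * η k * r⁻¹ = 2 * Real.pi * (r⁻¹ * η k) by ring]
    ring

end Laplace

/-! ### Time integrals of functions with power decay. -/

section Decay

theorem isEquivalent_of_tendsto_rpow_mul {f : ℝ → ℝ} {a c : ℝ} (hc : 0 < c)
    (h : Tendsto (fun t => t ^ a * f t) atTop (𝓝 c)) :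
    Asymptotics.IsEquivalent atTop f fun t => c * t ^ (-a) := by
  refine Asymptotics.isEquivalent_of_tendsto_one ?_
  have h1 := h.div_const c
  rw [div_self hc.ne'] at h1
  refine h1.congr' ?_
  filter_upwards [eventually_gt_atTop 0] with t ht
  have := Real.rpow_pos_of_pos ht a
  rw [Pi.div_apply, Real.rpow_neg ht.le]
  field_simp

/-- Beyond some time `f` lies between `c/2` and `2c` times `t ^ (-a)`, and before that it is
bounded, so its integrability is that of the power. -/
theorem lintegral_Ioi_ne_top_iff {f : ℝ → ℝ} (hf : Measurable f) (hf0 : ∀ t, 0 ≤ f t) {B : ℝ}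
    (hB : ∀ t, 0 ≤ t → f t ≤ B) {a c : ℝ} (hc : 0 < c)
    (h : Tendsto (fun t => t ^ a * f t) atTop (𝓝 c)) :
    ∫⁻ t in Ioi (0 : ℝ), ENNReal.ofReal (f t) ≠ ⊤ ↔ 1 < a := by
  obtain ⟨t₀, ht₀⟩ := eventually_atTop.1 ((h.eventually_const_lt (half_lt_self hc)).and
    ((h.eventually_lt_const (show c < 2 * c by linarith)).and (eventually_gt_atTop 0)))
  have hpos : 0 < t₀ := (ht₀ t₀ le_rfl).2.2
  rw [lintegral_ofReal_ne_top_iff_integrable hf.aestronglyMeasurable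
    (Eventually.of_forall hf0)]
  have hiff := integrableOn_Ioi_rpow_iff (s := -a) hpos
  rw [neg_lt_neg_iff] at hiff
  rw [← hiff]
  have hbd : ∀ t ∈ Ioi t₀, c / 2 * t ^ (-a) ≤ f t ∧ f t ≤ 2 * c * t ^ (-a) := by
    intro t ht
    obtain ⟨h1, h2, h3⟩ := ht₀ t (le_of_lt ht)
    have h4 := Real.rpow_pos_of_pos h3 a
    rw [Real.rpow_neg h3.le, ← div_eq_mul_inv, ← div_eq_mul_inv, div_le_iff₀ h4, le_div_iff₀ h4]
    exact ⟨by linarith, by linarith⟩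
  constructor
  · intro hi
    have h1 : IntegrableOn f (Ioi t₀) := IntegrableOn.mono_set hi (Ioi_subset_Ioi hpos.le)
    refine (h1.const_mul (2 / c)).mono' ?_ ((ae_restrict_iff' measurableSet_Ioi).2
      (Eventually.of_forall fun t ht => ?_))
    · exact (measurable_id.pow_const (-a)).aestronglyMeasurable
    · have h2 := (hbd t ht).1
      rw [Real.norm_of_nonneg (Real.rpow_nonneg (hpos.trans ht).le _)]
      calc t ^ (-a) = 2 / c * (c / 2 * t ^ (-a)) := by field_simp
        _ ≤ _ := by gcongr
  · intro hi
    rw [← Ioc_union_Ioi_eq_Ioi hpos.le]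
    refine IntegrableOn.union ?_ ?_
    · refine Measure.integrableOn_of_bounded (M := B) (by simp) hf.aestronglyMeasurable
        ((ae_restrict_iff' measurableSet_Ioc).2 (Eventually.of_forall fun t ht => ?_))
      rw [Real.norm_of_nonneg (hf0 t)]
      exact hB t ht.1.le
    · refine (hi.const_mul (2 * c)).mono' hf.aestronglyMeasurable
        ((ae_restrict_iff' measurableSet_Ioi).2 (Eventually.of_forall fun t ht => ?_))
      rw [Real.norm_of_nonneg (hf0 t)]
      exact (hbd t ht).2

/-- Cesàro type truncation of an integral over the half line. -/
theorem tendsto_integral_one_sub_div {f : ℝ → ℝ} (hf : Measurable f) (hf0 : ∀ t, 0 ≤ f t) {B : ℝ}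
    (hB : ∀ t, 0 ≤ t → f t ≤ B) :
    Tendsto (fun t : ℝ => ((∫ h in (0 : ℝ)..t, (1 - h / t) * f h : ℝ) : EReal)) atTop
      (𝓝 ((∫⁻ h in Ioi (0 : ℝ), ENNReal.ofReal (f h) : ENNReal) : EReal)) := by
  -- Replacing `t` by `max t 1` makes the truncation monotone on the whole line without changing it
  -- for large `t`.
  set G : ℝ → ENNReal := fun t =>
    ∫⁻ h in Ioi (0 : ℝ), ENNReal.ofReal (max (1 - h / max t 1) 0 * f h) with hG
  have hm : ∀ t : ℝ, Measurable fun h => max (1 - h / max t 1) 0 * f h := fun t => by fun_prop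
  have hmono : ∀ h : ℝ, 0 < h → Monotone fun t : ℝ =>
      ENNReal.ofReal (max (1 - h / max t 1) 0 * f h) := by
    intro h hh s t hst
    refine ENNReal.ofReal_le_ofReal (mul_le_mul_of_nonneg_right ?_ (hf0 h))
    have h1 : (0 : ℝ) < max s 1 := lt_max_of_lt_right one_pos
    gcongr
  have hGmono : Monotone G := fun s t hst =>
    setLIntegral_mono' measurableSet_Ioi fun h hh => hmono h hh hst
  have hlim : ∀ h : ℝ, Tendsto (fun t : ℝ => ENNReal.ofReal (max (1 - h / max t 1) 0 * f h)) atTop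
      (𝓝 (ENNReal.ofReal (f h))) := by
    intro h
    have h1 : Tendsto (fun t : ℝ => h / max t 1) atTop (𝓝 0) :=
      Tendsto.div_atTop tendsto_const_nhds
        (tendsto_atTop_mono (fun t => le_max_left t 1) tendsto_id)
    have h2 := ((h1.const_sub 1).max (tendsto_const_nhds (x := (0 : ℝ)))).mul_const (f h)
    simp only [sub_zero, zero_le_one, sup_of_le_left, one_mul] at h2
    exact ENNReal.tendsto_ofReal h2
  have hseq : Tendsto (fun n : ℕ => G n) atTop
      (𝓝 (∫⁻ h in Ioi (0 : ℝ), ENNReal.ofReal (f h))) := by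
    refine lintegral_tendsto_of_tendsto_of_monotone
      (fun n => (hm n).ennreal_ofReal.aemeasurable) ?_
      (Eventually.of_forall fun h => (hlim h).comp tendsto_natCast_atTop_atTop)
    refine (ae_restrict_iff' measurableSet_Ioi).2 (Eventually.of_forall fun h hh => ?_)
    exact (hmono h hh).comp Nat.mono_cast
  -- Monotone convergence applies along the integers; monotonicity of `G` extends the limit to real
  -- times.
  have hGt : Tendsto G atTop (𝓝 (∫⁻ h in Ioi (0 : ℝ), ENNReal.ofReal (f h))) := by
    have h1 := tendsto_atTop_iSup hGmono
    rwa [tendsto_nhds_unique hseq (h1.comp tendsto_natCast_atTop_atTop)]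
  refine ((continuous_coe_ennreal_ereal.tendsto _).comp hGt).congr' ?_
  filter_upwards [eventually_ge_atTop 1] with t ht
  have ht0 : 0 < t := one_pos.trans_le ht
  simp only [Function.comp, hG, max_eq_left ht]
  have hmt := hm t
  rw [max_eq_left ht] at hmt
  rw [← setIntegral_max_mul ht0, integral_eq_lintegral_of_nonneg_ae
    (Eventually.of_forall fun h => mul_nonneg (le_max_right _ _) (hf0 h)) hmt.aestronglyMeasurable,
    EReal.coe_ennreal_toReal]
  refine ne_of_lt (lt_of_le_of_lt (setLIntegral_mono' (g := (Iic t).indicator fun _ =>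
    ENNReal.ofReal B) measurableSet_Ioi fun h hh => ?_) ?_)
  · have h0 : (0 : ℝ) < h := hh
    by_cases hht : h ≤ t
    · rw [indicator_of_mem (mem_Iic.2 hht)]
      refine ENNReal.ofReal_le_ofReal ?_
      have h1 : max (1 - h / t) 0 ≤ 1 := max_le (by have := div_nonneg h0.le ht0.le; linarith)
        zero_le_one
      calc _ ≤ 1 * B := mul_le_mul h1 (hB h h0.le) (hf0 h) one_pos.le
        _ = B := one_mul B
    · have h1 : 1 - h / t ≤ 0 := sub_nonpos.2 ((one_le_div ht0).2 (not_le.1 hht).le)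
      simp [max_eq_right h1]
  · rw [lintegral_indicator measurableSet_Iic, Measure.restrict_restrict measurableSet_Iic,
      setLIntegral_const, Iic_inter_Ioi]
    exact ENNReal.mul_lt_top ENNReal.ofReal_lt_top (by simp)

end Decay

/-! ### Decay exponent and value of the conductivity. -/

section Conductivity

variable {d : ℕ} {α ν γ : ℝ}

/-- The exponent of the polynomial decay of the current correlations. -/
def decayExponent (d : ℕ) (ν : ℝ) : ℝ := (d : ℝ) / 2 + if ν = 0 then 0 else 1

/-- The substitution `r = √t` in the scaling limits puts both regimes into one power law. -/
theorem exists_tendsto_rpow_mul_limitCorr (hα : 0 < α) (hν : 0 ≤ ν) (hγ : 0 < γ) (k : Fin d) :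
    ∃ c : ℝ, 0 < c ∧
      Tendsto (fun t : ℝ => t ^ decayExponent d ν * limitCorr α ν γ k t) atTop (𝓝 c) := by
  have hsqrt : ∀ t : ℝ, 0 < t → √t ^ d = t ^ ((d : ℝ) / 2) := fun t ht => by
    rw [Real.rpow_div_two_eq_sqrt _ ht.le, Real.rpow_natCast]
  rcases hν.eq_or_lt with rfl | hν
  · obtain ⟨c, hc, h⟩ := exists_tendsto_limitCorr_unpinned hα hγ k
    refine ⟨c, hc, (h.comp Real.tendsto_sqrt_atTop).congr' ?_⟩
    filter_upwards [eventually_gt_atTop 0] with t ht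
    simp [decayExponent, hsqrt t ht, Real.sq_sqrt ht.le]
  · obtain ⟨c, hc, h⟩ := exists_tendsto_limitCorr_pinned hα hν hγ k
    refine ⟨c, hc, (h.comp Real.tendsto_sqrt_atTop).congr' ?_⟩
    filter_upwards [eventually_gt_atTop 0] with t ht
    simp only [decayExponent, Function.comp, hsqrt t ht, Real.sq_sqrt ht.le, hν.ne', if_false]
    rw [Real.rpow_add ht, Real.rpow_one]
    ring

/-- The integrand of the Green-Kubo formula. -/
def conductivityDensity (α ν : ℝ) (k : Fin d) (ξ : Fin d → ℝ) : ℝ :=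
  Real.sin (2 * Real.pi * ξ k) ^ 2 / ((ν + 4 * α * symb ξ) * symb ξ)

theorem conductivityDensity_nonneg (hα : 0 < α) (hν : 0 ≤ ν) (k : Fin d) (ξ : Fin d → ℝ) :
    0 ≤ conductivityDensity α ν k ξ := by
  have := symb_nonneg ξ
  unfold conductivityDensity
  positivity

theorem measurable_conductivityDensity (k : Fin d) : Measurable (conductivityDensity α ν k) := by
  have := (continuous_symb (d := d)).measurable
  unfold conductivityDensity
  fun_prop

theorem lintegral_exp_neg_mul_Ioi {b : ℝ} (hb : 0 < b) :
    ∫⁻ t in Ioi (0 : ℝ), ENNReal.ofReal (Real.exp (-(b * t))) = ENNReal.ofReal b⁻¹ := by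
  have h1 : IntegrableOn (fun t => Real.exp (-b * t)) (Ioi 0) :=
    integrableOn_exp_mul_Ioi (neg_lt_zero.2 hb) 0
  have h2 := integral_exp_mul_Ioi (neg_lt_zero.2 hb) 0
  simp only [← neg_mul]
  rw [← ofReal_integral_eq_lintegral_ofReal h1 (Eventually.of_forall fun t => (Real.exp_pos _).le),
    h2]
  simp

/-- Tonelli, then the time integral of the exponential is `1 / (8γS)`. As an identity in `[0, ∞]` it
needs no prior integrability and later transfers finiteness from time to frequency. -/
theorem lintegral_limitCorr [NeZero d] (hα : 0 < α) (hν : 0 ≤ ν) (hγ : 0 < γ) (k : Fin d) :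
    ∫⁻ t in Ioi (0 : ℝ), ENNReal.ofReal (limitCorr α ν γ k t) =
      ∫⁻ ξ in Icc (0 : Fin d → ℝ) 1,
        ENNReal.ofReal (α ^ 2 / (4 * γ) * conductivityDensity α ν k ξ) := by
  have h1 : ∀ t ∈ Ioi (0 : ℝ), ENNReal.ofReal (limitCorr α ν γ k t) =
      ∫⁻ ξ in Icc (0 : Fin d → ℝ) 1,
        ENNReal.ofReal (density α ν k ξ * Real.exp (-(8 * γ * t * symb ξ))) := fun t ht =>
    ofReal_integral_eq_lintegral_ofReal (integrable_density_mul_exp hα hν hγ k (le_of_lt ht))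
      (Eventually.of_forall fun ξ => density_mul_exp_nonneg hα hν k t ξ)
  rw [setLIntegral_congr_fun measurableSet_Ioi h1, lintegral_lintegral_swap]
  · refine lintegral_congr_ae ?_
    filter_upwards [ae_mem_Ioo] with ξ hξ
    have hs := symb_pos hξ
    simp only [ENNReal.ofReal_mul (density_nonneg hα hν k ξ)]
    have h2 : ∀ t, -(8 * γ * t * symb ξ) = -(8 * γ * symb ξ * t) := fun t => by ring
    simp only [h2]
    rw [lintegral_const_mul _ (by fun_prop), lintegral_exp_neg_mul_Ioi (by positivity),
      ← ENNReal.ofReal_mul (density_nonneg hα hν k ξ), density, conductivityDensity]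
    congr 1
    have h3 : 0 < ν + 4 * α * symb ξ := by positivity
    field_simp
    ring
  · exact (measurable_density_mul_exp k).ennreal_ofReal.aemeasurable

end Conductivity

end ExchangeChain

end

/-! ### Assembly of the theorem. -/

/-- Current correlations and Green-Kubo conductivity of the harmonic chain with momentum
exchange noise. -/
theorem mainTheorem3 (d : ℕ) [NeZero d] (k : Fin d) (α ν γ : ℝ)
    (hα : 0 < α) (hν : 0 ≤ ν) (hγ : 0 < γ) :
    -- the equilibrium measure and all the expectations are well defined
    (∀ T : ℝ, 0 < T → ∀ (N : ℕ) [NeZero N],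
      IsProbabilityMeasure (ExchangeChain.gibbs d N α ν T) ∧
      ∀ t : ℝ, 0 ≤ t →
        (∀ x : ExchangeChain.Site d N,
          Integrable (fun z => ExchangeChain.currentAt α ν γ k 0 0 z *
              ExchangeChain.currentAt α ν γ k x t z) (ExchangeChain.equilibrium d N α ν T) ∧
          IntervalIntegrable (ExchangeChain.correlation d N α ν γ T k x) volume 0 t ∧
          ∀ᵐ z ∂(ExchangeChain.equilibrium d N α ν T),
            IntervalIntegrable (fun s => ExchangeChain.currentAt α ν γ k x s z) volume 0 t) ∧
        Integrable (fun z => (∑ x : ExchangeChain.Site d N,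
            ∫ s in (0 : ℝ)..t, ExchangeChain.currentAt α ν γ k x s z) ^ 2)
          (ExchangeChain.equilibrium d N α ν T)) ∧
    -- existence, explicit value and decay of the limiting correlation function
    (∀ T : ℝ, 0 < T → ∃ C : ℝ → ℝ,
      (∀ t : ℝ, 0 ≤ t → Tendsto (fun N : ℕ => ∑ x : ExchangeChain.Site d (N + 1),
        ExchangeChain.correlation d (N + 1) α ν γ T k x t) atTop (𝓝 (C t))) ∧
      (∀ t : ℝ, 0 ≤ t → C t = T ^ 2 * ∫ ξ in Icc (0 : Fin d → ℝ) 1,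
        2 * α ^ 2 * Real.sin (2 * Real.pi * ξ k) ^ 2 /
            (ν + 4 * α * ∑ j, Real.sin (Real.pi * ξ j) ^ 2) *
          Real.exp (-(8 * γ * t * ∑ j, Real.sin (Real.pi * ξ j) ^ 2))) ∧
      (ν = 0 → ∃ c : ℝ, 0 < c ∧
        Asymptotics.IsEquivalent atTop C (fun t => c * t ^ (-(d : ℝ) / 2))) ∧
      (0 < ν → ∃ c : ℝ, 0 < c ∧
        Asymptotics.IsEquivalent atTop C (fun t => c * t ^ (-(d : ℝ) / 2 - 1)))) ∧
    -- existence in `(0, ∞]`, finiteness, independence of `T` and value of the conductivity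
    (∃ κ : EReal, 0 < κ ∧
      (∀ T : ℝ, 0 < T → ∃ K : ℝ → ℝ,
        (∀ t : ℝ, 0 < t →
          Tendsto (fun N : ℕ => ExchangeChain.greenKuboVariance d (N + 1) α ν γ T k t)
            atTop (𝓝 (K t)) ∧
          Tendsto (fun N : ℕ => ExchangeChain.greenKuboCorrelation d (N + 1) α ν γ T k t)
            atTop (𝓝 (K t))) ∧
        Tendsto (fun t => (K t : EReal)) atTop (𝓝 κ)) ∧
      (κ ≠ ⊤ ↔ 3 ≤ d ∨ 0 < ν) ∧
      (κ ≠ ⊤ →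
        IntegrableOn (fun ξ : Fin d → ℝ => Real.sin (2 * Real.pi * ξ k) ^ 2 /
          ((ν + 4 * α * ∑ j, Real.sin (Real.pi * ξ j) ^ 2) *
            ∑ j, Real.sin (Real.pi * ξ j) ^ 2)) (Icc 0 1) ∧
        κ = ((γ + α ^ 2 / (4 * γ) * ∫ ξ in Icc (0 : Fin d → ℝ) 1,
          Real.sin (2 * Real.pi * ξ k) ^ 2 /
            ((ν + 4 * α * ∑ j, Real.sin (Real.pi * ξ j) ^ 2) *
              ∑ j, Real.sin (Real.pi * ξ j) ^ 2) : ℝ) : EReal))) := by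
  refine ⟨fun T hT N _ => ⟨ExchangeChain.isProbabilityMeasure_gibbs hα hν hT, fun t ht =>
    ⟨fun x => ⟨ExchangeChain.integrable_currentAt_mul hα hν hT k 0 x 0 t,
      ExchangeChain.intervalIntegrable_correlation hα hν hT k x 0 t,
      Eventually.of_forall fun z => ExchangeChain.intervalIntegrable_currentAt hα hν k x z 0 t⟩,
      ExchangeChain.integrable_sq_sum_integral hα hν hT ht k⟩⟩, fun T hT => ?_, ?_⟩
  · obtain ⟨c, hc, hlim⟩ := ExchangeChain.exists_tendsto_rpow_mul_limitCorr hα hν hγ k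
    have hequiv : Asymptotics.IsEquivalent atTop
        (fun t => T ^ 2 * ExchangeChain.limitCorr α ν γ k t)
        fun t => T ^ 2 * c * t ^ (-ExchangeChain.decayExponent d ν) := by
      refine ExchangeChain.isEquivalent_of_tendsto_rpow_mul (by positivity) ?_
      simpa only [mul_left_comm] using hlim.const_mul (T ^ 2)
    refine ⟨fun t => T ^ 2 * ExchangeChain.limitCorr α ν γ k t, fun t ht => ?_, fun t ht => rfl,
      fun hν0 => ⟨T ^ 2 * c, by positivity, ?_⟩, fun hν0 => ⟨T ^ 2 * c, by positivity, ?_⟩⟩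
    · simp only [ExchangeChain.sum_correlation hα hν hγ hT k ht]
      exact (ExchangeChain.tendsto_spectralSum hα hν hγ k ht).const_mul _
    · rwa [ExchangeChain.decayExponent, if_pos hν0, add_zero, ← neg_div] at hequiv
    · rwa [ExchangeChain.decayExponent, if_neg hν0.ne', neg_add, ← neg_div, ← sub_eq_add_neg]
        at hequiv
  · obtain ⟨c, hc, hlim⟩ := ExchangeChain.exists_tendsto_rpow_mul_limitCorr hα hν hγ k
    have hmeas := ExchangeChain.measurable_limitCorr (α := α) (ν := ν) (γ := γ) k
    have hnonneg := ExchangeChain.limitCorr_nonneg (γ := γ) hα hν k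
    have hle : ∀ t, 0 ≤ t → ExchangeChain.limitCorr α ν γ k t ≤ 2 * α :=
      fun t ht => ExchangeChain.limitCorr_le hα hν hγ k ht
    -- Keeping the time integral in `[0, ∞]` treats the finite and the divergent cases together.
    -- Neither `L` nor the function taken for `K` below involves `T`.
    set L : ENNReal := ∫⁻ t in Ioi (0 : ℝ), ENNReal.ofReal (ExchangeChain.limitCorr α ν γ k t)
      with hL
    have htop : ((γ : EReal) + (L : EReal)) ≠ ⊤ ↔ L ≠ ⊤ := by
      rw [not_iff_not]
      constructor
      · intro h
        by_contra hne
        refine EReal.coe_ne_top (γ + L.toReal) ?_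
        rw [EReal.coe_add, EReal.coe_ennreal_toReal hne, h]
      · intro h
        rw [h]
        exact EReal.coe_add_top γ
    refine ⟨(γ : EReal) + (L : EReal), ?_, fun T hT =>
      ⟨fun t => γ + ∫ h in (0 : ℝ)..t, (1 - h / t) * ExchangeChain.limitCorr α ν γ k h,
        fun t ht => ⟨?_, ?_⟩, ?_⟩, ?_, fun hκ => ?_⟩
    · exact (EReal.coe_pos.2 hγ).trans_le (le_add_of_nonneg_right (EReal.coe_ennreal_nonneg L))
    · simp only [ExchangeChain.greenKuboVariance_eq hα hν hγ hT ht]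
      exact ExchangeChain.tendsto_integral_spectralSum hα hν hγ k ht
    · simp only [ExchangeChain.greenKuboCorrelation_eq hα hν hγ hT ht]
      exact ExchangeChain.tendsto_integral_spectralSum hα hν hγ k ht
    · simp only [EReal.coe_add]
      have h1 := ExchangeChain.tendsto_integral_one_sub_div hmeas hnonneg hle
      exact (EReal.continuousAt_add (Or.inl (EReal.coe_ne_top γ))
        (Or.inl (EReal.coe_ne_bot γ))).tendsto.comp (tendsto_const_nhds.prodMk_nhds h1)
    · rw [htop, hL, ExchangeChain.lintegral_Ioi_ne_top_iff hmeas hnonneg hle hc hlim,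
        ExchangeChain.decayExponent]
      have hd : (1 : ℝ) ≤ d := Nat.one_le_cast.2 (NeZero.one_le)
      rcases hν.eq_or_lt with h | h
      · rw [if_pos h.symm, add_zero, lt_div_iff₀ two_pos, one_mul, or_iff_left h.not_lt]
        -- The exponent `d / 2` exceeds 1 exactly when `2 < d`, which for natural numbers is `3 ≤
        -- d`.
        exact_mod_cast Iff.rfl
      · rw [if_neg h.ne']
        exact iff_of_true (by linarith) (Or.inr h)
    · have hA : 0 < α ^ 2 / (4 * γ) := by positivity
      have hf := ExchangeChain.measurable_conductivityDensity (α := α) (ν := ν) k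
      have hf0 : ∀ ξ, 0 ≤ α ^ 2 / (4 * γ) * ExchangeChain.conductivityDensity α ν k ξ :=
        fun ξ => mul_nonneg hA.le (ExchangeChain.conductivityDensity_nonneg hα hν k ξ)
      have h1 := htop.1 hκ
      rw [hL, ExchangeChain.lintegral_limitCorr hα hν hγ k,
        lintegral_ofReal_ne_top_iff_integrable (hf.const_mul _).aestronglyMeasurable
          (Eventually.of_forall hf0)] at h1
      have h2 : IntegrableOn (ExchangeChain.conductivityDensity α ν k) (Icc 0 1) := by
        refine (h1.const_mul (α ^ 2 / (4 * γ))⁻¹).congr (Eventually.of_forall fun ξ => ?_)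
        exact inv_mul_cancel_left₀ hA.ne' _
      refine ⟨h2, ?_⟩
      rw [hL, ExchangeChain.lintegral_limitCorr hα hν hγ k,
        ← ofReal_integral_eq_lintegral_ofReal h1 (Eventually.of_forall hf0),
        EReal.coe_ennreal_ofReal, max_eq_left (integral_nonneg hf0), integral_const_mul,
        ← EReal.coe_add]
      rfl
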